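/- Let $n\ge 2$, $N\ge 0$ and $0\le p\le n-1$ be integers and $\lambda\in\mathbb{C}$. Let $\Omega^p(\mathbb{R}^d)$ be the space of smooth complex-valued $p$-forms on $\mathbb{R}^d$ ($\Omega^{-1}=0$), let $\iota:\mathbb{R}^{n-1}\to\mathbb{R}^n$, $\iota(x)=(x,0)$, let $d,\delta$ and $\bar d,\bar\delta$ be the differential and co-differential ($\delta\omega=-\sum_i\partial_i\omega(e_i,\cdot)$) on forms on $\mathbb{R}^{n-1}$ and $\mathbb{R}^n$, $\Delta=d\delta+\delta d$, let $i_{\partial_n}$ be the insertion of $\partial_n$ into the first slot, and let $\partial_n$ act on forms on $\mathbb{R}^n$ by differentiating coefficients. Empty sums are $0$ and empty products are $1$. Put $$\beta_i^{(N)}(\lambda)=(-1)^i2^N\frac{N!}{(2N+1)!}\binom Ni\prod_{k=i+1}^N(2\lambda+n-2k)\prod_{k=1}^i(2\lambda+n-2k-2N-1)\quad(0\le i\le N),$$ $$\gamma_i^{(N)}(\lambda;p)=(\lambda+p-2i)\beta_i^{(N)}(\lambda)-(\lambda+p-2i+1)\beta_{i-1}^{(N)}(\lambda)\quad(1\le i\le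 N),$$ $$a_j^{(N)}(\lambda)=(-2)^{N-j}\frac{N!}{j!(2N-2j)!}\prod_{k=j}^{N-1}(2\lambda-4N+2k+n+1),\qquad b_j^{(N)}(\lambda)=(-2)^{N-j}\frac{N!}{j!(2N-2j+1)!}\prod_{k=j}^{N-1}(2\lambda-4N+2k+n-1)\quad(0\le j\le N),$$ and define $$D_{2N+1}^{(p\to p)}(\lambda)=\sum_{i=1}^N\gamma_i^{(N)}(\lambda;p)(d\delta)^{N-i}d\,\iota^*i_{\partial_n}(\bar\delta\bar d)^i+(\lambda+p)\sum_{i=0}^N\beta_i^{(N)}(\lambda)(d\delta)^{N-i}d\,\iota^*i_{\partial_n}(\bar d\bar\delta)^i+(\lambda+p-2N-1)\sum_{i=0}^N\beta_i^{(N)}(\lambda)(\delta d)^{N-i}\iota^*i_{\partial_n}\bar d(\bar\delta\bar d)^i.$$ For each $d\in\{n-1,n\}$, let $\mathfrak{so}(d+1,1)$ be the Lie algebra of endomorphisms of $\mathbb{R}^{d+2}$ that are skew for the quadratic form $2y_0y_{d+1}+y_1^2+\dots+y_d^2$; its group acts (locally) on $\mathbb{R}^d$ by conformal maps through the chart $x\mapsto\mathbb{R}(1,x,-|x|^2/2)$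 of the projectivized null cone. Let $\pi_\mu^{(p)}(\gamma)=e^{\mu\Phi_\gamma}\gamma_*$, where $\gamma_*g_0=e^{2\Phi_\gamma}g_0$ for the Euclidean metric $g_0$ and $\gamma_*=(\gamma^{-1})^*$, and let $d\pi_\mu^{(p)}(X)\omega=\frac{d}{dt}\big|_{t=0}\pi_\mu^{(p)}(\exp tX)\omega$ (pointwise). Write $\pi_\mu^{(p)}$ for $d=n$ and $\pi'^{(p)}_\mu$ for $d=n-1$, and embed $\mathfrak{so}(n,1)\subset\mathfrak{so}(n+1,1)$ by extending by zero on the coordinate $x_n$. Then: (1) $D_{2N+1}^{(p\to p)}(\lambda)$ is a linear differential operator $\Omega^p(\mathbb{R}^n)\to\Omega^p(\mathbb{R}^{n-1})$ of order at most $2N+1$. (2) For $1\le i\le N$, $$\gamma_i^{(N)}(\lambda;p)=(-1)^i2^N\frac{N!}{(N+1)(2N+1)!}\binom{N+1}i\big[(\lambda+p-2N-1)(N+1)(2\lambda+n-2i)+(\lambda+n-p)(2N+1)(N-i+1)\big]\prod_{k=i+1}^N(2\lambda+n-2k)\prod_{k=1}^{i-1}(2\lambda+n-2k-2N-1).$$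 (3) On $\Omega^p(\mathbb{R}^n)$, $$D_{2N+1}^{(p\to p)}(\lambda)=\sum_{j=0}^N(-1)^{N-j}(\lambda+p-2N-1)b_j^{(N)}(\lambda)\Delta^j\iota^*\partial_n^{2N+1-2j}+\sum_{j=0}^N(-1)^{N-j}a_j^{(N)}(\lambda-1)\Delta^jd\,\iota^*i_{\partial_n}\partial_n^{2N-2j}+\sum_{j=0}^{N-1}(-1)^{N-j-1}2N\,b_j^{(N-1)}(\lambda-1)\Delta^jd\delta\,\iota^*\partial_n^{2N-1-2j}.$$ (4) For all $X\in\mathfrak{so}(n,1)$ and all $\omega\in\Omega^p(\mathbb{R}^n)$, the derivatives that define $d\pi^{(p)}_{-\lambda-p}(X)\omega$ and $d\pi'^{(p)}_{-\lambda+2N+1-p}(X)D_{2N+1}^{(p\to p)}(\lambda)\omega$ exist, $d\pi^{(p)}_{-\lambda-p}(X)\omega$ is smooth, and $$d\pi'^{(p)}_{-\lambda+2N+1-p}(X)\,D_{2N+1}^{(p\to p)}(\lambda)\,\omega=D_{2N+1}^{(p\to p)}(\lambda)\,d\pi^{(p)}_{-\lambda-p}(X)\,\omega.$$ -/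

import Mathlib

open scoped ContDiff InnerProductSpace

noncomputable section

namespace SymBreak

/-! ## Differential forms on Euclidean spaces -/

/-- The Euclidean space `ℝ^d`. -/
abbrev Euc (d : ℕ) : Type := EuclideanSpace ℝ (Fin d)

/-- Complex-valued differential `p`-forms on `ℝ^d`; the elements of `Ω^p(ℝ^d)` are those
which are smooth (`ContDiff ℝ ∞`). -/
abbrev Form (d p : ℕ) : Type := Euc d → (Euc d) [⋀^Fin p]→L[ℝ] ℂ

/-- The `i`-th standard basis vector of `ℝ^d`. -/
def stdVec (d : ℕ) (i : Fin d) : Euc d := EuclideanSpace.single i (1 : ℝ)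

/-- The exterior differential. -/
def extD {d p : ℕ} (w : Form d p) : Form d (p + 1) := extDeriv w

/-- Insertion of the constant vector field `v` into the first slot. -/
def insertVec {d p : ℕ} (v : Euc d) (w : Form d (p + 1)) : Form d p :=
  fun x => (w x).curryLeft v

/-- Derivative of (the coefficients of) a form in the constant direction `v`. -/
def dirDeriv {d p : ℕ} (v : Euc d) (w : Form d p) : Form d p :=
  fun x => fderiv ℝ w x v

/-- The co-differential `δw = - ∑ i, ∂_i w(e_i, …)`. -/
def codiff {d p : ℕ} (w : Form d (p + 1)) : Form d p :=
  fun x => - ∑ i : Fin d, insertVec (stdVec d i) (dirDeriv (stdVec d i) w) x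

/-- The composition `d δ` on `p`-forms; it vanishes on functions. -/
def extDCodiff {d : ℕ} : (p : ℕ) → Form d p → Form d p
  | 0, _ => 0
  | _ + 1, w => extD (codiff w)

/-- The composition `δ d` on `p`-forms. -/
def codiffExtD {d : ℕ} (p : ℕ) (w : Form d p) : Form d p := codiff (extD w)

/-- The form Laplacian `Δ = δ d + d δ`. -/
def laplace {d : ℕ} (p : ℕ) (w : Form d p) : Form d p :=
  codiffExtD p w + extDCodiff p w

/-! ## The hyperplane `ℝ^m ⊂ ℝ^(m+1)` -/

/-- The embedding `ι : ℝ^m → ℝ^(m+1)`, `(x_1, …, x_m) ↦ (x_1, …, x_m, 0)`. -/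
def incl (m : ℕ) : Euc m →L[ℝ] Euc (m + 1) :=
  LinearMap.toContinuousLinearMap
    { toFun := fun x => WithLp.toLp 2 (Fin.snoc (α := fun _ => ℝ) (fun i : Fin m => x i) 0)
      map_add' := by
        intro x y
        ext i
        refine Fin.lastCases ?_ (fun j => ?_) i <;> simp
      map_smul' := by
        intro c x
        ext i
        refine Fin.lastCases ?_ (fun j => ?_) i <;> simp }

/-- The orthogonal projection `ℝ^(m+1) → ℝ^m`, `(x_1, …, x_(m+1)) ↦ (x_1, …, x_m)`. -/
def proj (m : ℕ) : Euc (m + 1) →L[ℝ] Euc m :=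
  LinearMap.toContinuousLinearMap
    { toFun := fun x => WithLp.toLp 2 (fun i : Fin m => x i.castSucc)
      map_add' := by
        intro x y
        ext i
        simp
      map_smul' := by
        intro c x
        ext i
        simp }

/-- The normal vector `∂_n` of the hyperplane, where `n = m + 1`. -/
def normalVec (m : ℕ) : Euc (m + 1) := stdVec (m + 1) (Fin.last m)

/-- The pull-back `ι^*` of forms. -/
def restrict {m p : ℕ} (w : Form (m + 1) p) : Form m p :=
  fun x => (w (incl m x)).compContinuousLinearMap (incl m)

/-- The derivative `∂_n` acting on forms on `ℝ^n`, where `n = m + 1`. -/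
def normalDeriv {m : ℕ} (p : ℕ) (w : Form (m + 1) p) : Form (m + 1) p :=
  dirDeriv (normalVec m) w

/-- The composition `d ι^* i_{∂_n}` on `p`-forms; it vanishes on functions. -/
def extDRestrictInsert {m : ℕ} : (p : ℕ) → Form (m + 1) p → Form m p
  | 0, _ => 0
  | _ + 1, w => extD (restrict (insertVec (normalVec m) w))

/-- The composition `ι^* i_{∂_n} d̄` on `p`-forms. -/
def restrictInsertExtD {m : ℕ} (p : ℕ) (w : Form (m + 1) p) : Form m p :=
  restrict (insertVec (normalVec m) (extD w))

/-- `D` maps smooth `p`-forms on `ℝ^(m+1)` to smooth `q`-forms on `ℝ^m`, is `ℂ`-linear on them,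
and `(D w)(x)` depends only on the `k`-jet of `w` at `ι x`: that is, `D` is a linear differential
operator of order at most `k`. -/
def IsDiffOpOfOrderLE {m p q : ℕ} (k : ℕ) (D : Form (m + 1) p → Form m q) : Prop :=
  (∀ w : Form (m + 1) p, ContDiff ℝ ∞ w → ContDiff ℝ ∞ (D w)) ∧
  (∀ (a b : ℂ) (w η : Form (m + 1) p), ContDiff ℝ ∞ w → ContDiff ℝ ∞ η →
    D (a • w + b • η) = a • D w + b • D η) ∧
  (∀ w : Form (m + 1) p, ContDiff ℝ ∞ w → ∀ x : Euc m,
    (∀ j ≤ k, iteratedFDeriv ℝ j w (incl m x) = 0) → D w x = 0)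

/-! ## Coefficients -/

/-- The coefficients `β_i^{(N)}(λ)` in dimension `n`. -/
def betaCoeff (n N i : ℕ) (lam : ℂ) : ℂ :=
  (-1) ^ i * 2 ^ N * ((N.factorial : ℂ) / ((2 * N + 1).factorial : ℂ)) * (N.choose i : ℂ)
    * (∏ k ∈ Finset.Icc (i + 1) N, (2 * lam + n - 2 * k))
    * ∏ k ∈ Finset.Icc 1 i, (2 * lam + n - 2 * k - 2 * N - 1)

/-- The coefficients `γ_i^{(N)}(λ;p)`, `1 ≤ i ≤ N`, in dimension `n`. -/
def gammaCoeff (n N p i : ℕ) (lam : ℂ) : ℂ :=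
  (lam + p - 2 * i) * betaCoeff n N i lam
    - (lam + p - 2 * i + 1) * betaCoeff n N (i - 1) lam

/-- The product expression for `γ_i^{(N)}(λ;p)`, `1 ≤ i ≤ N`. -/
def gammaProd (n N p i : ℕ) (lam : ℂ) : ℂ :=
  (-1) ^ i * 2 ^ N * ((N.factorial : ℂ) / ((N + 1) * ((2 * N + 1).factorial : ℂ)))
    * ((N + 1).choose i : ℂ)
    * ((lam + p - 2 * N - 1) * (N + 1) * (2 * lam + n - 2 * i)
        + (lam + n - p) * (2 * N + 1) * (N - i + 1))
    * (∏ k ∈ Finset.Icc (i + 1) N, (2 * lam + n - 2 * k))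
    * ∏ k ∈ Finset.Icc 1 (i - 1), (2 * lam + n - 2 * k - 2 * N - 1)

/-- The even Gegenbauer coefficients `a_j^{(N)}(λ)`, `0 ≤ j ≤ N`, normalized by `a_N^{(N)} = 1`. -/
def gegenEven (n N j : ℕ) (lam : ℂ) : ℂ :=
  (-2) ^ (N - j) * ((N.factorial : ℂ) / ((j.factorial : ℂ) * ((2 * N - 2 * j).factorial : ℂ)))
    * ∏ k ∈ Finset.Ico j N, (2 * lam - 4 * N + 2 * k + n + 1)

/-- The odd Gegenbauer coefficients `b_j^{(N)}(λ)`, `0 ≤ j ≤ N`, normalized by `b_N^{(N)} = 1`. -/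
def gegenOdd (n N j : ℕ) (lam : ℂ) : ℂ :=
  (-2) ^ (N - j) * ((N.factorial : ℂ) / ((j.factorial : ℂ) * ((2 * N - 2 * j + 1).factorial : ℂ)))
    * ∏ k ∈ Finset.Ico j N, (2 * lam - 4 * N + 2 * k + n - 1)

/-! ## The odd-order family of the first type -/

/-- The operator `D_{2N+1}^{(p → p)}(λ) : Ω^p(ℝ^n) → Ω^p(ℝ^(n-1))`, `n = m + 1`, in terms of
`d, δ, d̄, δ̄, ι^*` and `i_{∂_n}`. -/
def oddOp (m N p : ℕ) (lam : ℂ) (w : Form (m + 1) p) : Form m p :=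
  (∑ i ∈ Finset.Icc 1 N, gammaCoeff (m + 1) N p i lam •
      (extDCodiff p)^[N - i] (extDRestrictInsert p ((codiffExtD p)^[i] w)))
  + (lam + p) • (∑ i ∈ Finset.range (N + 1), betaCoeff (m + 1) N i lam •
      (extDCodiff p)^[N - i] (extDRestrictInsert p ((extDCodiff p)^[i] w)))
  + (lam + p - 2 * N - 1) • (∑ i ∈ Finset.range (N + 1), betaCoeff (m + 1) N i lam •
      (codiffExtD p)^[N - i] (restrictInsertExtD p ((codiffExtD p)^[i] w)))

/-- The Gegenbauer form of the operator, in terms of `Δ`, `d`, `δ` on `ℝ^(n-1)`, `ι^*`, `i_{∂_n}`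
and powers of `∂_n`, with Gegenbauer coefficients; here `n = m + 1`. -/
def oddOpGegenbauer (m N p : ℕ) (lam : ℂ) (w : Form (m + 1) p) : Form m p :=
  (∑ j ∈ Finset.range (N + 1),
      ((-1) ^ (N - j) * ((lam + p - 2 * N - 1) * gegenOdd (m + 1) N j lam)) •
        (laplace p)^[j] (restrict ((normalDeriv p)^[2 * N + 1 - 2 * j] w)))
  + (∑ j ∈ Finset.range (N + 1),
      ((-1) ^ (N - j) * gegenEven (m + 1) N j (lam - 1)) •
        (laplace p)^[j] (extDRestrictInsert p ((normalDeriv p)^[2 * N - 2 * j] w)))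
  + (∑ j ∈ Finset.range N,
      ((-1) ^ (N - j - 1) * (2 * N * gegenOdd (m + 1) (N - 1) j (lam - 1))) •
        (laplace p)^[j] (extDCodiff p (restrict ((normalDeriv p)^[2 * N - 1 - 2 * j] w))))

/-! ## The conformal Lie algebras and their representations on forms -/

/-- The space `ℝ^(d+2) = ℝ e_0 ⊕ ℝ^d ⊕ ℝ e_(d+1)`. -/
abbrev Amb (d : ℕ) : Type := ℝ × Euc d × ℝ

/-- The bilinear form on `ℝ^(d+2)` of the quadratic form
`2 y_0 y_(d+1) + y_1^2 + … + y_d^2`, of signature `(d+1,1)`. -/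
def ambForm {d : ℕ} (y z : Amb d) : ℝ :=
  y.1 * z.2.2 + y.2.2 * z.1 + ⟪y.2.1, z.2.1⟫_ℝ

/-- The Lie algebra `so(d+1,1,ℝ)` of the isometry group of `ambForm`. -/
def soAlg (d : ℕ) : Set (Amb d →L[ℝ] Amb d) :=
  {X | ∀ y z, ambForm (X y) z + ambForm y (X z) = 0}

/-- The action of the conformal group on `ℝ^d`, seen as the chart `x ↦ ℝ (1, x, -|x|^2/2)` of the
projectivized null cone. It is meaningful where the first component of `A (1, x, -|x|^2/2)` does
not vanish; this holds near any given point if `A` is close to the identity. -/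
def moebius {d : ℕ} (A : Amb d →L[ℝ] Amb d) (x : Euc d) : Euc d :=
  (A (1, x, -‖x‖ ^ 2 / 2)).1⁻¹ • (A (1, x, -‖x‖ ^ 2 / 2)).2.1

open Classical in
/-- The function `Φ` with `f^* g_0 = e^{2Φ} g_0` for a conformal map `f` and the Euclidean
metric `g_0`. -/
def logFactor {d : ℕ} (f : Euc d → Euc d) (x : Euc d) : ℝ :=
  if h : ConformalAt f x then Real.log (conformalFactorAt h) / 2 else 0

/-- The form `e^{μ Φ_γ} γ_* w`, written through the inverse `f = γ^{-1}`: here `γ_* = f^*` and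
`γ_* g_0 = f^* g_0 = e^{2 Φ_γ} g_0`. -/
def weightedPush {d p : ℕ} (μ : ℂ) (f : Euc d → Euc d) (w : Form d p) : Form d p :=
  fun x => Complex.exp (μ * (logFactor f x : ℂ)) •
    (w (f x)).compContinuousLinearMap (fderiv ℝ f x)

/-- The curve `t ↦ (π_μ^{(p)}(exp (t X)) w)(x)`, where `π_μ^{(p)}(γ) = e^{μ Φ_γ} γ_*`. -/
def repCurve {d p : ℕ} (μ : ℂ) (X : Amb d →L[ℝ] Amb d) (w : Form d p) (x : Euc d) (t : ℝ) :
    (Euc d) [⋀^Fin p]→L[ℝ] ℂ :=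
  weightedPush μ (moebius (NormedSpace.exp (-(t • X)))) w x

/-- The infinitesimal representation `dπ_μ^{(p)}(X)`. -/
def dRep {d p : ℕ} (μ : ℂ) (X : Amb d →L[ℝ] Amb d) (w : Form d p) : Form d p :=
  fun x => deriv (repCurve μ X w x) 0

/-- The block embedding `so(n,1,ℝ) → so(n+1,1,ℝ)`, `n = m + 1`, which extends `X` by zero on the
coordinate `x_n`. -/
def soEmbed {m : ℕ} (X : Amb m →L[ℝ] Amb m) : Amb (m + 1) →L[ℝ] Amb (m + 1) :=
  ((ContinuousLinearMap.id ℝ ℝ).prodMap ((incl m).prodMap (ContinuousLinearMap.id ℝ ℝ))).comp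
    (X.comp
      ((ContinuousLinearMap.id ℝ ℝ).prodMap ((proj m).prodMap (ContinuousLinearMap.id ℝ ℝ))))

end SymBreak

end

open scoped ContDiff InnerProductSpace

noncomputable section

namespace SymBreak

/-! ## Smooth forms of all degrees -/

/-! Everything is reduced to algebra in the endomorphism ring of `Forms`, the families of smooth
forms in all degrees. There the partial derivatives, the insertions, the exterior multiplications by
coordinate covectors and the multiplications by functions obey simple (anti)commutation relations, d
and δ are sums of products of them, and the conventions in degree zero are built in.

Gegenbauer form. Put κ = λ + p - 2N - 1. The operator equals Σ_j (-1)^(N-j) b_j(λ) B_j, where, with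
k = 2(N-j) + 1, B_j = κ Δ^j ι^*∂_n^k + k Δ^j d ι^* i_n ∂_n^(k-1) + 2j Δ^(j-1) dδ ι^*∂_n^k
(`gegenBlock`). This is (3), because a_j^(N)(λ-1) and 2N b_(j-1)^(N-1)(λ-1) are multiples of
b_j^(N)(λ). To get there, d² = δ² = 0 and Cartan's formula turn all words in dδ and δd into powers
of the two Laplacians (`oddForms_eq_sum`). Then ι^*Δ̄ = Δι^* - ι^*∂_n² is expanded binomially, and
Σ_i C(i,r) β_i = b_(N-r) follows from a Vandermonde convolution (`sum_betaCoeff_mul_choose`,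
`oddForms_eq_sum_gegenBlock`).

Covariance. Differentiating the action on the null cone gives dπ_μ(X) = -(L_ξ + μσ) for a quadratic
conformal field ξ with affine conformal factor σ (`hasDerivAt_repCurve_val`). For X in the
subalgebra, ξ is tangent to the hyperplane, so its commutators with ι^*∂_n^k, with ι^* i_n ∂_n^k and
with Δ^j are explicit constant-coefficient terms in the gradient c of σ. A block with indices (j, k)
therefore intertwines up to multiples of two members of one family of defects, those with indices
(j-1, k) and (j, k-2) (`gegenBlock_confOp`). Neighbouring blocks of the sum share these defects, so
all of them cancel as soon as the coefficients satisfy a two-term recursion, and the signed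
Gegenbauer coefficients do (`gegenSigned_succ`).

The order bound is read off from the blocks, each of total order 2N + 1. The product formula for γ_i
compares two consecutive β's, which differ in one factor of each product. -/

/-- The smooth `p`-forms on `ℝ^d`. -/
def smoothForm (d p : ℕ) : Submodule ℂ (Form d p) where
  carrier := {w | ContDiff ℝ ∞ w}
  add_mem' {a b} ha hb := by
    rw [Set.mem_ofPred_eq] at *
    exact ContDiff.add ha hb
  zero_mem' := by
    rw [Set.mem_ofPred_eq]
    exact contDiff_const
  smul_mem' c a ha := by
    rw [Set.mem_ofPred_eq] at *
    exact contDiff_const.smul ha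

/-- The smooth complex-valued functions on `ℝ^d`. -/
def smoothFun (d : ℕ) : Subalgebra ℂ (Euc d → ℂ) where
  carrier := {f | ContDiff ℝ ∞ f}
  mul_mem' {a b} ha hb := by
    rw [Set.mem_ofPred_eq] at *
    exact ContDiff.mul ha hb
  add_mem' {a b} ha hb := by
    rw [Set.mem_ofPred_eq] at *
    exact ContDiff.add ha hb
  algebraMap_mem' c := by
    rw [Set.mem_ofPred_eq]
    exact contDiff_const

lemma contDiff_form {d p : ℕ} (w : smoothForm d p) : ContDiff ℝ ∞ (w : Form d p) := w.2

lemma differentiable_form {d p : ℕ} (w : smoothForm d p) :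
    Differentiable ℝ (w : Form d p) := (contDiff_form w).differentiable (by simp)

lemma contDiff_fun {d : ℕ} (f : smoothFun d) : ContDiff ℝ ∞ (f : Euc d → ℂ) := f.2

lemma differentiable_fun {d : ℕ} (f : smoothFun d) : Differentiable ℝ (f : Euc d → ℂ) :=
  (contDiff_fun f).differentiable (by simp)

/-- Families of smooth forms on `ℝ^d`, one in each degree. -/
def Forms (d : ℕ) : Type := (p : ℕ) → smoothForm d p

instance (d : ℕ) : AddCommGroup (Forms d) :=
  inferInstanceAs (AddCommGroup ((p : ℕ) → smoothForm d p))

instance (d : ℕ) : Module ℂ (Forms d) :=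
  inferInstanceAs (Module ℂ ((p : ℕ) → smoothForm d p))

/-- The form of degree `p` in a family. -/
def Forms.val {d : ℕ} (w : Forms d) (p : ℕ) : Form d p := ((w p : smoothForm d p) : Form d p)

lemma Forms.contDiff_val {d : ℕ} (w : Forms d) (p : ℕ) : ContDiff ℝ ∞ (w.val p) :=
  contDiff_form (w p)

lemma Forms.differentiable_val {d : ℕ} (w : Forms d) (p : ℕ) : Differentiable ℝ (w.val p) :=
  differentiable_form (w p)

lemma Forms.ext_val {d : ℕ} {w η : Forms d} (h : ∀ p x, w.val p x = η.val p x) : w = η :=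
  funext fun p => Subtype.ext (funext fun x => h p x)

/-- The form of degree `p` in a family, as a linear map. -/
def Forms.valₗ (d p : ℕ) : Forms d →ₗ[ℂ] Form d p where
  toFun w := w.val p
  map_add' _ _ := rfl
  map_smul' _ _ := rfl

lemma Forms.val_zero {d : ℕ} (p : ℕ) : (0 : Forms d).val p = 0 := rfl

lemma Forms.val_add {d : ℕ} (w η : Forms d) (p : ℕ) : (w + η).val p = w.val p + η.val p := rfl

lemma Forms.val_smul {d : ℕ} (c : ℂ) (w : Forms d) (p : ℕ) : (c • w).val p = c • w.val p := rfl

lemma Forms.val_sum {d : ℕ} {ι : Type*} (s : Finset ι) (w : ι → Forms d) (p : ℕ) :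
    (∑ i ∈ s, w i).val p = ∑ i ∈ s, (w i).val p := map_sum (Forms.valₗ d p) w s

/-! ### Exterior algebra of alternating maps: multiplication by covectors, insertion of vectors -/

/-- The `i`-th coordinate covector. -/
def coordCLM (d : ℕ) (i : Fin d) : Euc d →L[ℝ] ℝ := EuclideanSpace.proj i

@[simp] lemma coordCLM_apply (d : ℕ) (i : Fin d) (x : Euc d) : coordCLM d i x = x i := rfl

/-- Exterior multiplication of an alternating map by a covector. -/
def wedgeCovec {d p : ℕ} (l : Euc d →L[ℝ] ℝ) (f : (Euc d) [⋀^Fin p]→L[ℝ] ℂ) :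
    (Euc d) [⋀^Fin (p + 1)]→L[ℝ] ℂ :=
  ContinuousAlternatingMap.alternatizeUncurryFin (l.smulRight f)

lemma wedgeCovec_apply {d p : ℕ} (l : Euc d →L[ℝ] ℝ) (f : (Euc d) [⋀^Fin p]→L[ℝ] ℂ)
    (v : Fin (p + 1) → Euc d) :
    wedgeCovec l f v = ∑ k : Fin (p + 1), (-1 : ℂ) ^ (k : ℕ) * ((l (v k) : ℂ) * f (k.removeNth v)) := by
  simp [wedgeCovec, ContinuousAlternatingMap.alternatizeUncurryFin_apply]

/-- In the alternating sum for l ∧ f evaluated at (u, v), the first term is l(u) f(v). In all others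
u is still an argument of f, and they cancel against l ∧ i_u f because their signs are shifted by
one. -/
lemma curryLeft_wedgeCovec {d p : ℕ} (l : Euc d →L[ℝ] ℝ) (u : Euc d)
    (f : (Euc d) [⋀^Fin (p + 1)]→L[ℝ] ℂ) :
    (wedgeCovec l f).curryLeft u + wedgeCovec l (f.curryLeft u) = (l u : ℂ) • f := by
  ext v
  simp only [ContinuousAlternatingMap.add_apply, ContinuousAlternatingMap.curryLeft_apply_apply,
    wedgeCovec_apply, ContinuousAlternatingMap.smul_apply, smul_eq_mul]
  rw [Fin.sum_univ_succ, add_assoc, ← Finset.sum_add_distrib]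
  have h0 : (0 : Fin (p + 2)).removeNth (Matrix.vecCons u v) = v := by
    ext i; simp [Fin.removeNth]
  have hs : ∀ k : Fin (p + 1), (k.succ).removeNth (Matrix.vecCons u v)
      = Matrix.vecCons u (k.removeNth v) := by
    intro k
    ext i
    refine Fin.cases ?_ (fun j => ?_) i <;> simp [Fin.removeNth]
  rw [h0, Finset.sum_eq_zero]
  · simp
  · intro k _
    rw [hs]
    simp [pow_succ]

lemma curryLeft_wedgeCovec_zero {d : ℕ} (l : Euc d →L[ℝ] ℝ) (u : Euc d)
    (f : (Euc d) [⋀^Fin 0]→L[ℝ] ℂ) :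
    (wedgeCovec l f).curryLeft u = (l u : ℂ) • f := by
  ext v
  simp only [ContinuousAlternatingMap.curryLeft_apply_apply,
    wedgeCovec_apply, ContinuousAlternatingMap.smul_apply, smul_eq_mul]
  rw [Fin.sum_univ_succ, Finset.univ_eq_empty, Finset.sum_empty, add_zero,
    Subsingleton.elim v ((0 : Fin 1).removeNth (Matrix.vecCons u v))]
  simp

/-- Polarization of i_u i_u = 0 at u + v. -/
lemma curryLeft_curryLeft_swap {d p : ℕ} (u v : Euc d) (f : (Euc d) [⋀^Fin (p + 2)]→L[ℝ] ℂ) :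
    (f.curryLeft u).curryLeft v = - (f.curryLeft v).curryLeft u := by
  have h := ContinuousAlternatingMap.curryLeft_same f (u + v)
  have hu := ContinuousAlternatingMap.curryLeft_same f u
  have hv := ContinuousAlternatingMap.curryLeft_same f v
  simp only [map_add, ContinuousAlternatingMap.curryLeft_add,
    _root_.add_apply, hu, hv, zero_add, add_zero] at h
  exact eq_neg_of_add_eq_zero_right h

/-- Exterior multiplication by a covector as a continuous linear map. -/
def wedgeCLM {d : ℕ} (p : ℕ) (l : Euc d →L[ℝ] ℝ) :
    (Euc d) [⋀^Fin p]→L[ℝ] ℂ →L[ℝ] (Euc d) [⋀^Fin (p + 1)]→L[ℝ] ℂ :=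
  (ContinuousAlternatingMap.alternatizeUncurryFinCLM ℝ (Euc d) ℂ).comp
    (ContinuousLinearMap.smulRightL ℝ (Euc d) ((Euc d) [⋀^Fin p]→L[ℝ] ℂ) l)

/-- Insertion of a vector as a continuous linear map. -/
def insertCLM {d : ℕ} (p : ℕ) (v : Euc d) :
    (Euc d) [⋀^Fin (p + 1)]→L[ℝ] ℂ →L[ℝ] (Euc d) [⋀^Fin p]→L[ℝ] ℂ :=
  (ContinuousLinearMap.apply ℝ ((Euc d) [⋀^Fin p]→L[ℝ] ℂ) v).comp
    (ContinuousAlternatingMap.curryLeftLI (𝕜 := ℝ) (E := Euc d) (F := ℂ)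
      (n := p)).toContinuousLinearMap

lemma wedgeCovec_add {d p : ℕ} (l : Euc d →L[ℝ] ℝ) (f g : (Euc d) [⋀^Fin p]→L[ℝ] ℂ) :
    wedgeCovec l (f + g) = wedgeCovec l f + wedgeCovec l g := map_add (wedgeCLM p l) f g

lemma wedgeCovec_smul {d p : ℕ} (l : Euc d →L[ℝ] ℝ) (c : ℂ) (f : (Euc d) [⋀^Fin p]→L[ℝ] ℂ) :
    wedgeCovec l (c • f) = c • wedgeCovec l f := by
  ext v
  simp only [wedgeCovec_apply, ContinuousAlternatingMap.smul_apply, smul_eq_mul, Finset.mul_sum]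
  exact Finset.sum_congr rfl fun k _ => by ring

lemma contDiff_dirDeriv {d p : ℕ} (v : Euc d) {w : Form d p} (hw : ContDiff ℝ ∞ w) :
    ContDiff ℝ ∞ (dirDeriv v w) :=
  (hw.fderiv_right (m := ∞) (by simp)).clm_apply contDiff_const

lemma contDiff_insertVec {d p : ℕ} (v : Euc d) {w : Form d (p + 1)} (hw : ContDiff ℝ ∞ w) :
    ContDiff ℝ ∞ (insertVec v w) :=
  (insertCLM p v).contDiff.comp hw

/-! ### The elementary operators on forms of all degrees -/

/-- The insertion of the `i`-th standard vector into forms of all degrees. -/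
def ins {d : ℕ} (i : Fin d) : Module.End ℂ (Forms d) where
  toFun w := fun p => ⟨insertVec (stdVec d i) (w.val (p + 1)), contDiff_insertVec _ (w.contDiff_val (p + 1))⟩
  map_add' _ _ := rfl
  map_smul' _ _ := rfl

/-- The `i`-th partial derivative on forms of all degrees. -/
def dir {d : ℕ} (i : Fin d) : Module.End ℂ (Forms d) where
  toFun w := fun p => ⟨dirDeriv (stdVec d i) (w.val p), contDiff_dirDeriv _ (w.contDiff_val p)⟩
  map_add' w η := Forms.ext_val fun p x => by
    change fderiv ℝ (w.val p + η.val p) x _ = _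
    rw [fderiv_add (w.differentiable_val p).differentiableAt (η.differentiable_val p).differentiableAt]
    rfl
  map_smul' c w := Forms.ext_val fun p x => by
    change fderiv ℝ (c • w.val p) x _ = _
    rw [fderiv_const_smul (w.differentiable_val p).differentiableAt]
    rfl

/-- Exterior multiplication by the `i`-th coordinate covector on forms of all degrees. -/
def wdg {d : ℕ} (i : Fin d) : Module.End ℂ (Forms d) where
  toFun w
    | 0 => 0
    | p + 1 => ⟨fun x => wedgeCovec (coordCLM d i) (w.val p x),
        (wedgeCLM p (coordCLM d i)).contDiff.comp (w.contDiff_val p)⟩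
  map_add' w η := Forms.ext_val fun p x => by
    cases p with
    | zero => exact (add_zero (0 : (Euc d) [⋀^Fin 0]→L[ℝ] ℂ)).symm
    | succ p => exact wedgeCovec_add _ _ _
  map_smul' c w := Forms.ext_val fun p x => by
    cases p with
    | zero => exact (smul_zero (A := (Euc d) [⋀^Fin 0]→L[ℝ] ℂ) c).symm
    | succ p => exact wedgeCovec_smul _ _ _

/-- Multiplication of forms by smooth functions. -/
def mulF {d : ℕ} : smoothFun d →ₐ[ℂ] Module.End ℂ (Forms d) where
  toFun f :=
    { toFun := fun w p => ⟨fun x => (f : Euc d → ℂ) x • w.val p x,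
        (contDiff_fun f).smul (w.contDiff_val p)⟩
      map_add' := fun w η => Forms.ext_val fun p x => smul_add _ _ _
      map_smul' := fun c w => Forms.ext_val fun p x =>
        smul_comm ((f : Euc d → ℂ) x) c (w.val p x) }
  map_one' := LinearMap.ext fun w => Forms.ext_val fun p x => one_smul _ _
  map_mul' f g := LinearMap.ext fun w => Forms.ext_val fun p x => mul_smul _ _ _
  map_zero' := LinearMap.ext fun w => Forms.ext_val fun p x => zero_smul ℂ (w.val p x)
  map_add' f g := LinearMap.ext fun w => Forms.ext_val fun p x =>
    add_smul ((f : Euc d → ℂ) x) ((g : Euc d → ℂ) x) (w.val p x)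
  commutes' c := LinearMap.ext fun w => Forms.ext_val fun p x => rfl

/-- The degree operator. -/
def degOp {d : ℕ} : Module.End ℂ (Forms d) where
  toFun w := fun p => (p : ℂ) • (w p : smoothForm d p)
  map_add' w η := Forms.ext_val fun p x => smul_add (p : ℂ) (w.val p x) (η.val p x)
  map_smul' c w := Forms.ext_val fun p x => smul_comm (p : ℂ) c (w.val p x)

/-- The `i`-th partial derivative of smooth functions. -/
def pderiv {d : ℕ} (i : Fin d) : Derivation ℂ (smoothFun d) (smoothFun d) :=
  Derivation.mk'
    { toFun := fun f => ⟨fun x => fderiv ℝ (f : Euc d → ℂ) x (stdVec d i),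
        ((contDiff_fun f).fderiv_right (m := ∞) (by simp)).clm_apply contDiff_const⟩
      map_add' := fun f g => Subtype.ext <| funext fun x => by
        change fderiv ℝ ((f : Euc d → ℂ) + (g : Euc d → ℂ)) x _ = _
        rw [fderiv_add (differentiable_fun f).differentiableAt (differentiable_fun g).differentiableAt]
        rfl
      map_smul' := fun c f => Subtype.ext <| funext fun x => by
        change fderiv ℝ (c • (f : Euc d → ℂ)) x _ = _
        rw [fderiv_const_smul (differentiable_fun f).differentiableAt]
        rfl }
    fun f g => Subtype.ext <| funext fun x => by
      change fderiv ℝ ((f : Euc d → ℂ) * (g : Euc d → ℂ)) x _ = _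
      rw [fderiv_mul (differentiable_fun f).differentiableAt (differentiable_fun g).differentiableAt]
      rfl

lemma pderiv_apply {d : ℕ} (i : Fin d) (f : smoothFun d) (x : Euc d) :
    (pderiv i f : Euc d → ℂ) x = fderiv ℝ (f : Euc d → ℂ) x (stdVec d i) := rfl

/-! ### Commutation relations -/

section Relations

variable {d : ℕ} (i j : Fin d) (f : smoothFun d)

lemma ins_mul_ins : (ins i * ins j : Module.End ℂ (Forms d)) = - (ins j * ins i) :=
  LinearMap.ext fun w => Forms.ext_val fun p x =>
    curryLeft_curryLeft_swap (stdVec d j) (stdVec d i) (w.val (p + 2) x)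

lemma coordCLM_stdVec : coordCLM d i (stdVec d j) = if i = j then 1 else 0 := by
  simp [stdVec]

lemma ins_mul_wdg : (ins i * wdg j : Module.End ℂ (Forms d))
    = (if i = j then 1 else 0) - wdg j * ins i := by
  refine LinearMap.ext fun w => Forms.ext_val fun p x => ?_
  have key : ((coordCLM d j (stdVec d i) : ℝ) : ℂ) • w.val p x
      = Forms.val ((if i = j then (1 : Module.End ℂ (Forms d)) else 0) w) p x := by
    rw [coordCLM_stdVec]
    by_cases h : i = j
    · simp [h]
    · simp only [h, Ne.symm h, if_false, Complex.ofReal_zero]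
      exact zero_smul ℂ (w.val p x)
  cases p with
  | zero =>
    have h2 := curryLeft_wedgeCovec_zero (coordCLM d j) (stdVec d i) (w.val 0 x)
    rw [key] at h2
    exact h2.trans (sub_zero _).symm
  | succ p =>
    have h2 := curryLeft_wedgeCovec (coordCLM d j) (stdVec d i) (w.val (p + 1) x)
    rw [key] at h2
    exact eq_sub_of_add_eq h2

lemma ins_mul_mulF : (ins i * mulF f : Module.End ℂ (Forms d)) = mulF f * ins i :=
  LinearMap.ext fun _ => Forms.ext_val fun _ _ => rfl

lemma wdg_mul_mulF : (wdg i * mulF f : Module.End ℂ (Forms d)) = mulF f * wdg i := by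
  refine LinearMap.ext fun w => Forms.ext_val fun p x => ?_
  cases p with
  | zero => exact (smul_zero (A := (Euc d) [⋀^Fin 0]→L[ℝ] ℂ) ((f : Euc d → ℂ) x)).symm
  | succ p => exact wedgeCovec_smul _ _ _

lemma dir_mul_mulF : (dir i * mulF f : Module.End ℂ (Forms d))
    = mulF f * dir i + mulF (pderiv i f) := by
  refine LinearMap.ext fun w => Forms.ext_val fun p x => ?_
  change fderiv ℝ (fun y => (f : Euc d → ℂ) y • w.val p y) x _ = _
  rw [fderiv_fun_smul (differentiable_fun f).differentiableAt (w.differentiable_val p).differentiableAt]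
  rfl

lemma fderiv_clm_comp {d p q : ℕ}
    (T : (Euc d) [⋀^Fin p]→L[ℝ] ℂ →L[ℝ] (Euc d) [⋀^Fin q]→L[ℝ] ℂ) (w : smoothForm d p)
    (x v : Euc d) : fderiv ℝ (fun y => T ((w : Form d p) y)) x v
      = T (fderiv ℝ (w : Form d p) x v) := by
  have h := (T.hasFDerivAt.comp x (differentiable_form w x).hasFDerivAt).fderiv
  exact congrArg (fun L => L v) h

lemma dir_mul_ins : (dir i * ins j : Module.End ℂ (Forms d)) = ins j * dir i :=
  LinearMap.ext fun w => Forms.ext_val fun p x =>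
    fderiv_clm_comp (insertCLM p (stdVec d j)) (w (p + 1)) x _

lemma dir_mul_wdg : (dir i * wdg j : Module.End ℂ (Forms d)) = wdg j * dir i := by
  refine LinearMap.ext fun w => Forms.ext_val fun p x => ?_
  cases p with
  | zero =>
    change fderiv ℝ (0 : Form d 0) x _ = 0
    simp
  | succ p => exact fderiv_clm_comp (wedgeCLM p (coordCLM d j)) (w p) x _

lemma dir_mul_dir : (dir i * dir j : Module.End ℂ (Forms d)) = dir j * dir i := by
  refine LinearMap.ext fun w => Forms.ext_val fun p x => ?_
  have hw := (w.contDiff_val p)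
  have hs : IsSymmSndFDerivAt ℝ (w.val p) x :=
    hw.contDiffAt.isSymmSndFDerivAt (by simp; exact WithTop.coe_le_coe.2 le_top)
  have h1 : ∀ u v : Euc d, fderiv ℝ (fun y => fderiv ℝ (w.val p) y v) x u
      = fderiv ℝ (fderiv ℝ (w.val p)) x u v := by
    intro u v
    have hd : DifferentiableAt ℝ (fderiv ℝ (w.val p)) x :=
      ((hw.fderiv_right (m := ∞) (by simp)).differentiable (by simp)).differentiableAt
    rw [fderiv_clm_apply hd (differentiableAt_const v)]
    simp
  change fderiv ℝ (fun y => fderiv ℝ (w.val p) y (stdVec d j)) x (stdVec d i)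
    = fderiv ℝ (fun y => fderiv ℝ (w.val p) y (stdVec d i)) x (stdVec d j)
  rw [h1, h1, hs]

end Relations

lemma sum_coord_stdVec {d : ℕ} (x : Euc d) : ∑ i, x i • stdVec d i = x := by
  ext j
  simp [stdVec, Pi.single_apply]

/-- Splitting off the first argument of an alternating map of degree p + 1 and antisymmetrizing
again multiplies it by p + 1. The sum over i is the coordinate expansion of the split-off argument.
-/
lemma sum_wdg_mul_ins {d : ℕ} : ∑ i, (wdg i * ins i : Module.End ℂ (Forms d)) = degOp := by
  refine LinearMap.ext fun w => Forms.ext_val fun p x => ?_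
  rw [LinearMap.sum_apply]
  cases p with
  | zero =>
    rw [Forms.val_sum, Finset.sum_apply]
    refine (Finset.sum_eq_zero fun i _ => rfl).trans ?_
    change 0 = ((0 : ℕ) : ℂ) • w.val 0 x
    rw [Nat.cast_zero]
    exact (zero_smul ℂ (w.val 0 x)).symm
  | succ p =>
    have h1 : ∑ i, (coordCLM d i).smulRight ((w.val (p + 1) x).curryLeft (stdVec d i))
        = (w.val (p + 1) x).curryLeft := by
      ext u : 1
      conv_rhs => rw [← sum_coord_stdVec u]
      simp [_root_.sum_apply]
    have h2 := ContinuousAlternatingMap.alternatizeUncurryFin_curryLeft (w.val (p + 1) x)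
    rw [← h1, ← ContinuousAlternatingMap.alternatizeUncurryFinCLM_apply, map_sum] at h2
    have h3 : Forms.val (∑ i, (wdg i * ins i : Module.End ℂ (Forms d)) w) (p + 1) x
      = ∑ i, wedgeCovec (coordCLM d i) ((w.val (p + 1) x).curryLeft (stdVec d i)) := by
      rw [Forms.val_sum, Finset.sum_apply]
      rfl
    rw [h3]
    refine h2.trans ?_
    change _ = (((p + 1 : ℕ) : ℂ)) • w.val (p + 1) x
    exact (Nat.cast_smul_eq_nsmul ℂ (p + 1) (w.val (p + 1) x)).symm

/-! ### The differential and the co-differential as operators on all degrees -/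

/-- The exterior differential on forms of all degrees. -/
def dOp {d : ℕ} : Module.End ℂ (Forms d) := ∑ i, wdg i * dir i

/-- The co-differential on forms of all degrees. -/
def delOp {d : ℕ} : Module.End ℂ (Forms d) := - ∑ i, ins i * dir i

lemma dOp_val_zero {d : ℕ} (w : Forms d) : Forms.val (dOp w) 0 = 0 := by
  rw [dOp, LinearMap.sum_apply, Forms.val_sum]
  exact Finset.sum_eq_zero fun i _ => rfl

lemma dOp_val_succ {d p : ℕ} (w : Forms d) : Forms.val (dOp w) (p + 1) = extD (w.val p) := by
  ext1 x
  rw [dOp, LinearMap.sum_apply, Forms.val_sum, Finset.sum_apply]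
  have h1 : ∑ i, (coordCLM d i).smulRight (fderiv ℝ (w.val p) x (stdVec d i))
      = fderiv ℝ (w.val p) x := by
    ext u : 1
    conv_rhs => rw [← sum_coord_stdVec u]
    simp [_root_.sum_apply]
  rw [extD, extDeriv, ← h1, ← ContinuousAlternatingMap.alternatizeUncurryFinCLM_apply, map_sum]
  rfl

lemma delOp_val {d p : ℕ} (w : Forms d) : Forms.val (delOp w) p = codiff (w.val (p + 1)) := by
  ext1 x
  rw [delOp, LinearMap.neg_apply, LinearMap.sum_apply]
  change - Forms.val (∑ i, (ins i * dir i) w) p x = _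
  rw [Forms.val_sum, Finset.sum_apply]
  rfl

lemma dOp_mul_dOp {d : ℕ} : (dOp * dOp : Module.End ℂ (Forms d)) = 0 := by
  refine LinearMap.ext fun w => Forms.ext_val fun p x => ?_
  match p with
  | 0 => exact congrFun (dOp_val_zero (dOp w)) x
  | 1 =>
    change Forms.val (dOp (dOp w)) 1 x = 0
    rw [dOp_val_succ, dOp_val_zero]
    change ContinuousAlternatingMap.alternatizeUncurryFin (fderiv ℝ (0 : Form d 0) x) = 0
    rw [fderiv_zero]
    exact map_zero (ContinuousAlternatingMap.alternatizeUncurryFinCLM ℝ (Euc d) ℂ)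
  | p + 2 =>
    change Forms.val (dOp (dOp w)) (p + 2) x = 0
    rw [dOp_val_succ, dOp_val_succ]
    exact congrFun (extDeriv_extDeriv (w.contDiff_val p) (by simp; exact WithTop.coe_le_coe.2 le_top)) x

/-! ## Restriction to the hyperplane -/

lemma incl_castSucc {m : ℕ} (x : Euc m) (i : Fin m) : incl m x i.castSucc = x i := by
  simp [incl]

lemma incl_last {m : ℕ} (x : Euc m) : incl m x (Fin.last m) = 0 := by
  simp [incl]

lemma proj_apply {m : ℕ} (x : Euc (m + 1)) (i : Fin m) : proj m x i = x i.castSucc := by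
  simp [proj]

lemma incl_stdVec {m : ℕ} (i : Fin m) : incl m (stdVec m i) = stdVec (m + 1) i.castSucc := by
  ext j
  refine Fin.lastCases ?_ (fun j => ?_) j
  · rw [incl_last]
    simp [stdVec, (Fin.castSucc_lt_last i).ne']
  · rw [incl_castSucc]
    simp [stdVec]

/-- Restriction of alternating maps to the hyperplane. -/
def restrictCLM (m p : ℕ) :
    (Euc (m + 1)) [⋀^Fin p]→L[ℝ] ℂ →L[ℝ] (Euc m) [⋀^Fin p]→L[ℝ] ℂ :=
  ContinuousAlternatingMap.compContinuousLinearMapCLM (incl m)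

lemma contDiff_restrict {m p : ℕ} {w : Form (m + 1) p} (hw : ContDiff ℝ ∞ w) :
    ContDiff ℝ ∞ (restrict w) :=
  (restrictCLM m p).contDiff.comp (hw.comp (incl m).contDiff)

/-- The pull-back to the hyperplane on forms of all degrees. -/
def resOp {m : ℕ} : Forms (m + 1) →ₗ[ℂ] Forms m where
  toFun w := fun p => ⟨restrict (w.val p), contDiff_restrict (w.contDiff_val p)⟩
  map_add' _ _ := rfl
  map_smul' _ _ := rfl

lemma resOp_val {m p : ℕ} (w : Forms (m + 1)) : (resOp w).val p = restrict (w.val p) := rfl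

/-- The restriction of smooth functions to the hyperplane. -/
def resFun {m : ℕ} : smoothFun (m + 1) →ₐ[ℂ] smoothFun m where
  toFun f := ⟨fun x => (f : Euc (m + 1) → ℂ) (incl m x), (contDiff_fun f).comp (incl m).contDiff⟩
  map_one' := rfl
  map_mul' _ _ := rfl
  map_zero' := rfl
  map_add' _ _ := rfl
  commutes' _ := rfl

lemma resOp_mulF {m : ℕ} (f : smoothFun (m + 1)) (w : Forms (m + 1)) :
    resOp (mulF f w) = mulF (resFun f) (resOp w) :=
  Forms.ext_val fun _ _ => rfl

lemma resOp_ins {m : ℕ} (i : Fin m) (w : Forms (m + 1)) :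
    resOp (ins i.castSucc w) = ins i (resOp w) := by
  refine Forms.ext_val fun p x => ?_
  have h := ContinuousAlternatingMap.curryLeft_compContinuousLinearMap
    (w.val (p + 1) (incl m x)) (incl m) (stdVec m i)
  rw [incl_stdVec] at h
  exact h.symm

lemma resOp_dir {m : ℕ} (i : Fin m) (w : Forms (m + 1)) :
    resOp (dir i.castSucc w) = dir i (resOp w) := by
  refine Forms.ext_val fun p x => ?_
  have h := ((restrictCLM m p).hasFDerivAt.comp x
    ((w.differentiable_val p (incl m x)).hasFDerivAt.comp x (incl m).hasFDerivAt)).fderiv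
  have h2 := congrArg (fun L => L (stdVec m i)) h
  refine Eq.trans ?_ h2.symm
  rw [ContinuousLinearMap.comp_apply, ContinuousLinearMap.comp_apply, incl_stdVec]
  rfl

lemma wedgeCovec_comp {m p : ℕ} (l : Euc (m + 1) →L[ℝ] ℝ)
    (f : (Euc (m + 1)) [⋀^Fin p]→L[ℝ] ℂ) :
    (wedgeCovec l f).compContinuousLinearMap (incl m)
      = wedgeCovec (l.comp (incl m)) (f.compContinuousLinearMap (incl m)) := by
  ext v
  rw [ContinuousAlternatingMap.compContinuousLinearMap_apply, wedgeCovec_apply, wedgeCovec_apply]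
  rfl

lemma resOp_wdg {m : ℕ} (i : Fin m) (w : Forms (m + 1)) :
    resOp (wdg i.castSucc w) = wdg i (resOp w) := by
  refine Forms.ext_val fun p x => ?_
  cases p with
  | zero => rfl
  | succ p =>
    refine (wedgeCovec_comp (coordCLM (m + 1) i.castSucc) (w.val p (incl m x))).trans ?_
    have : (coordCLM (m + 1) i.castSucc).comp (incl m) = coordCLM m i := by
      ext y
      exact incl_castSucc y i
    rw [this]
    rfl

lemma resOp_wdg_last {m : ℕ} (w : Forms (m + 1)) : resOp (wdg (Fin.last m) w) = 0 := by
  refine Forms.ext_val fun p x => ?_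
  cases p with
  | zero => rfl
  | succ p =>
    refine (wedgeCovec_comp (coordCLM (m + 1) (Fin.last m)) (w.val p (incl m x))).trans ?_
    have : (coordCLM (m + 1) (Fin.last m)).comp (incl m) = 0 := by
      ext y
      exact incl_last y
    rw [this]
    ext v
    rw [wedgeCovec_apply]
    simp [Forms.val_zero]

/-! ## Operators with constant coefficients -/

section Const

variable {d : ℕ}

/-- Insertion of a constant complex vector. -/
def insC (c : Fin d → ℂ) : Module.End ℂ (Forms d) := ∑ i, c i • ins i

/-- Exterior multiplication by a constant complex covector. -/
def wdgC (c : Fin d → ℂ) : Module.End ℂ (Forms d) := ∑ i, c i • wdg i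

/-- Derivative in the direction of a constant complex vector. -/
def dirC (c : Fin d → ℂ) : Module.End ℂ (Forms d) := ∑ i, c i • dir i

/-- The Laplacian on forms of all degrees. -/
def lapOp : Module.End ℂ (Forms d) := delOp * dOp + dOp * delOp

lemma dir_mul_dOp (i : Fin d) : (dir i * dOp : Module.End ℂ (Forms d)) = dOp * dir i := by
  simp only [dOp, Finset.mul_sum, Finset.sum_mul]
  refine Finset.sum_congr rfl fun j _ => ?_
  rw [← mul_assoc, dir_mul_wdg, mul_assoc, dir_mul_dir, mul_assoc]

lemma dir_mul_delOp (i : Fin d) : (dir i * delOp : Module.End ℂ (Forms d)) = delOp * dir i := by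
  simp only [delOp, Finset.mul_sum, Finset.sum_mul, mul_neg, neg_mul]
  refine congrArg _ (Finset.sum_congr rfl fun j _ => ?_)
  rw [← mul_assoc, dir_mul_ins, mul_assoc, dir_mul_dir, mul_assoc]

lemma dir_mul_lapOp (i : Fin d) : (dir i * lapOp : Module.End ℂ (Forms d)) = lapOp * dir i := by
  rw [lapOp, mul_add, add_mul, ← mul_assoc, dir_mul_delOp, mul_assoc, dir_mul_dOp, ← mul_assoc,
    ← mul_assoc, dir_mul_dOp, mul_assoc dOp, dir_mul_delOp]
  noncomm_ring

/-- Cartan's formula for the standard vector fields. -/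
lemma ins_mul_dOp (i : Fin d) : (ins i * dOp : Module.End ℂ (Forms d)) = dir i - dOp * ins i := by
  have h : ∀ j : Fin d, (ins i * (wdg j * dir j) : Module.End ℂ (Forms d))
      = (if i = j then dir j else 0) - wdg j * dir j * ins i := by
    intro j
    rw [← mul_assoc, ins_mul_wdg, sub_mul, ite_mul, one_mul, zero_mul, mul_assoc, ← dir_mul_ins,
      mul_assoc]
  simp only [dOp, Finset.mul_sum, Finset.sum_mul, h, Finset.sum_sub_distrib]
  simp

lemma ins_mul_delOp (i : Fin d) : (ins i * delOp : Module.End ℂ (Forms d)) = - (delOp * ins i) := by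
  simp only [delOp, mul_neg, neg_mul, Finset.mul_sum, Finset.sum_mul, ← Finset.sum_neg_distrib]
  refine Finset.sum_congr rfl fun j _ => ?_
  rw [← mul_assoc, ins_mul_ins, mul_assoc, dir_mul_ins, neg_mul, mul_assoc]

lemma delOp_mul_wdg (i : Fin d) : (delOp * wdg i : Module.End ℂ (Forms d))
    = - dir i - wdg i * delOp := by
  have h : ∀ j : Fin d, (ins j * dir j * wdg i : Module.End ℂ (Forms d))
      = (if j = i then dir j else 0) - wdg i * (ins j * dir j) := by
    intro j
    rw [mul_assoc, dir_mul_wdg, ← mul_assoc, ins_mul_wdg, sub_mul, ite_mul, one_mul, zero_mul,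
      mul_assoc]
  simp only [delOp, Finset.mul_sum, Finset.sum_mul, h, Finset.sum_sub_distrib, neg_mul, mul_neg]
  simp [sub_eq_add_neg, add_comm]

/-- Each summand i_j ∂_j of -δ anticommutes with δ, so δδ equals its own negative. -/
lemma delOp_mul_delOp : (delOp * delOp : Module.End ℂ (Forms d)) = 0 := by
  have h : (delOp * delOp : Module.End ℂ (Forms d)) = - (delOp * delOp) := by
    conv_lhs => enter [1]; rw [delOp]
    rw [neg_mul, Finset.sum_mul]
    have : ∀ i : Fin d, (ins i * dir i * delOp : Module.End ℂ (Forms d))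
        = - (delOp * (ins i * dir i)) := fun i => by
      rw [mul_assoc, dir_mul_delOp, ← mul_assoc, ins_mul_delOp, neg_mul, mul_assoc]
    simp only [this, Finset.sum_neg_distrib, neg_neg]
    rw [← Finset.mul_sum]
    conv_rhs => enter [1, 2]; rw [delOp]
    rw [mul_neg, neg_neg]
  have h2 : (2 : ℂ) • (delOp * delOp : Module.End ℂ (Forms d)) = 0 := by
    rw [two_smul]
    nth_rewrite 1 [h]
    exact neg_add_cancel _
  exact (smul_eq_zero.1 h2).resolve_left two_ne_zero

/-- Since δ = -Σ i_j ∂_j and ∂_j commutes with d, the Laplacian is -Σ (i_j d + d i_j) ∂_j, and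
Cartan's formula makes the bracket ∂_j. -/
lemma lapOp_eq : (lapOp : Module.End ℂ (Forms d)) = - ∑ i, dir i * dir i := by
  have h : (dOp * delOp : Module.End ℂ (Forms d)) = - ∑ i, dOp * ins i * dir i := by
    rw [delOp, mul_neg, Finset.mul_sum]
    simp only [mul_assoc]
  have h' : (delOp * dOp : Module.End ℂ (Forms d)) = - ∑ i, ins i * dOp * dir i := by
    rw [delOp, neg_mul, Finset.sum_mul]
    simp only [mul_assoc, dir_mul_dOp]
  rw [lapOp, h, h', ← neg_add, ← Finset.sum_add_distrib]
  refine congrArg _ (Finset.sum_congr rfl fun i _ => ?_)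
  rw [ins_mul_dOp]
  noncomm_ring

lemma lapOp_mul_dOp : (lapOp * dOp : Module.End ℂ (Forms d)) = dOp * lapOp := by
  rw [lapOp, add_mul, mul_add, mul_assoc, dOp_mul_dOp, ← mul_assoc dOp dOp, dOp_mul_dOp]
  noncomm_ring

lemma lapOp_mul_delOp : (lapOp * delOp : Module.End ℂ (Forms d)) = delOp * lapOp := by
  rw [lapOp, add_mul, mul_add, mul_assoc dOp, delOp_mul_delOp, ← mul_assoc delOp delOp,
    delOp_mul_delOp]
  noncomm_ring

lemma lapOp_mul_ins (i : Fin d) : (lapOp * ins i : Module.End ℂ (Forms d)) = ins i * lapOp := by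
  rw [lapOp_eq, neg_mul, mul_neg, Finset.sum_mul, Finset.mul_sum]
  refine congrArg _ (Finset.sum_congr rfl fun j _ => ?_)
  rw [mul_assoc, dir_mul_ins, ← mul_assoc, dir_mul_ins, mul_assoc]

lemma lapOp_mul_wdg (i : Fin d) : (lapOp * wdg i : Module.End ℂ (Forms d)) = wdg i * lapOp := by
  rw [lapOp_eq, neg_mul, mul_neg, Finset.sum_mul, Finset.mul_sum]
  refine congrArg _ (Finset.sum_congr rfl fun j _ => ?_)
  rw [mul_assoc, dir_mul_wdg, ← mul_assoc, dir_mul_wdg, mul_assoc]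

lemma degOp_mul_dir (i : Fin d) : (degOp * dir i : Module.End ℂ (Forms d)) = dir i * degOp :=
  LinearMap.ext fun w => by
    refine Forms.ext_val fun p x => ?_
    change (p : ℂ) • fderiv ℝ (w.val p) x _ = fderiv ℝ ((p : ℂ) • w.val p) x _
    rw [fderiv_const_smul (w.differentiable_val p).differentiableAt]
    rfl

lemma degOp_mul_ins (i : Fin d) : (degOp * ins i : Module.End ℂ (Forms d))
    = ins i * degOp - ins i := by
  rw [← sum_wdg_mul_ins, Finset.sum_mul, Finset.mul_sum, eq_sub_iff_add_eq]
  have h : ∀ j : Fin d, (ins i * (wdg j * ins j) : Module.End ℂ (Forms d))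
      = (if i = j then ins j else 0) + wdg j * ins j * ins i := by
    intro j
    rw [← mul_assoc, ins_mul_wdg, sub_mul, ite_mul, one_mul, zero_mul, mul_assoc, ins_mul_ins]
    noncomm_ring
  simp only [h, Finset.sum_add_distrib]
  simp [add_comm]

end Const

/-! ### The hyperplane operators -/

section Hyper

variable {m : ℕ}

lemma resOp_dOp (w : Forms (m + 1)) : resOp (dOp w) = dOp (resOp w) := by
  simp only [dOp, LinearMap.sum_apply, map_sum, Module.End.mul_apply]
  rw [Fin.sum_univ_castSucc, resOp_wdg_last, add_zero]
  simp only [resOp_wdg, resOp_dir]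

/-- `ι^* ∂_n^k`. -/
def resDir (k : ℕ) : Forms (m + 1) →ₗ[ℂ] Forms m := resOp ∘ₗ (dir (Fin.last m) ^ k)

/-- `ι^* i_{∂_n} ∂_n^k`. -/
def resIns (k : ℕ) : Forms (m + 1) →ₗ[ℂ] Forms m :=
  resOp ∘ₗ ins (Fin.last m) ∘ₗ (dir (Fin.last m) ^ k)

/-- The tangential summands of the ambient co-differential restrict to those of the hyperplane. Only
the normal summand is left over. -/
lemma resOp_delOp (w : Forms (m + 1)) :
    resOp (delOp w) = delOp (resOp w) - resOp (ins (Fin.last m) (dir (Fin.last m) w)) := by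
  simp only [delOp, LinearMap.sum_apply, map_sum, Module.End.mul_apply, LinearMap.neg_apply,
    map_neg]
  rw [Fin.sum_univ_castSucc]
  simp only [resOp_ins, resOp_dir]
  abel

end Hyper

/-! ## Lie derivatives -/

section Lie

variable {d : ℕ}

lemma dOp_mul_mulF (f : smoothFun d) : (dOp * mulF f : Module.End ℂ (Forms d))
    = mulF f * dOp + ∑ j, mulF (pderiv j f) * wdg j := by
  have h : ∀ j : Fin d, (wdg j * dir j * mulF f : Module.End ℂ (Forms d))
      = mulF f * (wdg j * dir j) + mulF (pderiv j f) * wdg j := by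
    intro j
    rw [mul_assoc, dir_mul_mulF, mul_add, ← mul_assoc, wdg_mul_mulF, wdg_mul_mulF, mul_assoc]
  simp only [dOp, Finset.sum_mul, Finset.mul_sum, h, Finset.sum_add_distrib]

lemma delOp_mul_mulF (f : smoothFun d) : (delOp * mulF f : Module.End ℂ (Forms d))
    = mulF f * delOp - ∑ j, mulF (pderiv j f) * ins j := by
  have h : ∀ j : Fin d, (ins j * dir j * mulF f : Module.End ℂ (Forms d))
      = mulF f * (ins j * dir j) + mulF (pderiv j f) * ins j := by
    intro j
    rw [mul_assoc, dir_mul_mulF, mul_add, ← mul_assoc, ins_mul_mulF, ins_mul_mulF, mul_assoc]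
  simp only [delOp, neg_mul, mul_neg, Finset.sum_mul, Finset.mul_sum, h, Finset.sum_add_distrib]
  abel

/-- Insertion of a vector field. -/
def insF (ξ : Fin d → smoothFun d) : Module.End ℂ (Forms d) := ∑ i, mulF (ξ i) * ins i

/-- The Lie derivative along a vector field. -/
def lieOp (ξ : Fin d → smoothFun d) : Module.End ℂ (Forms d) := dOp * insF ξ + insF ξ * dOp

/-- Separates the transport part of the Lie derivative from the action of the Jacobian of the field,
which is how the symmetric part and the second derivatives of a field enter the commutators below.
-/
lemma lieOp_eq (ξ : Fin d → smoothFun d) : lieOp ξ = ∑ i, mulF (ξ i) * dir i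
    + ∑ i, ∑ j, mulF (pderiv j (ξ i)) * (wdg j * ins i) := by
  simp only [lieOp, insF, Finset.sum_mul, Finset.mul_sum, ← Finset.sum_add_distrib]
  refine Finset.sum_congr rfl fun i _ => ?_
  rw [← mul_assoc, dOp_mul_mulF, mul_assoc _ (ins i) dOp, ins_mul_dOp, add_mul, Finset.sum_mul]
  simp only [mul_assoc, mul_sub]
  abel

lemma dOp_mul_lieOp (ξ : Fin d → smoothFun d) : dOp * lieOp ξ = lieOp ξ * dOp := by
  rw [lieOp, mul_add, add_mul, mul_assoc _ dOp dOp, ← mul_assoc dOp dOp, dOp_mul_dOp]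
  noncomm_ring

lemma resOp_insF {m : ℕ} (ξ : Fin (m + 1) → smoothFun (m + 1)) (η : Fin m → smoothFun m)
    (h : ∀ i, resFun (ξ i.castSucc) = η i) (h0 : resFun (ξ (Fin.last m)) = 0)
    (w : Forms (m + 1)) : resOp (insF ξ w) = insF η (resOp w) := by
  simp only [insF, LinearMap.sum_apply, map_sum, Module.End.mul_apply]
  rw [Fin.sum_univ_castSucc]
  simp only [resOp_mulF, resOp_ins, h, h0, map_zero, LinearMap.zero_apply, add_zero]

lemma resOp_lieOp {m : ℕ} (ξ : Fin (m + 1) → smoothFun (m + 1)) (η : Fin m → smoothFun m)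
    (h : ∀ i, resFun (ξ i.castSucc) = η i) (h0 : resFun (ξ (Fin.last m)) = 0)
    (w : Forms (m + 1)) : resOp (lieOp ξ w) = lieOp η (resOp w) := by
  simp only [lieOp, LinearMap.add_apply, map_add, Module.End.mul_apply, resOp_dOp,
    resOp_insF ξ η h h0]

/-- The failure of δ to commute with L_ξ involves only the symmetrized first derivatives of ξ (the
deformation of the metric) and its second derivatives. For conformal fields the former is a multiple
of the identity and the latter are constant. -/
lemma delOp_mul_lieOp (ξ : Fin d → smoothFun d) : delOp * lieOp ξ = lieOp ξ * delOp
    - ∑ i, ∑ j, mulF (pderiv j (ξ i)) * (ins i * dir j + ins j * dir i)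
    - ∑ k, ∑ i, ∑ j, mulF (pderiv k (pderiv j (ξ i))) * (ins k * wdg j * ins i) := by
  have h1 : ∀ k i : Fin d, (ins k * dir k * (mulF (ξ i) * dir i) : Module.End ℂ (Forms d))
      = mulF (ξ i) * dir i * (ins k * dir k) + mulF (pderiv k (ξ i)) * (ins k * dir i) := by
    intro k i
    have e1 : (ins k * dir k * dir i : Module.End ℂ (Forms d)) = dir i * (ins k * dir k) := by
      rw [mul_assoc, dir_mul_dir, ← mul_assoc, ← dir_mul_ins, mul_assoc]
    rw [← mul_assoc, mul_assoc (ins k), dir_mul_mulF, mul_add, ← mul_assoc, ins_mul_mulF,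
      ins_mul_mulF, add_mul, mul_assoc _ (ins k) (dir k), mul_assoc _ _ (dir i), e1, mul_assoc,
      mul_assoc]
  have h2 : ∀ k i j : Fin d, (ins k * dir k * (mulF (pderiv j (ξ i)) * (wdg j * ins i))
        : Module.End ℂ (Forms d))
      = mulF (pderiv j (ξ i)) * (wdg j * ins i) * (ins k * dir k)
        + mulF (pderiv j (ξ i)) * ((if k = j then ins i else 0) * dir k)
        + mulF (pderiv k (pderiv j (ξ i))) * (ins k * wdg j * ins i) := by
    intro k i j
    have e1 : (dir k * (wdg j * ins i) : Module.End ℂ (Forms d)) = wdg j * ins i * dir k := by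
      rw [← mul_assoc, dir_mul_wdg, mul_assoc, dir_mul_ins, mul_assoc]
    have e2 : (ins k * (wdg j * ins i) : Module.End ℂ (Forms d))
        = (if k = j then ins i else 0) + wdg j * ins i * ins k := by
      rw [← mul_assoc, ins_mul_wdg, sub_mul, ite_mul, one_mul, zero_mul, mul_assoc (wdg j),
        ins_mul_ins k i]
      noncomm_ring
    rw [mul_assoc (ins k), ← mul_assoc (dir k), dir_mul_mulF, add_mul, mul_assoc (mulF _) (dir k),
      e1, mul_add, ← mul_assoc (ins k), ins_mul_mulF, ← mul_assoc (ins k), ins_mul_mulF,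
      mul_assoc (mulF _) (ins k), ← mul_assoc (ins k) _ (dir k), e2, add_mul, mul_add]
    simp only [mul_assoc]
    abel
  rw [lieOp_eq]
  simp only [delOp, neg_mul, mul_neg, mul_add, add_mul, Finset.sum_mul]
  simp only [Finset.mul_sum, h1, h2, Finset.sum_add_distrib]
  have e3 : ∑ k, ∑ i, ∑ j, mulF (pderiv j (ξ i)) * ((if k = j then ins i else 0) * dir k)
      = ∑ i, ∑ j, (mulF (pderiv j (ξ i)) * (ins i * dir j) : Module.End ℂ (Forms d)) := by
    rw [Finset.sum_comm]
    refine Finset.sum_congr rfl fun i _ => ?_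
    rw [Finset.sum_comm]
    refine Finset.sum_congr rfl fun j _ => ?_
    simp [ite_mul, mul_ite]
  have e4 : ∑ k, ∑ i, (mulF (pderiv k (ξ i)) * (ins k * dir i) : Module.End ℂ (Forms d))
      = ∑ i, ∑ j, mulF (pderiv j (ξ i)) * (ins j * dir i) := Finset.sum_comm
  have e5 : ∑ k, ∑ i, (mulF (ξ i) * dir i * (ins k * dir k) : Module.End ℂ (Forms d))
      = ∑ i, ∑ k, mulF (ξ i) * dir i * (ins k * dir k) := Finset.sum_comm
  have e6 : ∑ k, ∑ i, ∑ j, (mulF (pderiv j (ξ i)) * (wdg j * ins i) * (ins k * dir k)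
        : Module.End ℂ (Forms d))
      = ∑ i, ∑ j, ∑ k, mulF (pderiv j (ξ i)) * (wdg j * ins i) * (ins k * dir k) := by
    rw [Finset.sum_comm]
    exact Finset.sum_congr rfl fun i _ => Finset.sum_comm
  rw [e3, e4, e5, e6]
  abel

lemma dir_mul_lieOp (k : Fin d) (ξ : Fin d → smoothFun d) : dir k * lieOp ξ
    = lieOp ξ * dir k + lieOp (fun i => pderiv k (ξ i)) := by
  have h : dir k * insF ξ = insF ξ * dir k + insF (fun i => pderiv k (ξ i)) := by
    simp only [insF, Finset.mul_sum, Finset.sum_mul, ← Finset.sum_add_distrib]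
    refine Finset.sum_congr rfl fun i _ => ?_
    rw [← mul_assoc, dir_mul_mulF, add_mul, mul_assoc, dir_mul_ins, mul_assoc]
  rw [lieOp, lieOp, mul_add, ← mul_assoc, dir_mul_dOp, mul_assoc, h, ← mul_assoc, h, add_mul,
    add_mul, mul_add, mul_assoc _ (dir k), dir_mul_dOp]
  noncomm_ring

lemma ins_mul_lieOp (k : Fin d) (ξ : Fin d → smoothFun d) : ins k * lieOp ξ
    = lieOp ξ * ins k + insF (fun i => pderiv k (ξ i)) := by
  have h : ∀ i j : Fin d, (ins k * (mulF (pderiv j (ξ i)) * (wdg j * ins i))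
        : Module.End ℂ (Forms d))
      = mulF (pderiv j (ξ i)) * (wdg j * ins i) * ins k
        + if k = j then mulF (pderiv j (ξ i)) * ins i else 0 := by
    intro i j
    have e2 : (ins k * (wdg j * ins i) : Module.End ℂ (Forms d))
        = (if k = j then ins i else 0) + wdg j * ins i * ins k := by
      rw [← mul_assoc, ins_mul_wdg, sub_mul, ite_mul, one_mul, zero_mul, mul_assoc (wdg j),
        ins_mul_ins k i]
      noncomm_ring
    rw [← mul_assoc, ins_mul_mulF, mul_assoc, e2, mul_add, mul_ite, mul_zero, add_comm,
      ← mul_assoc]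
  have h' : ∀ i : Fin d, (ins k * (mulF (ξ i) * dir i) : Module.End ℂ (Forms d))
      = mulF (ξ i) * dir i * ins k := by
    intro i
    rw [← mul_assoc, ins_mul_mulF, mul_assoc, ← dir_mul_ins, mul_assoc]
  rw [lieOp_eq, insF, mul_add, add_mul]
  simp only [Finset.mul_sum, Finset.sum_mul, h, h', Finset.sum_add_distrib]
  simp [add_assoc]

end Lie

/-! ### Conformal vector fields -/

section Conf

variable {d : ℕ}

/-- The coordinate functions. -/
def coordFun (i : Fin d) : smoothFun d :=
  ⟨fun x => (x i : ℂ), (Complex.ofRealCLM.comp (coordCLM d i)).contDiff (n := ∞)⟩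

lemma pderiv_coordFun (k i : Fin d) : pderiv k (coordFun i) = if i = k then 1 else 0 := by
  refine Subtype.ext (funext fun x => ?_)
  have h := ((Complex.ofRealCLM.comp (coordCLM d i)).hasFDerivAt (x := x)).fderiv
  rw [pderiv_apply]
  refine (congrArg (fun L => L (stdVec d k)) h).trans ?_
  change ((coordCLM d i (stdVec d k) : ℝ) : ℂ) = _
  rw [coordCLM_stdVec]
  split_ifs <;> simp

/-- The conformal factor of `confField b A s c`. -/
def confFactor (s : ℂ) (c : Fin d → ℂ) : smoothFun d :=
  algebraMap ℂ (smoothFun d) s + ∑ j, c j • coordFun j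

/-- The vector field `b + A x + (s + ⟨c, x⟩) x - |x|^2 c / 2`, which is conformal for
skew-symmetric `A`. -/
def confField (b : Fin d → ℂ) (A : Fin d → Fin d → ℂ) (s : ℂ) (c : Fin d → ℂ) (i : Fin d) :
    smoothFun d :=
  algebraMap ℂ (smoothFun d) (b i) + ∑ j, A i j • coordFun j + confFactor s c * coordFun i
    - (c i / 2) • ∑ j, coordFun j ^ 2

lemma pderiv_confFactor (k : Fin d) (s : ℂ) (c : Fin d → ℂ) :
    pderiv k (confFactor s c) = algebraMap ℂ (smoothFun d) (c k) := by
  simp [confFactor, map_sum, pderiv_coordFun, Algebra.algebraMap_eq_smul_one]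

/-- The skew-symmetric part of the derivative of `confField b A s c`. -/
def confSkew (A : Fin d → Fin d → ℂ) (c : Fin d → ℂ) (i k : Fin d) : smoothFun d :=
  algebraMap ℂ (smoothFun d) (A i k) + c k • coordFun i - c i • coordFun k

/-- When A is skew, so is the first term; this is then the conformal Killing equation with factor σ.
-/
lemma pderiv_confField (b : Fin d → ℂ) (A : Fin d → Fin d → ℂ) (s : ℂ) (c : Fin d → ℂ)
    (k i : Fin d) : pderiv k (confField b A s c i)
      = confSkew A c i k + if i = k then confFactor s c else 0 := by
  have h : ∑ j, pderiv k (coordFun j ^ 2) = (2 : ℂ) • coordFun k := by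
    simp only [Derivation.leibniz_pow, pderiv_coordFun]
    simp [two_smul]
  rw [confField, map_sub, map_add, map_add, Derivation.map_algebraMap, map_sum, Derivation.leibniz,
    pderiv_confFactor, Derivation.map_smul, map_sum, h]
  simp only [Derivation.map_smul, pderiv_coordFun, confSkew, smul_smul]
  rw [div_mul_cancel₀ _ two_ne_zero]
  simp [Algebra.algebraMap_eq_smul_one]
  abel

lemma pderiv_confSkew (A : Fin d → Fin d → ℂ) (c : Fin d → ℂ) (k i j : Fin d) :
    pderiv k (confSkew A c i j) = (if i = k then algebraMap ℂ (smoothFun d) (c j) else 0)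
      - if j = k then algebraMap ℂ (smoothFun d) (c i) else 0 := by
  simp [confSkew, pderiv_coordFun, Algebra.algebraMap_eq_smul_one]

lemma mulF_algebraMap (a : ℂ) :
    (mulF (algebraMap ℂ (smoothFun d) a) : Module.End ℂ (Forms d)) = a • 1 := by
  rw [AlgHom.commutes, Algebra.algebraMap_eq_smul_one]

lemma dOp_mul_confFactor (s : ℂ) (c : Fin d → ℂ) :
    (dOp * mulF (confFactor s c) : Module.End ℂ (Forms d))
      = mulF (confFactor s c) * dOp + wdgC c := by
  simp [dOp_mul_mulF, pderiv_confFactor, ← Algebra.smul_def, wdgC]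

lemma delOp_mul_confFactor (s : ℂ) (c : Fin d → ℂ) :
    (delOp * mulF (confFactor s c) : Module.End ℂ (Forms d))
      = mulF (confFactor s c) * delOp - insC c := by
  simp [delOp_mul_mulF, pderiv_confFactor, ← Algebra.smul_def, insC]

lemma degOp_mul_insC (c : Fin d → ℂ) : (degOp * insC c : Module.End ℂ (Forms d))
    = insC c * degOp - insC c := by
  simp only [insC, Finset.mul_sum, Finset.sum_mul, mul_smul_comm, smul_mul_assoc, degOp_mul_ins,
    ← Finset.sum_sub_distrib, smul_sub]

/-- In `delOp_mul_lieOp` the symmetric part of the Jacobian contributes 2σδ. The second derivatives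
are built from c alone and are contracted by Σ i_k e^k∧ = d - deg and Σ e^k∧ i_k = deg. -/
lemma delOp_mul_lieOp_confField (b : Fin d → ℂ) (A : Fin d → Fin d → ℂ)
    (hA : ∀ i j, A i j = - A j i) (s : ℂ) (c : Fin d → ℂ) :
    delOp * lieOp (confField b A s c) = lieOp (confField b A s c) * delOp
      + (2 : ℂ) • (mulF (confFactor s c) * delOp)
      + insC c * ((d : ℂ) • (1 : Module.End ℂ (Forms d)) - (2 : ℂ) • degOp) := by
  have h1 : ∑ i, ∑ j, mulF (pderiv j (confField b A s c i)) * (ins i * dir j + ins j * dir i)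
      = - (2 : ℂ) • (mulF (confFactor s c) * delOp) := by
    -- A skew matrix is contracted with an expression symmetric in i and j.
    have hS : ∑ i, ∑ j, (mulF (confSkew A c i j) * (ins i * dir j + ins j * dir i)
        : Module.End ℂ (Forms d)) = 0 := by
      have : ∑ i, ∑ j, (mulF (confSkew A c i j) * (ins i * dir j + ins j * dir i)
          : Module.End ℂ (Forms d))
          = - ∑ i, ∑ j, mulF (confSkew A c i j) * (ins i * dir j + ins j * dir i) := by
        conv_lhs => rw [Finset.sum_comm]
        rw [← Finset.sum_neg_distrib]
        refine Finset.sum_congr rfl fun i _ => ?_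
        rw [← Finset.sum_neg_distrib]
        refine Finset.sum_congr rfl fun j _ => ?_
        have : confSkew A c j i = - confSkew A c i j := by
          simp only [confSkew, hA j i, map_neg]
          abel
        rw [this, map_neg, neg_mul, add_comm]
      have h2 := add_eq_zero_iff_eq_neg.2 this
      rw [← two_smul ℂ] at h2
      exact (smul_eq_zero.1 h2).resolve_left two_ne_zero
    simp only [pderiv_confField, map_add, add_mul, Finset.sum_add_distrib, hS, zero_add]
    rw [delOp, mul_neg, smul_neg, neg_smul, neg_neg, Finset.mul_sum, Finset.smul_sum]
    refine Finset.sum_congr rfl fun i _ => ?_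
    rw [Finset.sum_eq_single i]
    · rw [if_pos rfl, two_smul, mul_add]
    · intro j _ hj
      rw [if_neg (Ne.symm hj), map_zero, zero_mul]
    · simp
  have hk : ∀ k i j : Fin d, (mulF (pderiv k (pderiv j (confField b A s c i)))
        * (ins k * wdg j * ins i) : Module.End ℂ (Forms d))
      = (if i = k then c j • (ins k * wdg j * ins i) else 0)
        - (if j = k then c i • (ins k * wdg j * ins i) else 0)
        + if i = j then c k • (ins k * wdg j * ins i) else 0 := by
    intro k i j
    rw [pderiv_confField, map_add, pderiv_confSkew]
    have : pderiv k (if i = j then confFactor s c else 0)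
        = if i = j then algebraMap ℂ (smoothFun d) (c k) else 0 := by
      split_ifs
      · exact pderiv_confFactor k s c
      · exact map_zero _
    rw [this]
    split_ifs <;> simp [← Algebra.smul_def, sub_mul, add_mul]
  have ht1 : ∑ k, ∑ i, ∑ j, (if i = k then c j • (ins k * wdg j * ins i) else 0)
      = (insC c : Module.End ℂ (Forms d)) := by
    have : ∀ k : Fin d, ∑ i, ∑ j, (if i = k then c j • (ins k * wdg j * ins i) else 0)
        = (c k • ins k : Module.End ℂ (Forms d)) := by
      intro k
      rw [Finset.sum_eq_single k]
      · have hkk : (ins k * ins k : Module.End ℂ (Forms d)) = 0 := by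
          have h := add_eq_zero_iff_eq_neg.2 (ins_mul_ins k k)
          rw [← two_smul ℂ] at h
          exact (smul_eq_zero.1 h).resolve_left two_ne_zero
        simp only [if_true, ins_mul_wdg, sub_mul, mul_assoc, hkk, mul_zero, sub_zero, ite_mul,
          one_mul, zero_mul]
        simp
      · intro i _ hi
        simp [hi]
      · simp
    simp only [this, insC]
  have ht2 : ∑ k, ∑ i, ∑ j, (if j = k then c i • (ins k * wdg j * ins i) else 0)
      = ((d : ℂ) • (1 : Module.End ℂ (Forms d)) - degOp) * insC c := by
    have h3 : ∑ k, (ins k * wdg k : Module.End ℂ (Forms d))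
        = (d : ℂ) • (1 : Module.End ℂ (Forms d)) - degOp := by
      simp only [ins_mul_wdg, if_true, Finset.sum_sub_distrib, sum_wdg_mul_ins]
      simp [Nat.cast_smul_eq_nsmul]
    rw [← h3, Finset.sum_mul]
    refine Finset.sum_congr rfl fun k _ => ?_
    rw [insC, Finset.mul_sum]
    refine Finset.sum_congr rfl fun i _ => ?_
    simp
  have ht3 : ∑ k, ∑ i, ∑ j, (if i = j then c k • (ins k * wdg j * ins i) else 0)
      = (insC c * degOp : Module.End ℂ (Forms d)) := by
    rw [← sum_wdg_mul_ins, insC, Finset.sum_mul]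
    refine Finset.sum_congr rfl fun k _ => ?_
    rw [Finset.mul_sum]
    refine Finset.sum_congr rfl fun i _ => ?_
    simp [mul_assoc]
  rw [delOp_mul_lieOp, h1]
  simp only [hk, Finset.sum_add_distrib, Finset.sum_sub_distrib, ht1, ht2, ht3]
  rw [sub_mul, degOp_mul_insC, mul_sub, mul_smul_comm, mul_smul_comm, smul_mul_assoc, one_mul,
    mul_one]
  module

end Conf

/-! ## Commutation with conformal fields tangent to the hyperplane -/

section Tangent

variable {m : ℕ}

/-- Extension of a vector by zero. -/
def extVec (c : Fin m → ℂ) : Fin (m + 1) → ℂ := Fin.snoc (α := fun _ => ℂ) c 0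

/-- Extension of a matrix by zero. -/
def extMat (A : Fin m → Fin m → ℂ) : Fin (m + 1) → Fin (m + 1) → ℂ :=
  Fin.snoc (α := fun _ => Fin (m + 1) → ℂ) (fun i => extVec (A i)) 0

@[simp] lemma extVec_castSucc (c : Fin m → ℂ) (i : Fin m) : extVec c i.castSucc = c i := by
  simp [extVec]

@[simp] lemma extVec_last (c : Fin m → ℂ) : extVec c (Fin.last m) = 0 := by
  simp [extVec]

@[simp] lemma extMat_castSucc (A : Fin m → Fin m → ℂ) (i : Fin m) :
    extMat A i.castSucc = extVec (A i) := by
  simp [extMat]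

@[simp] lemma extMat_last (A : Fin m → Fin m → ℂ) : extMat A (Fin.last m) = 0 := by
  simp [extMat]

lemma extMat_apply_last (A : Fin m → Fin m → ℂ) (i : Fin (m + 1)) :
    extMat A i (Fin.last m) = 0 := by
  refine Fin.lastCases ?_ (fun i => ?_) i <;> simp

lemma resFun_coordFun (i : Fin m) : resFun (coordFun i.castSucc) = coordFun i :=
  Subtype.ext (funext fun x => congrArg Complex.ofReal (incl_castSucc x i))

lemma resFun_coordFun_last : resFun (coordFun (Fin.last m)) = 0 :=
  Subtype.ext (funext fun x => congrArg Complex.ofReal (incl_last x))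

lemma resFun_confFactor (s : ℂ) (c : Fin m → ℂ) :
    resFun (confFactor s (extVec c)) = confFactor s c := by
  simp only [confFactor, map_add, AlgHom.commutes, map_sum, map_smul, Fin.sum_univ_castSucc,
    extVec_castSucc, extVec_last, zero_smul, add_zero, resFun_coordFun]

lemma resFun_confField_castSucc (b : Fin m → ℂ) (A : Fin m → Fin m → ℂ) (s : ℂ) (c : Fin m → ℂ)
    (i : Fin m) : resFun (confField (extVec b) (extMat A) s (extVec c) i.castSucc)
      = confField b A s c i := by
  simp only [confField, map_add, map_sub, map_mul, map_pow, resFun_confFactor, AlgHom.commutes,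
    map_sum, map_smul, Fin.sum_univ_castSucc, extVec_castSucc, extVec_last, zero_smul, add_zero,
    resFun_coordFun, resFun_coordFun_last, extMat_castSucc]
  simp

lemma resFun_confField_last (b : Fin m → ℂ) (A : Fin m → Fin m → ℂ) (s : ℂ) (c : Fin m → ℂ) :
    resFun (confField (extVec b) (extMat A) s (extVec c) (Fin.last m)) = 0 := by
  simp [confField, resFun_coordFun_last]

lemma resOp_insC (c : Fin m → ℂ) (w : Forms (m + 1)) :
    resOp (insC (extVec c) w) = insC c (resOp w) := by
  simp [insC, LinearMap.sum_apply, Fin.sum_univ_castSucc, resOp_ins]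

lemma resOp_wdgC (c : Fin m → ℂ) (w : Forms (m + 1)) :
    resOp (wdgC (extVec c) w) = wdgC c (resOp w) := by
  simp [wdgC, LinearMap.sum_apply, Fin.sum_univ_castSucc, resOp_wdg]

lemma resOp_dirC (c : Fin m → ℂ) (w : Forms (m + 1)) :
    resOp (dirC (extVec c) w) = dirC c (resOp w) := by
  simp [dirC, LinearMap.sum_apply, Fin.sum_univ_castSucc, resOp_dir]

variable (b : Fin m → ℂ) (A : Fin m → Fin m → ℂ) (s : ℂ) (c : Fin m → ℂ)

/-- The normal derivative of a tangential conformal vector field, acting on forms. -/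
def normalCommutator : Module.End ℂ (Forms (m + 1)) :=
  mulF (confFactor s (extVec c)) * dir (Fin.last m)
    - mulF (coordFun (Fin.last m)) * dirC (extVec c)
    + (wdgC (extVec c) * ins (Fin.last m) - wdg (Fin.last m) * insC (extVec c))

/-- The normal derivative of a tangential conformal field is σ e_n - x_n c. There is no rotation
term because the extended matrix has a zero last column. -/
lemma pderiv_last_confField (i : Fin (m + 1)) :
    pderiv (Fin.last m) (confField (extVec b) (extMat A) s (extVec c) i)
      = (if i = Fin.last m then confFactor s (extVec c) else 0)
        - extVec c i • coordFun (Fin.last m) := by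
  rw [pderiv_confField, confSkew, extMat_apply_last, extVec_last, map_zero, zero_smul]
  abel

/-- The commutator of ∂_n with L_ξ is the Lie derivative along ∂_n ξ = σ e_n - x_n c. Its Jacobian
is constant, which produces the two algebraic terms in `normalCommutator`. -/
lemma dir_mul_lieOp_confField :
    dir (Fin.last m) * lieOp (confField (extVec b) (extMat A) s (extVec c))
      = lieOp (confField (extVec b) (extMat A) s (extVec c)) * dir (Fin.last m)
        + normalCommutator s c := by
  rw [dir_mul_lieOp, lieOp_eq (fun i => pderiv _ _)]
  have h : ∀ i j : Fin (m + 1), pderiv j (pderiv (Fin.last m)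
        (confField (extVec b) (extMat A) s (extVec c) i))
      = (if i = Fin.last m then algebraMap ℂ (smoothFun (m + 1)) (extVec c j) else 0)
        - (if j = Fin.last m then algebraMap ℂ (smoothFun (m + 1)) (extVec c i) else 0) := by
    intro i j
    rw [pderiv_last_confField, map_sub, Derivation.map_smul, pderiv_coordFun]
    congr 1
    · split_ifs
      · exact pderiv_confFactor j s _
      · exact map_zero _
    · by_cases hj : j = Fin.last m
      · rw [if_pos hj, if_pos hj.symm, Algebra.algebraMap_eq_smul_one]
      · rw [if_neg hj, if_neg (Ne.symm hj), smul_zero]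
  congr 1
  simp only [h]
  simp only [pderiv_last_confField, map_sub, sub_mul, Finset.sum_sub_distrib, normalCommutator]
  have e1 : ∑ i, (mulF (if i = Fin.last m then confFactor s (extVec c) else 0) * dir i)
      = (mulF (confFactor s (extVec c)) * dir (Fin.last m) : Module.End ℂ (Forms (m + 1))) := by
    rw [Finset.sum_eq_single (Fin.last m)]
    · rw [if_pos rfl]
    · intro i _ hi
      rw [if_neg hi, map_zero, zero_mul]
    · simp
  have e2 : ∑ i, (mulF (extVec c i • coordFun (Fin.last m)) * dir i)
      = (mulF (coordFun (Fin.last m)) * dirC (extVec c) : Module.End ℂ (Forms (m + 1))) := by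
    rw [dirC, Finset.mul_sum]
    exact Finset.sum_congr rfl fun i _ => by rw [map_smul, smul_mul_assoc, mul_smul_comm]
  have e3 : ∑ i : Fin (m + 1), ∑ j, (mulF (if i = Fin.last m then
        algebraMap ℂ (smoothFun (m + 1)) (extVec c j) else 0) * (wdg j * ins i))
      = (wdgC (extVec c) * ins (Fin.last m) : Module.End ℂ (Forms (m + 1))) := by
    rw [Finset.sum_eq_single (Fin.last m)]
    · rw [wdgC, Finset.sum_mul]
      exact Finset.sum_congr rfl fun j _ => by
        rw [if_pos rfl, mulF_algebraMap, smul_mul_assoc, one_mul, smul_mul_assoc]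
    · intro i _ hi
      simp [hi]
    · simp
  have e4 : ∑ i : Fin (m + 1), ∑ j, (mulF (if j = Fin.last m then
        algebraMap ℂ (smoothFun (m + 1)) (extVec c i) else 0) * (wdg j * ins i))
      = (wdg (Fin.last m) * insC (extVec c) : Module.End ℂ (Forms (m + 1))) := by
    rw [Finset.sum_comm, Finset.sum_eq_single (Fin.last m)]
    · rw [insC, Finset.mul_sum]
      exact Finset.sum_congr rfl fun j _ => by
        rw [if_pos rfl, mulF_algebraMap, smul_mul_assoc, one_mul, mul_smul_comm]
    · intro i _ hi
      simp [hi]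
    · simp
  rw [e1, e2, e3, e4]

lemma ins_mul_lieOp_confField :
    ins (Fin.last m) * lieOp (confField (extVec b) (extMat A) s (extVec c))
      = lieOp (confField (extVec b) (extMat A) s (extVec c)) * ins (Fin.last m)
        + (mulF (confFactor s (extVec c)) * ins (Fin.last m)
          - mulF (coordFun (Fin.last m)) * insC (extVec c)) := by
  rw [ins_mul_lieOp]
  congr 1
  simp only [insF, pderiv_last_confField, map_sub, sub_mul, Finset.sum_sub_distrib]
  congr 1
  · rw [Finset.sum_eq_single (Fin.last m)]
    · rw [if_pos rfl]
    · intro i _ hi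
      rw [if_neg hi, map_zero, zero_mul]
    · simp
  · rw [insC, Finset.mul_sum]
    exact Finset.sum_congr rfl fun i _ => by rw [map_smul, smul_mul_assoc, mul_smul_comm]

lemma dir_mul_insC {d : ℕ} (i : Fin d) (c : Fin d → ℂ) :
    (dir i * insC c : Module.End ℂ (Forms d)) = insC c * dir i := by
  simp only [insC, Finset.mul_sum, Finset.sum_mul, mul_smul_comm, smul_mul_assoc, dir_mul_ins]

lemma dir_mul_wdgC {d : ℕ} (i : Fin d) (c : Fin d → ℂ) :
    (dir i * wdgC c : Module.End ℂ (Forms d)) = wdgC c * dir i := by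
  simp only [wdgC, Finset.mul_sum, Finset.sum_mul, mul_smul_comm, smul_mul_assoc, dir_mul_wdg]

lemma dir_mul_dirC {d : ℕ} (i : Fin d) (c : Fin d → ℂ) :
    (dir i * dirC c : Module.End ℂ (Forms d)) = dirC c * dir i := by
  simp only [dirC, Finset.mul_sum, Finset.sum_mul, mul_smul_comm, smul_mul_assoc, dir_mul_dir]

lemma dir_mul_confFactor : (dir (Fin.last m) * mulF (confFactor s (extVec c))
    : Module.End ℂ (Forms (m + 1))) = mulF (confFactor s (extVec c)) * dir (Fin.last m) := by
  rw [dir_mul_mulF, pderiv_confFactor, extVec_last, map_zero, map_zero, add_zero]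

/-- Only the coefficient x_n is not constant in the normal direction. The result -∂_c commutes with
∂_n, so moving a power of ∂_n through L_ξ stops after the second commutator. -/
lemma dir_mul_normalCommutator : dir (Fin.last m) * normalCommutator s c
    = normalCommutator s c * dir (Fin.last m) - dirC (extVec c) := by
  have h1 : (dir (Fin.last m) * (mulF (coordFun (Fin.last m)) * dirC (extVec c))
      : Module.End ℂ (Forms (m + 1)))
      = mulF (coordFun (Fin.last m)) * dirC (extVec c) * dir (Fin.last m)
        + dirC (extVec c) := by
    rw [← mul_assoc, dir_mul_mulF, pderiv_coordFun, if_pos rfl, map_one, add_mul, one_mul,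
      mul_assoc, dir_mul_dirC, mul_assoc]
  have h2 : (dir (Fin.last m) * (wdgC (extVec c) * ins (Fin.last m))
      : Module.End ℂ (Forms (m + 1))) = wdgC (extVec c) * ins (Fin.last m) * dir (Fin.last m) := by
    rw [← mul_assoc, dir_mul_wdgC, mul_assoc, dir_mul_ins, mul_assoc]
  have h3 : (dir (Fin.last m) * (wdg (Fin.last m) * insC (extVec c))
      : Module.End ℂ (Forms (m + 1))) = wdg (Fin.last m) * insC (extVec c) * dir (Fin.last m) := by
    rw [← mul_assoc, dir_mul_wdg, mul_assoc, dir_mul_insC, mul_assoc]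
  rw [normalCommutator, mul_add, mul_sub, mul_sub, h1, h2, h3, ← mul_assoc, dir_mul_confFactor]
  noncomm_ring

/-- Moving a power through an element with nilpotent commutators. -/
lemma pow_mul_of_commutator {R : Type*} [Ring R] [Algebra ℂ R] {T L M Z : R}
    (hL : T * L = L * T + M) (hM : T * M = M * T - Z) (hZ : T * Z = Z * T) (k : ℕ) :
    T ^ k * L = L * T ^ k + (k : ℂ) • (M * T ^ (k - 1))
      - (k.choose 2 : ℂ) • (Z * T ^ (k - 2)) := by
  induction k with
  | zero => simp
  | succ k ih =>
    rw [pow_succ', mul_assoc, ih, mul_sub, mul_add, mul_smul_comm, mul_smul_comm, ← mul_assoc,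
      hL, ← mul_assoc T M, hM, ← mul_assoc T Z, hZ, Nat.choose_succ_succ' k 1, Nat.choose_one_right]
    -- The exponents k - 1 and k - 2 are truncated for k < 2. There the binomial coefficients
    -- vanish, but the exponents do not follow the general pattern.
    rcases k with _ | _ | k
    · simp
    · have e0 : (0 + 1).choose (1 + 1) = 0 := rfl
      rw [e0]
      simp only [zero_add, Nat.reduceAdd, Nat.sub_self, pow_zero, Nat.add_one_sub_one, pow_one,
        Nat.cast_one, Nat.cast_zero, Nat.cast_ofNat, mul_one, add_mul, add_zero,
        mul_assoc]
      module
    · have e1 : k + 1 + 1 - 1 = k + 1 := rfl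
      have e2 : k + 1 + 1 - 2 = k := rfl
      have e3 : k + 1 + 1 + 1 - 1 = k + 1 + 1 := rfl
      have e4 : k + 1 + 1 + 1 - (1 + 1) = k + 1 := rfl
      have e5 : k + 1 + 1 + 1 - 2 = k + 1 := rfl
      rw [e1, e2, e3, e5]
      simp only [add_mul, sub_mul, mul_assoc, ← pow_succ', smul_sub, Nat.cast_add,
        Nat.cast_one]
      module

/-- The function x_n and exterior multiplication by dx_n die on the hyperplane. -/
lemma resOp_normalCommutator (w : Forms (m + 1)) : resOp (normalCommutator s c w)
    = mulF (confFactor s c) (resOp (dir (Fin.last m) w))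
      + wdgC c (resOp (ins (Fin.last m) w)) := by
  simp only [normalCommutator, LinearMap.add_apply, LinearMap.sub_apply, Module.End.mul_apply,
    map_add, map_sub, resOp_mulF, resFun_confFactor, resFun_coordFun_last, map_zero,
    LinearMap.zero_apply, resOp_wdgC, resOp_wdg_last, sub_zero]

lemma ins_mul_ins_self {d : ℕ} (i : Fin d) : (ins i * ins i : Module.End ℂ (Forms d)) = 0 := by
  have h := add_eq_zero_iff_eq_neg.2 (ins_mul_ins i i)
  rw [← two_smul ℂ] at h
  exact (smul_eq_zero.1 h).resolve_left two_ne_zero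

lemma ins_last_mul_wdgC : (ins (Fin.last m) * wdgC (extVec c) : Module.End ℂ (Forms (m + 1)))
    = - (wdgC (extVec c) * ins (Fin.last m)) := by
  simp only [wdgC, Finset.mul_sum, Finset.sum_mul, mul_smul_comm, smul_mul_assoc, ins_mul_wdg,
    smul_sub, Finset.sum_sub_distrib]
  simp

lemma resOp_ins_normalCommutator (w : Forms (m + 1)) :
    resOp (ins (Fin.last m) (normalCommutator s c w))
      = mulF (confFactor s c) (resOp (ins (Fin.last m) (dir (Fin.last m) w)))
        - insC c (resOp w) := by
  have h : ins (Fin.last m) * normalCommutator s c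
      = mulF (confFactor s (extVec c)) * (ins (Fin.last m) * dir (Fin.last m))
        - mulF (coordFun (Fin.last m)) * (ins (Fin.last m) * dirC (extVec c))
        - (insC (extVec c) - wdg (Fin.last m) * (ins (Fin.last m) * insC (extVec c))) := by
    have h1 : (ins (Fin.last m) * (wdgC (extVec c) * ins (Fin.last m))
        : Module.End ℂ (Forms (m + 1))) = 0 := by
      rw [← mul_assoc, ins_last_mul_wdgC, neg_mul, mul_assoc, ins_mul_ins_self, mul_zero, neg_zero]
    have h2 : (ins (Fin.last m) * (wdg (Fin.last m) * insC (extVec c))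
        : Module.End ℂ (Forms (m + 1)))
        = insC (extVec c) - wdg (Fin.last m) * (ins (Fin.last m) * insC (extVec c)) := by
      rw [← mul_assoc, ins_mul_wdg, if_pos rfl, sub_mul, one_mul, mul_assoc]
    rw [normalCommutator, mul_add, mul_sub, mul_sub, h1, h2, ← mul_assoc, ins_mul_mulF, mul_assoc,
      ← mul_assoc (ins _) (mulF (coordFun _)), ins_mul_mulF, mul_assoc]
    abel
  rw [← Module.End.mul_apply, h]
  simp only [LinearMap.sub_apply, Module.End.mul_apply, map_sub, resOp_mulF, resFun_confFactor,
    resFun_coordFun_last, map_zero, LinearMap.zero_apply, resOp_insC, resOp_wdg_last, sub_zero]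

lemma resDir_apply (k : ℕ) (w : Forms (m + 1)) :
    resDir k w = resOp ((dir (Fin.last m) ^ k) w) := rfl

lemma resIns_apply (k : ℕ) (w : Forms (m + 1)) :
    resIns k w = resOp (ins (Fin.last m) ((dir (Fin.last m) ^ k) w)) := rfl

/-- The double commutator is -∂_c, hence the coefficient C(k,2). The single commutator contributes
kσ and couples to the normal component of the form through c∧. -/
lemma resDir_lieOp (k : ℕ) (w : Forms (m + 1)) :
    resDir k (lieOp (confField (extVec b) (extMat A) s (extVec c)) w)
      = lieOp (confField b A s c) (resDir k w) + (k : ℂ) • mulF (confFactor s c) (resDir k w)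
        + (k : ℂ) • wdgC c (resIns (k - 1) w)
        - (k.choose 2 : ℂ) • dirC c (resDir (k - 2) w) := by
  have h := pow_mul_of_commutator (dir_mul_lieOp_confField b A s c)
    (dir_mul_normalCommutator s c) (dir_mul_dirC _ _) k
  rw [resDir_apply, ← Module.End.mul_apply, h]
  simp only [LinearMap.sub_apply, LinearMap.add_apply, LinearMap.smul_apply, Module.End.mul_apply,
    map_sub, map_add, map_smul, resOp_normalCommutator, resOp_dirC, ← resDir_apply,
    ← resIns_apply, smul_add,
    resOp_lieOp _ _ (resFun_confField_castSucc b A s c) (resFun_confField_last b A s c)]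
  rcases k with _ | k
  · simp
  · rw [← Module.End.mul_apply (dir _), Nat.add_sub_cancel, ← pow_succ', ← resDir_apply]
    abel

/-- The factor k + 1 instead of k comes from the commutator of the insertion itself with L_ξ, which
adds one more σ. -/
lemma resIns_lieOp (k : ℕ) (w : Forms (m + 1)) :
    resIns k (lieOp (confField (extVec b) (extMat A) s (extVec c)) w)
      = lieOp (confField b A s c) (resIns k w)
        + ((k : ℂ) + 1) • mulF (confFactor s c) (resIns k w)
        - (k : ℂ) • insC c (resDir (k - 1) w)
        - (k.choose 2 : ℂ) • dirC c (resIns (k - 2) w) := by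
  have h := pow_mul_of_commutator (dir_mul_lieOp_confField b A s c)
    (dir_mul_normalCommutator s c) (dir_mul_dirC _ _) k
  have hI : ∀ v, resOp (ins (Fin.last m)
      (lieOp (confField (extVec b) (extMat A) s (extVec c)) v))
      = lieOp (confField b A s c) (resOp (ins (Fin.last m) v))
        + mulF (confFactor s c) (resOp (ins (Fin.last m) v)) := by
    intro v
    rw [← Module.End.mul_apply, ins_mul_lieOp_confField]
    simp only [LinearMap.sub_apply, LinearMap.add_apply, Module.End.mul_apply, map_sub, map_add,
      resOp_mulF, resFun_confFactor, resFun_coordFun_last, map_zero, LinearMap.zero_apply, sub_zero,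
      resOp_lieOp _ _ (resFun_confField_castSucc b A s c) (resFun_confField_last b A s c)]
  have hZ : ∀ v, resOp (ins (Fin.last m) (dirC (extVec c) v))
      = dirC c (resOp (ins (Fin.last m) v)) := by
    intro v
    rw [← resOp_dirC, dirC]
    simp only [LinearMap.sum_apply, LinearMap.smul_apply, map_sum, map_smul,
      ← Module.End.mul_apply, dir_mul_ins]
  rw [resIns_apply, ← Module.End.mul_apply (dir (Fin.last m) ^ k), h]
  simp only [LinearMap.sub_apply, LinearMap.add_apply, LinearMap.smul_apply, Module.End.mul_apply,
    map_sub, map_add, map_smul, resOp_ins_normalCommutator, hI, hZ, ← resDir_apply,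
    ← resIns_apply, smul_sub]
  rcases k with _ | k
  · simp
  · rw [← Module.End.mul_apply (dir _), Nat.add_sub_cancel, ← pow_succ', ← resIns_apply]
    module

lemma pow_mul_comm_of_comm {R : Type*} [Monoid R] {T S : R} (h : T * S = S * T) (k : ℕ) :
    T ^ k * S = S * T ^ k := (Commute.pow_left h k).eq

lemma resDir_confFactor (k : ℕ) (w : Forms (m + 1)) :
    resDir k (mulF (confFactor s (extVec c)) w) = mulF (confFactor s c) (resDir k w) := by
  rw [resDir_apply, ← Module.End.mul_apply, pow_mul_comm_of_comm (dir_mul_confFactor s c),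
    Module.End.mul_apply, resOp_mulF, resFun_confFactor, resDir_apply]

lemma resIns_confFactor (k : ℕ) (w : Forms (m + 1)) :
    resIns k (mulF (confFactor s (extVec c)) w) = mulF (confFactor s c) (resIns k w) := by
  rw [resIns_apply, ← Module.End.mul_apply (dir (Fin.last m) ^ k), pow_mul_comm_of_comm (dir_mul_confFactor s c),
    Module.End.mul_apply, ← Module.End.mul_apply (ins _), ins_mul_mulF, Module.End.mul_apply,
    resOp_mulF, resFun_confFactor, resIns_apply]

end Tangent

/-! ## The infinitesimal conformal action and the Laplacian -/

section ConfOp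

variable {d : ℕ}

/-- The operator `L_ξ + μ σ` of a conformal vector field `ξ` with conformal factor `σ`. -/
def confOp (b : Fin d → ℂ) (A : Fin d → Fin d → ℂ) (s : ℂ) (c : Fin d → ℂ) (μ : ℂ) :
    Module.End ℂ (Forms d) := lieOp (confField b A s c) + μ • mulF (confFactor s c)

lemma dirC_mul_dOp (c : Fin d → ℂ) : (dirC c * dOp : Module.End ℂ (Forms d)) = dOp * dirC c := by
  simp only [dirC, Finset.mul_sum, Finset.sum_mul, mul_smul_comm, smul_mul_assoc, dir_mul_dOp]

lemma dirC_mul_delOp (c : Fin d → ℂ) :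
    (dirC c * delOp : Module.End ℂ (Forms d)) = delOp * dirC c := by
  simp only [dirC, Finset.mul_sum, Finset.sum_mul, mul_smul_comm, smul_mul_assoc, dir_mul_delOp]

lemma lapOp_mul_dirC (c : Fin d → ℂ) :
    (lapOp * dirC c : Module.End ℂ (Forms d)) = dirC c * lapOp := by
  simp only [dirC, Finset.mul_sum, Finset.sum_mul, mul_smul_comm, smul_mul_assoc, dir_mul_lapOp]

lemma lapOp_mul_insC (c : Fin d → ℂ) :
    (lapOp * insC c : Module.End ℂ (Forms d)) = insC c * lapOp := by
  simp only [insC, Finset.mul_sum, Finset.sum_mul, mul_smul_comm, smul_mul_assoc, lapOp_mul_ins]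

lemma lapOp_mul_wdgC (c : Fin d → ℂ) :
    (lapOp * wdgC c : Module.End ℂ (Forms d)) = wdgC c * lapOp := by
  simp only [wdgC, Finset.mul_sum, Finset.sum_mul, mul_smul_comm, smul_mul_assoc, lapOp_mul_wdg]

lemma insC_mul_dOp (c : Fin d → ℂ) :
    (insC c * dOp : Module.End ℂ (Forms d)) = dirC c - dOp * insC c := by
  simp only [insC, dirC, Finset.mul_sum, Finset.sum_mul, mul_smul_comm, smul_mul_assoc, ins_mul_dOp,
    smul_sub, Finset.sum_sub_distrib]

lemma delOp_mul_wdgC (c : Fin d → ℂ) :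
    (delOp * wdgC c : Module.End ℂ (Forms d)) = - dirC c - wdgC c * delOp := by
  simp only [wdgC, dirC, Finset.mul_sum, Finset.sum_mul, mul_smul_comm, smul_mul_assoc,
    delOp_mul_wdg, smul_sub, smul_neg, Finset.sum_sub_distrib, Finset.sum_neg_distrib]

/-- Here c∧ is the commutator of d with a linear function of gradient c, so the relation follows
from d² = 0. -/
lemma dOp_mul_wdgC (c : Fin d → ℂ) :
    (dOp * wdgC c : Module.End ℂ (Forms d)) = - (wdgC c * dOp) := by
  have h := dOp_mul_confFactor (d := d) 0 c
  have h2 : (dOp * (dOp * mulF (confFactor 0 c)) : Module.End ℂ (Forms d)) = 0 := by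
    rw [← mul_assoc, dOp_mul_dOp, zero_mul]
  rw [h, mul_add, ← mul_assoc, h, add_mul, mul_assoc, dOp_mul_dOp, mul_zero, zero_add] at h2
  exact eq_neg_of_add_eq_zero_right h2

lemma dOp_mul_confOp (b : Fin d → ℂ) (A : Fin d → Fin d → ℂ) (s : ℂ) (c : Fin d → ℂ) (μ : ℂ) :
    dOp * confOp b A s c μ = confOp b A s c μ * dOp + μ • wdgC c := by
  rw [confOp, mul_add, add_mul, dOp_mul_lieOp, mul_smul_comm, dOp_mul_confFactor, smul_add,
    smul_mul_assoc, add_assoc]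

variable (b : Fin d → ℂ) (A : Fin d → Fin d → ℂ) (s : ℂ) (c : Fin d → ℂ)

lemma dOp_dOp_apply (v : Forms d) : dOp (dOp v) = 0 := LinearMap.congr_fun dOp_mul_dOp v

lemma delOp_delOp_apply (v : Forms d) : delOp (delOp v) = 0 :=
  LinearMap.congr_fun delOp_mul_delOp v

lemma delOp_dOp_apply (v : Forms d) : delOp (dOp v) = lapOp v - dOp (delOp v) := by
  simp [lapOp]

lemma delOp_dirC_apply (v : Forms d) : delOp (dirC c v) = dirC c (delOp v) :=
  (LinearMap.congr_fun (dirC_mul_delOp c) v).symm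

lemma dOp_dirC_apply (v : Forms d) : dOp (dirC c v) = dirC c (dOp v) :=
  (LinearMap.congr_fun (dirC_mul_dOp c) v).symm

lemma insC_dOp_apply (v : Forms d) : insC c (dOp v) = dirC c v - dOp (insC c v) :=
  LinearMap.congr_fun (insC_mul_dOp c) v

lemma delOp_wdgC_apply (v : Forms d) : delOp (wdgC c v) = - dirC c v - wdgC c (delOp v) :=
  LinearMap.congr_fun (delOp_mul_wdgC c) v

lemma dOp_wdgC_apply (v : Forms d) : dOp (wdgC c v) = - wdgC c (dOp v) :=
  LinearMap.congr_fun (dOp_mul_wdgC c) v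

lemma lapPow_dOp_apply (j : ℕ) (v : Forms d) : (lapOp ^ j) (dOp v) = dOp ((lapOp ^ j) v) :=
  LinearMap.congr_fun (pow_mul_comm_of_comm lapOp_mul_dOp j) v

lemma lapPow_delOp_apply (j : ℕ) (v : Forms d) : (lapOp ^ j) (delOp v) = delOp ((lapOp ^ j) v) :=
  LinearMap.congr_fun (pow_mul_comm_of_comm lapOp_mul_delOp j) v

lemma lapPow_dirC_apply (j : ℕ) (v : Forms d) : (lapOp ^ j) (dirC c v) = dirC c ((lapOp ^ j) v) :=
  LinearMap.congr_fun (pow_mul_comm_of_comm (lapOp_mul_dirC c) j) v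

lemma lapPow_insC_apply (j : ℕ) (v : Forms d) : (lapOp ^ j) (insC c v) = insC c ((lapOp ^ j) v) :=
  LinearMap.congr_fun (pow_mul_comm_of_comm (lapOp_mul_insC c) j) v

lemma lapPow_wdgC_apply (j : ℕ) (v : Forms d) : (lapOp ^ j) (wdgC c v) = wdgC c ((lapOp ^ j) v) :=
  LinearMap.congr_fun (pow_mul_comm_of_comm (lapOp_mul_wdgC c) j) v

lemma lapOp_lapPow_apply (j : ℕ) (v : Forms d) : lapOp ((lapOp ^ j) v) = (lapOp ^ (j + 1)) v := by
  rw [pow_succ', Module.End.mul_apply]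

lemma degOp_mul_dOp : (degOp * dOp : Module.End ℂ (Forms d)) = dOp * degOp + dOp := by
  refine LinearMap.ext fun w => Forms.ext_val fun p x => ?_
  cases p with
  | zero =>
    change ((0 : ℕ) : ℂ) • (dOp w).val 0 x = ((dOp (degOp w)).val 0 + (dOp w).val 0) x
    rw [dOp_val_zero, dOp_val_zero]
    exact (smul_zero (A := (Euc d) [⋀^Fin 0]→L[ℝ] ℂ) ((0 : ℕ) : ℂ)).trans (add_zero 0).symm
  | succ p =>
    change ((p + 1 : ℕ) : ℂ) • (dOp w).val (p + 1) x
      = ((dOp (degOp w)).val (p + 1) + (dOp w).val (p + 1)) x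
    rw [dOp_val_succ, dOp_val_succ]
    have : extD ((degOp w).val p) = (p : ℂ) • extD (w.val p) := by
      have h := dOp.map_smul (p : ℂ) w
      have h2 := congrArg (fun v => Forms.val v (p + 1)) h
      simp only [Forms.val_smul] at h2
      rw [dOp_val_succ, dOp_val_succ] at h2
      exact h2
    rw [this]
    simp only [Pi.add_apply, Pi.smul_apply, Nat.cast_add, Nat.cast_one]
    module

lemma degOp_mul_delOp : (degOp * delOp : Module.End ℂ (Forms d)) = delOp * degOp - delOp := by
  have h : ∀ i : Fin d, (degOp * (ins i * dir i) : Module.End ℂ (Forms d))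
      = ins i * dir i * degOp - ins i * dir i := by
    intro i
    rw [← mul_assoc, degOp_mul_ins, sub_mul, mul_assoc, degOp_mul_dir, mul_assoc]
  simp only [delOp, mul_neg, neg_mul, Finset.mul_sum, Finset.sum_mul, h, Finset.sum_sub_distrib]
  abel

/-- The co-differential raises the weight μ by 2, through the term 2σδ of
`delOp_mul_lieOp_confField`. It is exactly covariant when μ = d - 2p. -/
lemma delOp_confOp_apply (hA : ∀ i j, A i j = - A j i) {v : Forms d} {p : ℂ} (hv : degOp v = p • v) (μ : ℂ) :
    delOp (confOp b A s c μ v) = confOp b A s c (μ + 2) (delOp v)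
      + ((d : ℂ) - 2 * p - μ) • insC c v := by
  have h := LinearMap.congr_fun (delOp_mul_lieOp_confField b A hA s c) v
  have h2 := LinearMap.congr_fun (delOp_mul_confFactor s c) v
  simp only [Module.End.mul_apply, LinearMap.add_apply, LinearMap.sub_apply, LinearMap.smul_apply,
    Module.End.one_apply, hv, map_sub, map_smul] at h h2
  simp only [confOp, LinearMap.add_apply, LinearMap.smul_apply, map_add, map_smul, h, h2]
  module

lemma dOp_confOp_apply (v : Forms d) (μ : ℂ) : dOp (confOp b A s c μ v)
    = confOp b A s c μ (dOp v) + μ • wdgC c v :=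
  LinearMap.congr_fun (dOp_mul_confOp b A s c μ) v

lemma degOp_lapOp_apply {v : Forms d} {p : ℂ} (hv : degOp v = p • v) :
    degOp (lapOp v) = p • lapOp v := by
  have h1 := fun v : Forms d => LinearMap.congr_fun (degOp_mul_dOp (d := d)) v
  have h2 := fun v : Forms d => LinearMap.congr_fun (degOp_mul_delOp (d := d)) v
  simp only [Module.End.mul_apply, LinearMap.add_apply, LinearMap.sub_apply] at h1 h2
  simp only [lapOp, Module.End.mul_apply, LinearMap.add_apply, map_add, h1, h2, hv, map_smul,
    map_sub]
  module

lemma degOp_lapPow_apply {v : Forms d} {p : ℂ} (hv : degOp v = p • v) (j : ℕ) :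
    degOp ((lapOp ^ j) v) = p • (lapOp ^ j) v := by
  induction j with
  | zero => simpa using hv
  | succ j ih => rw [← lapOp_lapPow_apply, degOp_lapOp_apply ih]

lemma degOp_dOp_apply {v : Forms d} {p : ℂ} (hv : degOp v = p • v) :
    degOp (dOp v) = (p + 1) • dOp v := by
  have h := LinearMap.congr_fun (degOp_mul_dOp (d := d)) v
  simp only [Module.End.mul_apply, LinearMap.add_apply, hv, map_smul] at h
  rw [h]
  module

lemma degOp_delOp_apply {v : Forms d} {p : ℂ} (hv : degOp v = p • v) :
    degOp (delOp v) = (p - 1) • delOp v := by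
  have h := LinearMap.congr_fun (degOp_mul_delOp (d := d)) v
  simp only [Module.End.mul_apply, LinearMap.sub_apply, hv, map_smul] at h
  rw [h]
  module

lemma dOp_delOp_confOp_apply (hA : ∀ i j, A i j = - A j i) {v : Forms d} {p : ℂ}
    (hv : degOp v = p • v) (μ : ℂ) :
    dOp (delOp (confOp b A s c μ v)) = confOp b A s c (μ + 2) (dOp (delOp v))
      + (μ + 2) • wdgC c (delOp v) + ((d : ℂ) - 2 * p - μ) • dOp (insC c v) := by
  rw [delOp_confOp_apply b A s c hA hv, map_add, dOp_confOp_apply, map_smul]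

lemma lapOp_confOp_apply (hA : ∀ i j, A i j = - A j i) {v : Forms d} {p : ℂ}
    (hv : degOp v = p • v) (μ : ℂ) :
    lapOp (confOp b A s c μ v) = confOp b A s c (μ + 2) (lapOp v)
      + ((d : ℂ) - 2 - 2 * μ - 2 * p) • dirC c v
      + (2 : ℂ) • (wdgC c (delOp v) + dOp (insC c v)) := by
  have h1 := dOp_delOp_confOp_apply b A s c hA hv μ
  have h2 : delOp (dOp (confOp b A s c μ v)) = confOp b A s c (μ + 2) (delOp (dOp v))
      + ((d : ℂ) - 2 * (p + 1) - μ) • insC c (dOp v) + μ • delOp (wdgC c v) := by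
    rw [dOp_confOp_apply, map_add, delOp_confOp_apply b A s c hA (degOp_dOp_apply hv), map_smul]
  have hl : ∀ u : Forms d, lapOp u = delOp (dOp u) + dOp (delOp u) := fun u => rfl
  rw [hl, h1, h2, hl v, map_add, insC_dOp_apply, delOp_wdgC_apply]
  module

/-- Both correction terms for one Laplacian commute with Δ, so they only accumulate. The weight
grows by 2 at each step, and summing the resulting coefficients of ∂_c gives j(d - 2μ - 2p - 2j). -/
lemma lapPow_confOp_apply (hA : ∀ i j, A i j = - A j i) {v : Forms d} {p : ℂ}
    (hv : degOp v = p • v) (μ : ℂ) (j : ℕ) :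
    (lapOp ^ j) (confOp b A s c μ v) = confOp b A s c (μ + 2 * j) ((lapOp ^ j) v)
      + (j * ((d : ℂ) - 2 * μ - 2 * p - 2 * j)) • dirC c ((lapOp ^ (j - 1)) v)
      + (2 * j : ℂ) • (wdgC c (delOp ((lapOp ^ (j - 1)) v)) + dOp (insC c ((lapOp ^ (j - 1)) v))) := by
  induction j with
  | zero => simp
  | succ j ih =>
    rw [← lapOp_lapPow_apply, ih, map_add, map_add,
      lapOp_confOp_apply b A s c hA (degOp_lapPow_apply hv j), lapOp_lapPow_apply, map_smul,
      map_smul, map_add, Nat.add_sub_cancel]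
    have e1 := fun u : Forms d => lapPow_dirC_apply c 1 u
    have e2 := fun u : Forms d => lapPow_wdgC_apply c 1 u
    have e3 := fun u : Forms d => lapPow_insC_apply c 1 u
    have e4 := fun u : Forms d => lapPow_dOp_apply 1 u
    have e5 := fun u : Forms d => lapPow_delOp_apply 1 u
    simp only [pow_one] at e1 e2 e3 e4 e5
    rw [e1, e2, e4, e5, e3, lapOp_lapPow_apply]
    have hμ : μ + 2 * ((j : ℂ) + 1) = μ + 2 * j + 2 := by ring
    rcases j with _ | j
    · simp only [Nat.cast_zero, Nat.cast_one, zero_add, zero_mul, zero_smul, mul_zero,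
        pow_zero, pow_one, add_zero, mul_one]
      module
    · rw [Nat.add_sub_cancel]
      push_cast at hμ ⊢
      rw [hμ]
      module

end ConfOp

/-! ### Conformal covariance of the building blocks -/

section Blocks

variable {m : ℕ}

lemma degOp_resOp (w : Forms (m + 1)) : degOp (resOp w) = resOp (degOp w) :=
  Forms.ext_val fun _ _ => rfl

lemma degOp_resDir {w : Forms (m + 1)} {p : ℂ} (hw : degOp w = p • w) (k : ℕ) :
    degOp (resDir k w) = p • resDir k w := by
  have h := LinearMap.congr_fun (pow_mul_comm_of_comm (degOp_mul_dir (Fin.last m)).symm k) w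
  simp only [Module.End.mul_apply, hw, map_smul] at h
  rw [resDir_apply, degOp_resOp, ← h, map_smul]

lemma degOp_resIns {w : Forms (m + 1)} {p : ℂ} (hw : degOp w = p • w) (k : ℕ) :
    degOp (resIns k w) = (p - 1) • resIns k w := by
  have h := LinearMap.congr_fun (pow_mul_comm_of_comm (degOp_mul_dir (Fin.last m)).symm k) w
  have h2 := LinearMap.congr_fun (degOp_mul_ins (Fin.last m)) ((dir (Fin.last m) ^ k) w)
  simp only [Module.End.mul_apply, hw, map_smul, LinearMap.sub_apply] at h h2
  rw [resIns_apply, degOp_resOp, h2, ← h, map_smul, map_sub, map_smul]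
  module

/-- The building blocks of the operator in Gegenbauer form. -/
def gegenBlock (κ : ℂ) (j k : ℕ) (w : Forms (m + 1)) : Forms m :=
  κ • (lapOp ^ j) (resDir k w) + (k : ℂ) • (lapOp ^ j) (dOp (resIns (k - 1) w))
    + (2 * j : ℂ) • (lapOp ^ (j - 1)) (dOp (delOp (resDir k w)))

/-- The obstructions to the conformal covariance of the building blocks. -/
def blockDefect (κ : ℂ) (c : Fin m → ℂ) (j k : ℕ) (w : Forms (m + 1)) : Forms m :=
  κ • dirC c ((lapOp ^ j) (resDir k w)) + (2 : ℂ) • dOp (insC c ((lapOp ^ j) (resDir k w)))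
    + (k : ℂ) • dirC c (dOp ((lapOp ^ j) (resIns (k - 1) w)))
    + (2 * j : ℂ) • dirC c (dOp (delOp ((lapOp ^ (j - 1)) (resDir k w))))

variable (b : Fin m → ℂ) (A : Fin m → Fin m → ℂ) (s : ℂ) (c : Fin m → ℂ)

lemma resDir_confOp (k : ℕ) (μ : ℂ) (w : Forms (m + 1)) :
    resDir k (confOp (extVec b) (extMat A) s (extVec c) μ w)
      = confOp b A s c (μ + k) (resDir k w) + (k : ℂ) • wdgC c (resIns (k - 1) w)
        - (k.choose 2 : ℂ) • dirC c (resDir (k - 2) w) := by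
  simp only [confOp, LinearMap.add_apply, LinearMap.smul_apply, map_add, map_smul, resDir_lieOp,
    resDir_confFactor]
  module

lemma resIns_confOp (k : ℕ) (μ : ℂ) (w : Forms (m + 1)) :
    resIns k (confOp (extVec b) (extMat A) s (extVec c) μ w)
      = confOp b A s c (μ + k + 1) (resIns k w) - (k : ℂ) • insC c (resDir (k - 1) w)
        - (k.choose 2 : ℂ) • dirC c (resIns (k - 2) w) := by
  simp only [confOp, LinearMap.add_apply, LinearMap.smul_apply, map_add, map_smul, resIns_lieOp,
    resIns_confFactor]
  module

/-- The condition on κ makes the three summands of the block land in the same weight -κ. It also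
kills the terms beginning with c∧: the coefficient of c∧ Δ^j ι^* i_n ∂_n^k is (k+1)(κ + μ + k + 1 +
2j), while the c∧ dδ terms from the second and third summands cancel each other. What remains
consists of ∂_c terms and d i_c terms and groups into two defects. -/
lemma gegenBlock_confOp (hA : ∀ i j, A i j = - A j i) {w : Forms (m + 1)} {p : ℂ}
    (hw : degOp w = p • w) {κ μ : ℂ} (j k : ℕ) (h : κ + μ + (k + 1 : ℕ) + 2 * j = 0) :
    gegenBlock κ j (k + 1) (confOp (extVec b) (extMat A) s (extVec c) μ w)
      = confOp b A s c (- κ) (gegenBlock κ j (k + 1) w)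
        + (j * (m - 2 * p - 2 * μ - 2 * (k + 1 : ℕ) - 2 * j)) • blockDefect κ c (j - 1) (k + 1) w
        - ((k + 1).choose 2 : ℂ) • blockDefect κ c j (k - 1) w := by
  have hU := degOp_resDir hw (k + 1)
  have hV := degOp_resIns hw k
  have hdV : degOp (dOp (resIns k w)) = p • dOp (resIns k w) := by
    rw [degOp_dOp_apply hV, sub_add_cancel]
  have hdU : degOp (dOp (delOp (resDir (k + 1) w))) = p • dOp (delOp (resDir (k + 1) w)) := by
    rw [degOp_dOp_apply (degOp_delOp_apply hU), sub_add_cancel]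
  rw [gegenBlock, resDir_confOp, resIns_confOp]
  simp only [map_add, map_sub, map_smul, Nat.add_sub_cancel, dOp_confOp_apply,
    dOp_delOp_confOp_apply b A s c hA hU, lapPow_confOp_apply b A s c hA hU,
    lapPow_confOp_apply b A s c hA hdV, lapPow_confOp_apply b A s c hA hdU]
  have e1 : μ + (k + 1 : ℕ) + 2 * j = - κ := by linear_combination h
  have e2 : μ + k + 1 + 2 * j = - κ := by
    push_cast at h
    linear_combination h
  rw [e1, e2]
  have i1 : k + 1 - 2 = k - 1 := by omega
  have i2 : k - 1 - 1 = k - 2 := by omega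
  rcases j with _ | i
  · have hκ : κ = - (μ + (k + 1 : ℕ)) := by
      push_cast at h ⊢
      linear_combination h
    simp only [blockDefect, gegenBlock, map_add, map_smul, Nat.add_sub_cancel, i1, i2, hκ,
      Nat.cast_choose_two, pow_zero, Module.End.one_apply, dOp_dirC_apply]
    rcases k with _ | k
    · simp only [Nat.cast_zero, Nat.cast_one, zero_add]
      module
    · rw [Nat.add_sub_cancel]
      push_cast
      module
  · have e3 : μ + (k + 1 : ℕ) + 2 + 2 * (i : ℕ) = - κ := by
      push_cast at h ⊢
      linear_combination h
    rw [Nat.add_sub_cancel, e3]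
    simp only [blockDefect, gegenBlock, map_add, map_smul, Nat.add_sub_cancel,
      lapPow_dOp_apply, lapPow_delOp_apply, lapPow_dirC_apply, lapPow_insC_apply,
      lapPow_wdgC_apply, delOp_wdgC_apply, dOp_wdgC_apply, dOp_dirC_apply, insC_dOp_apply,
      delOp_dOp_apply, delOp_delOp_apply, dOp_dOp_apply, delOp_dirC_apply,
      lapOp_lapPow_apply, map_sub, map_neg, map_zero]
    have hκ : κ = - (μ + (k + 1 : ℕ) + 2 * (i + 1 : ℕ)) := by linear_combination h
    have hl : ∀ x : Forms m, lapOp (delOp x) = delOp (lapOp x) := fun x =>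
      LinearMap.congr_fun lapOp_mul_delOp x
    rw [Nat.cast_choose_two, Nat.cast_choose_two, hκ, i1, i2, hl, lapOp_lapPow_apply]
    generalize confOp b A s c _ = C
    -- The boundary cases are separate because j - 1 and k - 1 are truncated subtractions; wherever
    -- truncation occurs the coefficient in front is zero.
    rcases i with _ | i <;> rcases k with _ | k
    · simp only [Nat.cast_zero, Nat.cast_one, zero_add]
      module
    · rw [Nat.add_sub_cancel]
      simp only [Nat.cast_zero, Nat.cast_one, Nat.cast_add, zero_add]
      module
    · rw [Nat.add_sub_cancel]
      simp only [Nat.cast_zero, Nat.cast_one, Nat.cast_add, zero_add]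
      module
    · rw [Nat.add_sub_cancel, Nat.add_sub_cancel]
      push_cast
      module

/-- The coefficient recursion which makes a combination of building blocks covariant. -/
lemma sum_gegenBlock_confOp (hA : ∀ i j, A i j = - A j i) {w : Forms (m + 1)} {p : ℂ}
    (hw : degOp w = p • w) {κ μ : ℂ} (N : ℕ) (h : κ + μ + 2 * N + 1 = 0) (g : ℕ → ℂ)
    (hg : ∀ j < N, g (j + 1) * ((j + 1) * (m - 2 * p - 2 * μ - 4 * N + 2 * j))
      = g j * ((2 * (N - j : ℕ) + 1).choose 2 : ℕ)) :
    ∑ j ∈ Finset.range (N + 1), g j • gegenBlock κ j (2 * (N - j) + 1)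
        (confOp (extVec b) (extMat A) s (extVec c) μ w)
      = confOp b A s c (- κ) (∑ j ∈ Finset.range (N + 1),
          g j • gegenBlock κ j (2 * (N - j) + 1) w) := by
  have hstep : ∀ j ∈ Finset.range (N + 1), g j • gegenBlock κ j (2 * (N - j) + 1)
        (confOp (extVec b) (extMat A) s (extVec c) μ w)
      = confOp b A s c (- κ) (g j • gegenBlock κ j (2 * (N - j) + 1) w)
        + ((g j * (j * (m - 2 * p - 2 * μ - 4 * N + 2 * j - 2)))
            • blockDefect κ c (j - 1) (2 * (N - j) + 1) w
          - (g j * ((2 * (N - j : ℕ) + 1).choose 2 : ℕ))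
            • blockDefect κ c j (2 * (N - j) - 1) w) := by
    intro j hj
    have hj' : j ≤ N := Nat.lt_succ_iff.1 (Finset.mem_range.1 hj)
    have hc : ((2 * (N - j) + 1 : ℕ) : ℂ) = 2 * (N - j) + 1 := by
      push_cast [Nat.cast_sub hj']
      ring
    rw [gegenBlock_confOp b A s c hA hw j (2 * (N - j)) (by rw [hc]; linear_combination h), hc,
      map_smul]
    module
  rw [Finset.sum_congr rfl hstep, Finset.sum_add_distrib, ← map_sum, Finset.sum_sub_distrib,
    add_eq_left, sub_eq_zero]
  -- The lower defect of block j + 1 is the upper defect of block j, since 2(N - (j+1)) + 1 = 2(N-j)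
  -- - 1. The recursion equates their coefficients.
  have hz : ∑ j ∈ Finset.range N, (g (j + 1) * (((j + 1 : ℕ) : ℂ)
        * (m - 2 * p - 2 * μ - 4 * N + 2 * (j + 1 : ℕ) - 2)))
        • blockDefect κ c (j + 1 - 1) (2 * (N - (j + 1)) + 1) w
      = ∑ j ∈ Finset.range N, (g j * ((2 * (N - j : ℕ) + 1).choose 2 : ℕ))
        • blockDefect κ c j (2 * (N - j) - 1) w := by
    refine Finset.sum_congr rfl fun j hj => ?_
    have hj' := Finset.mem_range.1 hj
    have e : 2 * (N - (j + 1)) + 1 = 2 * (N - j) - 1 := by omega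
    rw [← hg j hj', e, Nat.add_sub_cancel]
    congr 2
    push_cast
    ring
  -- The two unmatched ends vanish: the factor j is 0 at j = 0, and C(1,2) = 0 at j = N.
  rw [Finset.sum_range_succ', hz, Finset.sum_range_succ]
  simp

end Blocks

/-! ## Coefficient identities -/

lemma prod_Icc_succ_eq {R : Type*} [CommRing R] (f : ℕ → R) (i N : ℕ) (hi : i ≤ N) :
    f i * ∏ k ∈ Finset.Icc (i + 1) N, f k = ∏ k ∈ Finset.Icc i N, f k := by
  rw [← Finset.insert_Icc_succ_left_eq_Icc hi, Finset.prod_insert (by simp)]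
  rfl

/-- Two consecutive β's share all but one factor of each product, and both binomials are rational
multiples of C(N+1, i). After factoring these out a polynomial identity is left. -/
lemma gammaCoeff_eq_gammaProd (n N p i : ℕ) (hi : i ∈ Finset.Icc 1 N) (lam : ℂ) :
    gammaCoeff n N p i lam = gammaProd n N p i lam := by
  obtain ⟨h1, hN⟩ := Finset.mem_Icc.1 hi
  obtain ⟨j, rfl⟩ : ∃ j, i = j + 1 := ⟨i - 1, by omega⟩
  have hN1 : ((N : ℂ) + 1) ≠ 0 := by exact_mod_cast Nat.succ_ne_zero N
  have e1 : ∏ k ∈ Finset.Icc (j + 1) N, (2 * lam + n - 2 * (k : ℂ))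
      = (2 * lam + n - 2 * (j + 1 : ℕ)) * ∏ k ∈ Finset.Icc (j + 1 + 1) N, (2 * lam + n - 2 * (k : ℂ)) :=
    (prod_Icc_succ_eq (fun k : ℕ => 2 * lam + n - 2 * (k : ℂ)) (j + 1) N hN).symm
  have e2 : ∏ k ∈ Finset.Icc 1 (j + 1), (2 * lam + n - 2 * (k : ℂ) - 2 * N - 1)
      = (∏ k ∈ Finset.Icc 1 j, (2 * lam + n - 2 * (k : ℂ) - 2 * N - 1))
        * (2 * lam + n - 2 * (j + 1 : ℕ) - 2 * N - 1) :=
    Finset.prod_Icc_succ_top (by omega) _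
  have c1 : (N.choose (j + 1) : ℂ) * (N + 1) = ((N + 1).choose (j + 1) : ℂ) * (N - j) := by
    have h := Nat.choose_mul_succ_eq N (j + 1)
    have : ((N + 1 - (j + 1) : ℕ) : ℂ) = N - j := by
      rw [Nat.cast_sub (by omega)]
      push_cast
      ring
    rw [← this]
    exact_mod_cast h
  have c2 : (N.choose j : ℂ) * (N + 1) = ((N + 1).choose (j + 1) : ℂ) * (j + 1) := by
    have h := Nat.add_one_mul_choose_eq N j
    rw [mul_comm]
    exact_mod_cast h
  rw [gammaCoeff, gammaProd, betaCoeff, betaCoeff, Nat.add_sub_cancel, e1, e2]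
  have c1' : (N.choose (j + 1) : ℂ) = ((N + 1).choose (j + 1) : ℂ) * (N - j) / (N + 1) := by
    rw [← c1, mul_div_cancel_right₀ _ hN1]
  have c2' : (N.choose j : ℂ) = ((N + 1).choose (j + 1) : ℂ) * (j + 1) / (N + 1) := by
    rw [← c2, mul_div_cancel_right₀ _ hN1]
  rw [c1', c2']
  generalize (∏ k ∈ Finset.Icc (j + 1 + 1) N, (2 * lam + n - 2 * (k : ℂ))) = P
  generalize (∏ k ∈ Finset.Icc 1 j, (2 * lam + n - 2 * (k : ℂ) - 2 * N - 1)) = Q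
  generalize ((N + 1).choose (j + 1) : ℂ) = B
  have hf : ((2 * N + 1).factorial : ℂ) ≠ 0 := by exact_mod_cast Nat.factorial_ne_zero _
  push_cast
  field_simp
  ring

lemma sum_choose_succ_mul {R : Type*} [CommRing R] (M : ℕ) (f : ℕ → R) :
    ∑ i ∈ Finset.range (M + 2), ((M + 1).choose i : R) * f i
      = ∑ i ∈ Finset.range (M + 1), (M.choose i : R) * f i
        + ∑ i ∈ Finset.range (M + 1), (M.choose i : R) * f (i + 1) := by
  have h : ∑ i ∈ Finset.range (M + 1), (M.choose i : R) * f i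
      = ∑ i ∈ Finset.range (M + 1), (M.choose (i + 1) : R) * f (i + 1) + f 0 := by
    rw [Finset.sum_range_succ', Finset.sum_range_succ _ M, Nat.choose_succ_self]
    simp
  rw [h, Finset.sum_range_succ']
  simp only [Nat.choose_succ_succ', Nat.cast_add, add_mul, Finset.sum_add_distrib]
  simp
  ring

/-- A Vandermonde convolution for products of arithmetic progressions. -/
lemma sum_choose_mul_prod {R : Type*} [CommRing R] (M : ℕ) (A B : R) :
    ∑ i ∈ Finset.range (M + 1), (M.choose i : R) * ((-1) ^ i
        * (∏ k ∈ Finset.range (M - i), (A - 2 * (i + 1 + k)))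
        * ∏ k ∈ Finset.range i, (B - 2 * (k + 1)))
      = ∏ k ∈ Finset.range M, (A - B - 2 * k) := by
  induction M generalizing A B with
  | zero => simp
  | succ M ih =>
    -- Pascal's rule splits the sum in two. The second half is the induction hypothesis for (A-2,
    -- B-2), which has the same difference A - B. The factors A - 2(M+1) and -(B-2) that come out
    -- add up to the new factor A - B - 2M.
    rw [sum_choose_succ_mul, Finset.prod_range_succ]
    have h1 : ∑ i ∈ Finset.range (M + 1), (M.choose i : R) * ((-1) ^ i
        * (∏ k ∈ Finset.range (M + 1 - i), (A - 2 * (i + 1 + k)))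
        * ∏ k ∈ Finset.range i, (B - 2 * (k + 1)))
        = (A - 2 * (M + 1)) * ∏ k ∈ Finset.range M, (A - B - 2 * k) := by
      rw [← ih, Finset.mul_sum]
      refine Finset.sum_congr rfl fun i hi => ?_
      have hi' : i ≤ M := Nat.lt_succ_iff.1 (Finset.mem_range.1 hi)
      rw [Nat.succ_sub hi', Finset.prod_range_succ, Nat.cast_sub hi']
      ring
    have h2 : ∑ i ∈ Finset.range (M + 1), (M.choose i : R) * ((-1) ^ (i + 1)
        * (∏ k ∈ Finset.range (M + 1 - (i + 1)), (A - 2 * ((i + 1 : ℕ) + 1 + k)))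
        * ∏ k ∈ Finset.range (i + 1), (B - 2 * (k + 1)))
        = - (B - 2) * ∏ k ∈ Finset.range M, (A - B - 2 * k) := by
      have e : ∏ k ∈ Finset.range M, (A - B - 2 * (k : R))
          = ∏ k ∈ Finset.range M, ((A - 2) - (B - 2) - 2 * (k : R)) :=
        Finset.prod_congr rfl fun k _ => by ring
      rw [e, ← ih, Finset.mul_sum]
      refine Finset.sum_congr rfl fun i _ => ?_
      have e1 : ∏ k ∈ Finset.range (M + 1 - (i + 1)), (A - 2 * (((i + 1 : ℕ) : R) + 1 + k))
          = ∏ k ∈ Finset.range (M - i), (A - 2 - 2 * ((i : R) + 1 + k)) := by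
        rw [Nat.add_sub_add_right]
        exact Finset.prod_congr rfl fun k _ => by push_cast; ring
      have e2 : ∏ k ∈ Finset.range (i + 1), (B - 2 * ((k : R) + 1))
          = (∏ k ∈ Finset.range i, (B - 2 - 2 * ((k : R) + 1))) * (B - 2) := by
        rw [Finset.prod_range_succ']
        congr 1
        · exact Finset.prod_congr rfl fun k _ => by push_cast; ring
        · simp
      rw [e1, e2]
      ring
    rw [h1, h2]
    ring

/-- The product runs over the odd numbers from 2r + 3 to 2(M+r) + 1, a quotient of two double
factorials. -/
lemma factorial_mul_prod_odd (M r : ℕ) :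
    (2 : ℂ) ^ M * (M + r).factorial * (2 * r + 1).factorial
        * ∏ k ∈ Finset.range M, (2 * ((M + r : ℕ) : ℂ) + 1 - 2 * k)
      = (2 * (M + r) + 1).factorial * r.factorial := by
  induction M with
  | zero =>
    simp
    ring
  | succ M ih =>
    have e : ∏ k ∈ Finset.range (M + 1), (2 * ((M + 1 + r : ℕ) : ℂ) + 1 - 2 * k)
        = (∏ k ∈ Finset.range M, (2 * ((M + r : ℕ) : ℂ) + 1 - 2 * k)) * (2 * (M + r) + 3) := by
      rw [Finset.prod_range_succ']
      congr 1
      · exact Finset.prod_congr rfl fun k _ => by push_cast; ring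
      · push_cast
        ring
    have f1 : M + 1 + r = (M + r) + 1 := by ring
    have f2 : 2 * (M + 1 + r) + 1 = (2 * (M + r) + 1) + 1 + 1 := by ring
    rw [e, f2, Nat.factorial_succ (2 * (M + r) + 1 + 1), Nat.factorial_succ (2 * (M + r) + 1), f1,
      Nat.factorial_succ (M + r)]
    push_cast at ih ⊢
    linear_combination (2 * ((M : ℂ) + r + 1)) * (2 * (M + r) + 3) * ih

/-- This produces the Gegenbauer coefficients. After C(N,i)C(i,r) = C(N,r)C(N-r,i-r) the sum is a
Vandermonde convolution whose two progressions differ by the constant 2N + 1. Hence λ survives only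
in the first r factors of the second product, and these form the product in b_(N-r). -/
lemma sum_betaCoeff_mul_choose (n N r : ℕ) (hr : r ≤ N) (lam : ℂ) :
    ∑ i ∈ Finset.range (N + 1), betaCoeff n N i lam * (i.choose r : ℂ)
      = gegenOdd n N (N - r) lam := by
  obtain ⟨M, rfl⟩ : ∃ M, N = M + r := ⟨N - r, by omega⟩
  rw [Nat.add_sub_cancel]
  have hsplit : M + r + 1 = r + (M + 1) := by ring
  rw [hsplit, Finset.sum_range_add, Finset.sum_eq_zero, zero_add]
  swap
  · intro i hi
    rw [Nat.choose_eq_zero_of_lt (Finset.mem_range.1 hi), Nat.cast_zero, mul_zero]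
  set α : ℂ := 2 * lam + n with hα
  set P : ℂ := ∏ k ∈ Finset.range r, (α - 2 * (k + 1) - 2 * (M + r : ℕ) - 1) with hP
  have hterm : ∀ i ∈ Finset.range (M + 1), betaCoeff n (M + r) (r + i) lam * ((r + i).choose r : ℂ)
      = ((-1) ^ r * 2 ^ (M + r) * (((M + r).factorial : ℂ) / ((2 * (M + r) + 1).factorial : ℂ))
          * ((M + r).choose r : ℂ) * P)
        * ((M.choose i : ℂ) * ((-1) ^ i
          * (∏ k ∈ Finset.range (M - i), ((α - 2 * r) - 2 * (i + 1 + k)))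
          * ∏ k ∈ Finset.range i, ((α - 2 * r - 2 * (M + r : ℕ) - 1) - 2 * (k + 1)))) := by
    intro i hi
    have hi' : i ≤ M := Nat.lt_succ_iff.1 (Finset.mem_range.1 hi)
    have c : ((M + r).choose (r + i) : ℂ) * ((r + i).choose r : ℂ)
        = ((M + r).choose r : ℂ) * (M.choose i : ℂ) := by
      have h := Nat.choose_mul (n := M + r) (k := r + i) (s := r) (by omega)
      rw [Nat.add_sub_cancel, Nat.add_sub_cancel_left] at h
      exact_mod_cast h
    have p1 : ∏ k ∈ Finset.Icc (r + i + 1) (M + r), (α - 2 * (k : ℂ))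
        = ∏ k ∈ Finset.range (M - i), ((α - 2 * r) - 2 * ((i : ℂ) + 1 + k)) := by
      rw [← Finset.Ico_add_one_right_eq_Icc, Finset.prod_Ico_eq_prod_range]
      have : M + r + 1 - (r + i + 1) = M - i := by omega
      rw [this]
      exact Finset.prod_congr rfl fun k _ => by push_cast; ring
    have p2 : ∏ k ∈ Finset.Icc 1 (r + i), (α - 2 * (k : ℂ) - 2 * (M + r : ℕ) - 1)
        = P * ∏ k ∈ Finset.range i, ((α - 2 * r - 2 * (M + r : ℕ) - 1) - 2 * ((k : ℂ) + 1)) := by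
      rw [← Finset.Ico_add_one_right_eq_Icc, Finset.prod_Ico_eq_prod_range, Nat.add_sub_cancel,
        Finset.prod_range_add]
      congr 1
      · exact Finset.prod_congr rfl fun k _ => by push_cast; ring
      · exact Finset.prod_congr rfl fun k _ => by push_cast; ring
    rw [betaCoeff, ← hα, p1, p2, pow_add]
    linear_combination ((-1) ^ r * (-1) ^ i * 2 ^ (M + r)
      * (((M + r).factorial : ℂ) / ((2 * (M + r) + 1).factorial : ℂ))
      * (∏ k ∈ Finset.range (M - i), ((α - 2 * r) - 2 * ((i : ℂ) + 1 + k)))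
      * (P * ∏ k ∈ Finset.range i, ((α - 2 * r - 2 * (M + r : ℕ) - 1) - 2 * ((k : ℂ) + 1)))) * c
  rw [Finset.sum_congr rfl hterm, ← Finset.mul_sum, sum_choose_mul_prod, gegenOdd]
  have q1 : ∏ k ∈ Finset.Ico M (M + r), (2 * lam - 4 * (M + r : ℕ) + 2 * (k : ℂ) + n - 1) = P := by
    rw [Finset.prod_Ico_eq_prod_range, Nat.add_sub_cancel_left, ← Finset.prod_range_reflect, hP]
    refine Finset.prod_congr rfl fun k hk => ?_
    have hk' := Finset.mem_range.1 hk
    rw [Nat.sub_sub, Nat.cast_add M (r - (1 + k)), Nat.cast_sub (by omega), hα]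
    push_cast
    ring
  -- The difference A - B is 2N + 1 with N = M + r, independent of λ, so the value of the
  -- convolution is a ratio of factorials.
  have q2 : ∏ k ∈ Finset.range M, (α - 2 * r - (α - 2 * r - 2 * ((M + r : ℕ) : ℂ) - 1) - 2 * (k : ℂ))
      = ∏ k ∈ Finset.range M, (2 * ((M + r : ℕ) : ℂ) + 1 - 2 * k) :=
    Finset.prod_congr rfl fun k _ => by ring
  rw [q1, q2]
  have hfac := factorial_mul_prod_odd M r
  generalize ∏ k ∈ Finset.range M, (2 * ((M + r : ℕ) : ℂ) + 1 - 2 * k) = Q at hfac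
  have e1 : M + r - M = r := by omega
  have e2 : 2 * (M + r) - 2 * M + 1 = 2 * r + 1 := by omega
  have hc : ((M + r).choose r : ℂ) = (M + r).factorial / (M.factorial * r.factorial) := by
    rw [Nat.add_choose, Nat.cast_div (Nat.factorial_mul_factorial_dvd_factorial_add M r)]
    · push_cast
      ring
    · exact_mod_cast Nat.mul_ne_zero (Nat.factorial_ne_zero _) (Nat.factorial_ne_zero _)
  rw [e1, e2, hc]
  have h1 : ((2 * (M + r) + 1).factorial : ℂ) ≠ 0 := by exact_mod_cast Nat.factorial_ne_zero _
  have h2 : ((2 * r + 1).factorial : ℂ) ≠ 0 := by exact_mod_cast Nat.factorial_ne_zero _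
  have h3 : (M.factorial : ℂ) ≠ 0 := by exact_mod_cast Nat.factorial_ne_zero _
  have h4 : (r.factorial : ℂ) ≠ 0 := by exact_mod_cast Nat.factorial_ne_zero _
  have hm2 : (-2 : ℂ) ^ r = (-1) ^ r * 2 ^ r := by rw [← mul_pow]; norm_num
  rw [hm2, pow_add]
  field_simp
  linear_combination (((M + r).factorial : ℂ) * P) * hfac

/-- The shift of λ by one aligns the two products. Together with `gegenOdd_sub_one` it lets a single
coefficient b_j^(N)(λ) govern all three summands of a block. -/
lemma gegenEven_sub_one (m N j : ℕ) (hj : j ≤ N) (lam : ℂ) :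
    gegenEven (m + 1) N j (lam - 1) = (2 * (N - j) + 1) * gegenOdd (m + 1) N j lam := by
  obtain ⟨q, rfl⟩ : ∃ q, N = j + q := ⟨N - j, by omega⟩
  have e2 : 2 * (j + q) - 2 * j = 2 * q := by omega
  have p : ∏ k ∈ Finset.Ico j (j + q),
        (2 * (lam - 1) - 4 * ((j + q : ℕ) : ℂ) + 2 * (k : ℂ) + (m + 1 : ℕ) + 1)
      = ∏ k ∈ Finset.Ico j (j + q),
        (2 * lam - 4 * ((j + q : ℕ) : ℂ) + 2 * (k : ℂ) + (m + 1 : ℕ) - 1) :=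
    Finset.prod_congr rfl fun k _ => by ring
  rw [gegenEven, gegenOdd, p, e2, Nat.factorial_succ (2 * q)]
  have h2 : ((2 * q).factorial : ℂ) ≠ 0 := by exact_mod_cast Nat.factorial_ne_zero _
  have h3 : (j.factorial : ℂ) ≠ 0 := by exact_mod_cast Nat.factorial_ne_zero _
  have h4 : (2 * q + 1 : ℂ) ≠ 0 := by exact_mod_cast Nat.succ_ne_zero (2 * q)
  push_cast
  field_simp
  ring

lemma gegenOdd_sub_one (m N j : ℕ) (hj : j < N) (lam : ℂ) :
    2 * N * gegenOdd (m + 1) (N - 1) j (lam - 1)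
      = 2 * (j + 1) * gegenOdd (m + 1) N (j + 1) lam := by
  obtain ⟨q, rfl⟩ : ∃ q, N = j + q + 1 := ⟨N - j - 1, by omega⟩
  have e1 : j + q + 1 - (j + 1) = q := by omega
  have e2 : 2 * (j + q) - 2 * j + 1 = 2 * q + 1 := by omega
  have e3 : 2 * (j + q + 1) - 2 * (j + 1) + 1 = 2 * q + 1 := by omega
  have p : ∏ k ∈ Finset.Ico j (j + q),
        (2 * (lam - 1) - 4 * ((j + q : ℕ) : ℂ) + 2 * (k : ℂ) + (m + 1 : ℕ) - 1)
      = ∏ k ∈ Finset.Ico (j + 1) (j + q + 1),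
        (2 * lam - 4 * ((j + q + 1 : ℕ) : ℂ) + 2 * (k : ℂ) + (m + 1 : ℕ) - 1) := by
    rw [Finset.prod_Ico_eq_prod_range, Finset.prod_Ico_eq_prod_range, e1, Nat.add_sub_cancel_left]
    exact Finset.prod_congr rfl fun k _ => by push_cast; ring
  rw [Nat.add_sub_cancel, gegenOdd, gegenOdd, p, e1, e2, e3, Nat.add_sub_cancel_left,
    Nat.factorial_succ (j + q), Nat.factorial_succ j]
  have h2 : ((2 * q + 1).factorial : ℂ) ≠ 0 := by exact_mod_cast Nat.factorial_ne_zero _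
  have h3 : (j.factorial : ℂ) ≠ 0 := by exact_mod_cast Nat.factorial_ne_zero _
  have h4 : (j + 1 : ℂ) ≠ 0 := by exact_mod_cast Nat.succ_ne_zero j
  push_cast
  field_simp

/-- The Gegenbauer coefficients with alternating signs. -/
def gegenSigned (m N j : ℕ) (lam : ℂ) : ℂ := (-1) ^ (N - j) * gegenOdd (m + 1) N j lam

/-- The recursion required by `sum_gegenBlock_confOp` for μ = -λ - p. The linear factor is the
lowest factor of the product in b_j, and C(2(N-j)+1, 2) is half the quotient of consecutive odd
factorials. -/
lemma gegenSigned_succ (m N j : ℕ) (hj : j < N) (lam : ℂ) :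
    gegenSigned m N (j + 1) lam * ((j + 1) * (m + 2 * lam - 4 * N + 2 * j))
      = gegenSigned m N j lam * ((2 * (N - j : ℕ) + 1).choose 2 : ℕ) := by
  obtain ⟨q, rfl⟩ : ∃ q, N = j + q + 1 := ⟨N - j - 1, by omega⟩
  have e1 : j + q + 1 - (j + 1) = q := by omega
  have e1' : j + q + 1 - j = q + 1 := by omega
  have e2 : 2 * (j + q + 1) - 2 * j + 1 = 2 * q + 1 + 1 + 1 := by omega
  have e3 : 2 * (j + q + 1) - 2 * (j + 1) + 1 = 2 * q + 1 := by omega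
  have p : ∏ k ∈ Finset.Ico j (j + q + 1),
        (2 * lam - 4 * ((j + q + 1 : ℕ) : ℂ) + 2 * (k : ℂ) + (m + 1 : ℕ) - 1)
      = (2 * lam - 4 * ((j + q + 1 : ℕ) : ℂ) + 2 * (j : ℂ) + (m + 1 : ℕ) - 1)
        * ∏ k ∈ Finset.Ico (j + 1) (j + q + 1),
        (2 * lam - 4 * ((j + q + 1 : ℕ) : ℂ) + 2 * (k : ℂ) + (m + 1 : ℕ) - 1) :=
    Finset.prod_eq_prod_Ico_succ_bot (by omega) _
  rw [gegenSigned, gegenSigned, gegenOdd, gegenOdd, p, e1, e1', e2, e3, Nat.cast_choose_two,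
    Nat.factorial_succ (2 * q + 1 + 1), Nat.factorial_succ (2 * q + 1), Nat.factorial_succ j,
    pow_succ (-1 : ℂ), pow_succ (-2 : ℂ)]
  have h2 : ((2 * q + 1).factorial : ℂ) ≠ 0 := by exact_mod_cast Nat.factorial_ne_zero _
  have h3 : (j.factorial : ℂ) ≠ 0 := by exact_mod_cast Nat.factorial_ne_zero _
  have h4 : (j + 1 : ℂ) ≠ 0 := by exact_mod_cast Nat.succ_ne_zero j
  have h5 : (2 * q + 1 + 1 : ℂ) ≠ 0 := by exact_mod_cast Nat.succ_ne_zero (2 * q + 1)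
  have h6 : (2 * q + 1 + 1 + 1 : ℂ) ≠ 0 := by exact_mod_cast Nat.succ_ne_zero (2 * q + 1 + 1)
  generalize ∏ k ∈ Finset.Ico (j + 1) (j + q + 1),
        (2 * lam - 4 * ((j + q + 1 : ℕ) : ℂ) + 2 * (k : ℂ) + (m + 1 : ℕ) - 1) = P
  push_cast
  field_simp
  ring

/-! ## The Gegenbauer form -/

section Binomial

variable {V : Type*} [AddCommGroup V] [Module ℂ V]

/-- The binomial expansion of a double sequence governed by `y (i + 1) r = T (y i r) - y i (r + 1)`. -/
lemma pow_apply_eq_sum_choose (T : Module.End ℂ V) (y : ℕ → ℕ → V)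
    (hy : ∀ i r, y (i + 1) r = T (y i r) - y i (r + 1)) (N i s : ℕ) (hi : i ≤ N) :
    (T ^ (N - i)) (y i s)
      = ∑ r ∈ Finset.range (N + 1), ((-1) ^ r * (i.choose r : ℂ)) • (T ^ (N - r)) (y 0 (s + r)) := by
  induction i generalizing N s with
  | zero =>
    rw [Finset.sum_range_succ', Finset.sum_eq_zero]
    · simp
    · intro r _
      simp
  | succ i ih =>
    obtain ⟨M, rfl⟩ : ∃ M, N = M + 1 := ⟨N - 1, by omega⟩
    have hiM : i ≤ M := by omega
    have h1 := ih (M + 1) s (by omega)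
    have h2 := ih M (s + 1) hiM
    have e : (T ^ (M + 1 - (i + 1))) (T (y i s)) = (T ^ (M + 1 - i)) (y i s) := by
      rw [← Module.End.mul_apply, ← pow_succ]
      congr 2
      omega
    rw [hy, map_sub, e, h1, Nat.add_sub_add_right, h2, Finset.sum_range_succ',
      Finset.sum_range_succ' _ (M + 1), add_sub_right_comm, ← Finset.sum_sub_distrib]
    congr 1
    · refine Finset.sum_congr rfl fun r _ => ?_
      have e2 : s + 1 + r = s + (r + 1) := by ring
      rw [Nat.choose_succ_succ', Nat.add_sub_add_right, e2, Nat.cast_add, pow_succ]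
      module
    · simp

/-- Used with T = Δ and y(i, r) a restriction of ∂_n^(2r) or ∂_n^(2r+1) applied to Δ̄^i ω. It trades
a sum over powers of Δ̄ for one over normal derivatives, with binomially transformed coefficients.
-/
lemma sum_pow_apply_eq (T : Module.End ℂ V) (y : ℕ → ℕ → V)
    (hy : ∀ i r, y (i + 1) r = T (y i r) - y i (r + 1)) (N : ℕ) (e : ℕ → ℂ) :
    ∑ i ∈ Finset.range (N + 1), e i • (T ^ (N - i)) (y i 0)
      = ∑ r ∈ Finset.range (N + 1),
          ((-1) ^ r * ∑ i ∈ Finset.range (N + 1), e i * (i.choose r : ℂ))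
            • (T ^ (N - r)) (y 0 r) := by
  have h : ∀ i ∈ Finset.range (N + 1), e i • (T ^ (N - i)) (y i 0)
      = ∑ r ∈ Finset.range (N + 1), ((-1) ^ r * (e i * (i.choose r : ℂ)))
        • (T ^ (N - r)) (y 0 r) := by
    intro i hi
    rw [pow_apply_eq_sum_choose T y hy N i 0 (Nat.lt_succ_iff.1 (Finset.mem_range.1 hi)),
      Finset.smul_sum]
    refine Finset.sum_congr rfl fun r _ => ?_
    rw [smul_smul, zero_add]
    congr 1
    ring
  rw [Finset.sum_congr rfl h, Finset.sum_comm]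
  refine Finset.sum_congr rfl fun r _ => ?_
  rw [Finset.mul_sum, Finset.sum_smul]

end Binomial

/-! ### Binomial transforms of the coefficients β -/

section BetaSums

variable (n N r : ℕ) (lam : ℂ)

lemma betaCoeff_succ_self : betaCoeff n N (N + 1) lam = 0 := by
  simp [betaCoeff]

lemma choose_mul_succ_cast (i r : ℕ) :
    (i.choose r : ℂ) * (i + 1) = ((i + 1).choose r : ℂ) * ((i + 1 : ℕ) - r) := by
  have h := Nat.choose_mul_succ_eq i r
  rcases Nat.lt_or_ge (i + 1) r with hlt | hge
  · rw [Nat.choose_eq_zero_of_lt hlt, Nat.choose_eq_zero_of_lt (by omega)]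
    simp
  · rw [← Nat.cast_sub hge]
    exact_mod_cast h

/-- Shift the index and use (i+1) C(i,r) = (i+1-r) C(i+1,r). The boundary terms vanish because
β_(N+1) = 0 and r C(0,r) = 0. -/
lemma sum_succ_betaCoeff : ∑ i ∈ Finset.range (N + 1),
      ((i + 1 : ℂ) * betaCoeff n N (i + 1) lam) * (i.choose r : ℂ)
    = ∑ i ∈ Finset.range (N + 1), ((i : ℂ) - r) * betaCoeff n N i lam * (i.choose r : ℂ) := by
  have h : ∀ i : ℕ, ((i + 1 : ℂ) * betaCoeff n N (i + 1) lam) * (i.choose r : ℂ)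
      = (((i + 1 : ℕ) : ℂ) - r) * betaCoeff n N (i + 1) lam * ((i + 1).choose r : ℂ) := by
    intro i
    linear_combination betaCoeff n N (i + 1) lam * choose_mul_succ_cast i r
  simp only [h]
  rw [Finset.sum_range_succ, betaCoeff_succ_self, Finset.sum_range_succ' _ N]
  rcases r with _ | r <;> simp

/-- After the index shift the weight becomes (2i+1) - 2(i-r) = 2r + 1, which is independent of i. -/
lemma sum_betaCoeff_even (hr : r ≤ N) : ∑ i ∈ Finset.range (N + 1),
      ((2 * i + 1) * betaCoeff n N i lam - 2 * (i + 1) * betaCoeff n N (i + 1) lam)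
        * (i.choose r : ℂ)
    = (2 * r + 1) * gegenOdd n N (N - r) lam := by
  have h := sum_succ_betaCoeff n N r lam
  rw [← sum_betaCoeff_mul_choose n N r hr lam, Finset.mul_sum]
  have e : ∀ i : ℕ, ((2 * i + 1) * betaCoeff n N i lam - 2 * (i + 1) * betaCoeff n N (i + 1) lam)
        * (i.choose r : ℂ) = (2 * i + 1) * betaCoeff n N i lam * (i.choose r : ℂ)
        - 2 * (((i + 1 : ℂ) * betaCoeff n N (i + 1) lam) * (i.choose r : ℂ)) := fun i => by ring
  simp only [e, Finset.sum_sub_distrib]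
  rw [← Finset.mul_sum, h, Finset.mul_sum, ← Finset.sum_sub_distrib]
  exact Finset.sum_congr rfl fun i _ => by ring

lemma sum_betaCoeff_exact (hr : r ≤ N) : ∑ i ∈ Finset.range (N + 1),
      (2 * (i + 1) * betaCoeff n N (i + 1) lam + 2 * (N - i) * betaCoeff n N i lam)
        * (i.choose r : ℂ)
    = 2 * (N - r) * gegenOdd n N (N - r) lam := by
  have h := sum_succ_betaCoeff n N r lam
  rw [← sum_betaCoeff_mul_choose n N r hr lam, Finset.mul_sum]
  have e : ∀ i : ℕ, (2 * (i + 1) * betaCoeff n N (i + 1) lam + 2 * (N - i) * betaCoeff n N i lam)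
        * (i.choose r : ℂ) = 2 * (((i + 1 : ℂ) * betaCoeff n N (i + 1) lam) * (i.choose r : ℂ))
        + 2 * (N - i) * betaCoeff n N i lam * (i.choose r : ℂ) := fun i => by ring
  simp only [e, Finset.sum_add_distrib]
  rw [← Finset.mul_sum, h, Finset.mul_sum, ← Finset.sum_add_distrib]
  exact Finset.sum_congr rfl fun i _ => by ring

end BetaSums

/-! ### Collapsing words in dδ and δd to powers of the Laplacian -/

section Words

variable {d : ℕ}

/-- The operator `d δ` on forms of all degrees. -/
def ddelOp : Module.End ℂ (Forms d) := dOp * delOp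

/-- The operator `δ d` on forms of all degrees. -/
def deldOp : Module.End ℂ (Forms d) := delOp * dOp

lemma ddelOp_apply (v : Forms d) : ddelOp v = dOp (delOp v) := rfl

lemma deldOp_apply (v : Forms d) : deldOp v = delOp (dOp v) := rfl


lemma lapOp_dOp_apply (v : Forms d) : lapOp (dOp v) = dOp (lapOp v) :=
  LinearMap.congr_fun lapOp_mul_dOp v

lemma lapOp_delOp_apply (v : Forms d) : lapOp (delOp v) = delOp (lapOp v) :=
  LinearMap.congr_fun lapOp_mul_delOp v

/-- On exact forms δd does the same as nothing after d, so dδ and Δ agree there. The other lemmas of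
this section are variants for δd and for co-exact forms. -/
lemma pow_dOp_delOp_dOp (k : ℕ) (v : Forms d) :
    (ddelOp ^ k) (dOp v) = (lapOp ^ k) (dOp v) := by
  induction k with
  | zero => rfl
  | succ k ih =>
    rw [pow_succ', Module.End.mul_apply, ih, ← lapOp_lapPow_apply, lapPow_dOp_apply]
    simp [ddelOp, lapOp, dOp_dOp_apply]

lemma dOp_pow_delOp_dOp (k : ℕ) (v : Forms d) :
    dOp ((deldOp ^ k) v) = (lapOp ^ k) (dOp v) := by
  induction k with
  | zero => rfl
  | succ k ih =>
    have h : lapOp (dOp ((deldOp ^ k) v)) = dOp (delOp (dOp ((deldOp ^ k) v))) := by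
      simp [lapOp, dOp_dOp_apply]
    rw [← lapOp_lapPow_apply, ← ih, h, pow_succ', Module.End.mul_apply, deldOp_apply]

lemma pow_delOp_dOp_succ (k : ℕ) (v : Forms d) :
    (deldOp ^ (k + 1)) v = delOp (dOp ((lapOp ^ k) v)) := by
  rw [pow_succ', Module.End.mul_apply, deldOp_apply, dOp_pow_delOp_dOp, lapPow_dOp_apply]

lemma delOp_pow_dOp_delOp (k : ℕ) (v : Forms d) :
    delOp ((ddelOp ^ k) v) = (lapOp ^ k) (delOp v) := by
  induction k with
  | zero => rfl
  | succ k ih =>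
    have h : lapOp (delOp ((ddelOp ^ k) v)) = delOp (dOp (delOp ((ddelOp ^ k) v))) := by
      simp [lapOp, delOp_delOp_apply]
    rw [← lapOp_lapPow_apply, ← ih, h, pow_succ', Module.End.mul_apply, ddelOp_apply]

lemma pow_dOp_delOp_succ (k : ℕ) (v : Forms d) :
    (ddelOp ^ (k + 1)) v = dOp (delOp ((lapOp ^ k) v)) := by
  rw [pow_succ', Module.End.mul_apply, ddelOp_apply, delOp_pow_dOp_delOp, lapPow_delOp_apply]

end Words

/-! ### From the geometric words to Laplacians and normal derivatives -/

section Gegenbauer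

variable {m : ℕ}

/-- The Laplacian is minus the sum of second derivatives, so restriction loses exactly the summand
-∂_n². -/
lemma resDir_lapOp (k : ℕ) (w : Forms (m + 1)) :
    resDir k (lapOp w) = lapOp (resDir k w) - resDir (k + 2) w := by
  have h := LinearMap.congr_fun (pow_mul_comm_of_comm (dir_mul_lapOp (Fin.last m)) k) w
  simp only [Module.End.mul_apply] at h
  rw [resDir_apply, h, resDir_apply, resDir_apply]
  simp only [lapOp_eq, LinearMap.neg_apply, LinearMap.sum_apply, Module.End.mul_apply, map_neg,
    map_sum]
  rw [Fin.sum_univ_castSucc, pow_succ', pow_succ', Module.End.mul_apply, Module.End.mul_apply]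
  simp only [resOp_dir]
  abel

lemma resIns_lapOp (k : ℕ) (w : Forms (m + 1)) :
    resIns k (lapOp w) = lapOp (resIns k w) - resIns (k + 2) w := by
  have h := fun (j : ℕ) (v : Forms (m + 1)) =>
    LinearMap.congr_fun (pow_mul_comm_of_comm (dir_mul_ins (Fin.last m) (Fin.last m)) j) v
  simp only [Module.End.mul_apply] at h
  have h2 := LinearMap.congr_fun (lapOp_mul_ins (Fin.last m)) w
  simp only [Module.End.mul_apply] at h2
  have e : ∀ (j : ℕ) (v : Forms (m + 1)), resIns j v = resDir j (ins (Fin.last m) v) := by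
    intro j v
    rw [resIns_apply, resDir_apply, h]
  rw [e, e, e, ← h2, resDir_lapOp]

lemma resIns_zero_dOp (w : Forms (m + 1)) :
    resIns 0 (dOp w) = resDir 1 w - dOp (resIns 0 w) := by
  have h := LinearMap.congr_fun (ins_mul_dOp (Fin.last m)) w
  simp only [Module.End.mul_apply, LinearMap.sub_apply] at h
  rw [resIns_apply, resDir_apply, resIns_apply, pow_zero, pow_one, Module.End.one_apply,
    Module.End.one_apply, h, map_sub, resOp_dOp]

/-- The normal correction in `resOp_delOp` contains a second insertion of ∂_n and hence vanishes. -/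
lemma resIns_delOp (k : ℕ) (w : Forms (m + 1)) :
    resIns k (delOp w) = - delOp (resIns k w) := by
  have h := LinearMap.congr_fun (pow_mul_comm_of_comm (dir_mul_delOp (Fin.last m)) k) w
  have h2 := fun v => LinearMap.congr_fun (ins_mul_delOp (Fin.last m)) v
  have h3 := fun v => LinearMap.congr_fun (dir_mul_ins (Fin.last m) (Fin.last m)) v
  have h4 := fun v => LinearMap.congr_fun (ins_mul_ins_self (Fin.last m)) v
  simp only [Module.End.mul_apply, LinearMap.neg_apply, LinearMap.zero_apply] at h h2 h3 h4
  rw [resIns_apply, h, h2, map_neg, resOp_delOp, h3, h4, map_zero, sub_zero, resIns_apply]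

/-- The operator of odd order on forms of all degrees, with the parameter `p` of its
coefficients. -/
def oddForms (m N p : ℕ) (lam : ℂ) (w : Forms (m + 1)) : Forms m :=
  (∑ i ∈ Finset.Icc 1 N, gammaCoeff (m + 1) N p i lam •
      (ddelOp ^ (N - i)) (dOp (resIns 0 ((deldOp ^ i) w))))
  + (lam + p) • (∑ i ∈ Finset.range (N + 1), betaCoeff (m + 1) N i lam •
      (ddelOp ^ (N - i)) (dOp (resIns 0 ((ddelOp ^ i) w))))
  + (lam + p - 2 * N - 1) • (∑ i ∈ Finset.range (N + 1), betaCoeff (m + 1) N i lam •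
      (deldOp ^ (N - i)) (resIns 0 (dOp ((deldOp ^ i) w))))

section Expansion

variable (w : Forms (m + 1))

/-- Write the power as δ̄ d̄ Δ̄^i. Moving the insertion past δ̄ costs a sign, Cartan's formula
replaces i_n d̄ by ∂_n - d̄ i_n, and dδd = Δd. -/
lemma dOp_resIns_deldOp_pow_succ (i : ℕ) :
    dOp (resIns 0 ((deldOp ^ (i + 1)) w))
      = lapOp (dOp (resIns 0 ((lapOp ^ i) w))) - dOp (delOp (resDir 1 ((lapOp ^ i) w))) := by
  rw [pow_delOp_dOp_succ, resIns_delOp, resIns_zero_dOp]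
  simp only [lapOp, LinearMap.add_apply, Module.End.mul_apply, map_neg, map_sub, dOp_dOp_apply,
    map_zero, zero_add]
  abel

lemma dOp_resIns_ddelOp_pow_succ (i : ℕ) :
    dOp (resIns 0 ((ddelOp ^ (i + 1)) w))
      = dOp (resIns 0 ((lapOp ^ (i + 1)) w)) - lapOp (dOp (resIns 0 ((lapOp ^ i) w)))
        + dOp (delOp (resDir 1 ((lapOp ^ i) w))) := by
  have h := dOp_resIns_deldOp_pow_succ w i
  have e : (ddelOp ^ (i + 1)) w = (lapOp ^ (i + 1)) w - (deldOp ^ (i + 1)) w := by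
    rw [pow_delOp_dOp_succ, pow_dOp_delOp_succ, ← lapOp_lapPow_apply]
    simp [lapOp]
  rw [e, map_sub, map_sub, h]
  abel

lemma resIns_dOp_deldOp_pow (i : ℕ) :
    resIns 0 (dOp ((deldOp ^ i) w))
      = resDir 1 ((lapOp ^ i) w) - dOp (resIns 0 ((lapOp ^ i) w)) := by
  rw [dOp_pow_delOp_dOp, lapPow_dOp_apply, resIns_zero_dOp]

lemma ddelOp_pow_dOp_resIns_deldOp (k i : ℕ) :
    (ddelOp ^ k) (dOp (resIns 0 ((deldOp ^ (i + 1)) w)))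
      = (lapOp ^ (k + 1)) (dOp (resIns 0 ((lapOp ^ i) w)))
        - (lapOp ^ k) (dOp (delOp (resDir 1 ((lapOp ^ i) w)))) := by
  rw [pow_dOp_delOp_dOp, dOp_resIns_deldOp_pow_succ, map_sub, pow_succ, Module.End.mul_apply]

lemma ddelOp_pow_dOp_resIns_ddelOp (k i : ℕ) :
    (ddelOp ^ k) (dOp (resIns 0 ((ddelOp ^ (i + 1)) w)))
      = (lapOp ^ k) (dOp (resIns 0 ((lapOp ^ (i + 1)) w)))
        - (lapOp ^ (k + 1)) (dOp (resIns 0 ((lapOp ^ i) w)))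
        + (lapOp ^ k) (dOp (delOp (resDir 1 ((lapOp ^ i) w)))) := by
  rw [pow_dOp_delOp_dOp, dOp_resIns_ddelOp_pow_succ, map_add, map_sub, pow_succ lapOp k,
    Module.End.mul_apply]

/-- With a positive power in front, δd annihilates the exact part of `resIns_dOp_deldOp_pow` and
acts as Δ - dδ on the rest. For the zeroth power the exact part survives, so the summand i = N is
treated apart. -/
lemma deldOp_pow_resIns_dOp (k i : ℕ) :
    (deldOp ^ (k + 1)) (resIns 0 (dOp ((deldOp ^ i) w)))
      = (lapOp ^ (k + 1)) (resDir 1 ((lapOp ^ i) w))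
        - (lapOp ^ k) (dOp (delOp (resDir 1 ((lapOp ^ i) w)))) := by
  rw [resIns_dOp_deldOp_pow, pow_delOp_dOp_succ, pow_succ, Module.End.mul_apply, ← map_sub,
    ← lapPow_dOp_apply, ← lapPow_delOp_apply]
  congr 1
  simp [lapOp, dOp_dOp_apply]

/-- The operator of odd order in terms of powers of the Laplacians. -/
lemma oddForms_eq_sum (N p : ℕ) (lam : ℂ) :
    oddForms m N p lam w
      = (lam + p - 2 * N - 1) • (∑ i ∈ Finset.range (N + 1), betaCoeff (m + 1) N i lam •
          (lapOp ^ (N - i)) (resDir 1 ((lapOp ^ i) w)))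
        + (∑ i ∈ Finset.range (N + 1),
          ((2 * i + 1) * betaCoeff (m + 1) N i lam
            - 2 * (i + 1) * betaCoeff (m + 1) N (i + 1) lam) •
          (lapOp ^ (N - i)) (dOp (resIns 0 ((lapOp ^ i) w))))
        + ∑ i ∈ Finset.range N,
          (2 * (i + 1) * betaCoeff (m + 1) N (i + 1) lam
            + 2 * (N - i) * betaCoeff (m + 1) N i lam) •
          (lapOp ^ (N - 1 - i)) (dOp (delOp (resDir 1 ((lapOp ^ i) w)))) := by
  set β := fun i => betaCoeff (m + 1) N i lam with hβ
  have hβN : β (N + 1) = 0 := betaCoeff_succ_self _ _ _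
  have h1 : ∑ i ∈ Finset.Icc 1 N, gammaCoeff (m + 1) N p i lam •
        (ddelOp ^ (N - i)) (dOp (resIns 0 ((deldOp ^ i) w)))
      = ∑ i ∈ Finset.range N, ((lam + p - 2 * (i + 1)) * β (i + 1)
          - (lam + p - 2 * (i + 1) + 1) * β i) •
        ((lapOp ^ (N - i)) (dOp (resIns 0 ((lapOp ^ i) w)))
          - (lapOp ^ (N - 1 - i)) (dOp (delOp (resDir 1 ((lapOp ^ i) w))))) := by
    rw [← Finset.Ico_add_one_right_eq_Icc, Finset.sum_Ico_eq_sum_range]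
    refine Finset.sum_congr (by simp) fun i hi => ?_
    have hi' : i < N := by simpa using hi
    have e1 : N - i = N - (1 + i) + 1 := by omega
    have e2 : N - 1 - i = N - (1 + i) := by omega
    rw [add_comm 1 i] at *
    rw [ddelOp_pow_dOp_resIns_deldOp, e1, e2, gammaCoeff, Nat.add_sub_cancel]
    push_cast
    rfl
  have h2 : ∑ i ∈ Finset.range (N + 1), betaCoeff (m + 1) N i lam •
        (ddelOp ^ (N - i)) (dOp (resIns 0 ((ddelOp ^ i) w)))
      = (∑ i ∈ Finset.range N, (β i - β (i + 1)) •
          (lapOp ^ (N - i)) (dOp (resIns 0 ((lapOp ^ i) w))))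
        + β N • dOp (resIns 0 ((lapOp ^ N) w))
        + ∑ i ∈ Finset.range N, β (i + 1) •
          (lapOp ^ (N - 1 - i)) (dOp (delOp (resDir 1 ((lapOp ^ i) w)))) := by
    have e : (∑ i ∈ Finset.range N, β (i + 1) •
          (lapOp ^ (N - (i + 1))) (dOp (resIns 0 ((lapOp ^ (i + 1)) w))))
          + β 0 • (lapOp ^ N) (dOp (resIns 0 ((lapOp ^ 0) w)))
        = (∑ i ∈ Finset.range N, β i • (lapOp ^ (N - i)) (dOp (resIns 0 ((lapOp ^ i) w))))
          + β N • dOp (resIns 0 ((lapOp ^ N) w)) := by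
      have := Finset.sum_range_succ
        (fun i => β i • (lapOp ^ (N - i)) (dOp (resIns 0 ((lapOp ^ i) w)))) N
      rw [Finset.sum_range_succ'] at this
      simpa using this
    have e0 : (ddelOp ^ N) (dOp (resIns 0 w)) = (lapOp ^ N) (dOp (resIns 0 ((lapOp ^ 0) w))) :=
      pow_dOp_delOp_dOp N _
    rw [Finset.sum_range_succ', Nat.sub_zero, pow_zero, Module.End.one_apply, e0]
    simp only [sub_smul, Finset.sum_sub_distrib]
    rw [sub_add_eq_add_sub, ← e, add_sub_right_comm, add_right_comm, ← Finset.sum_sub_distrib,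
      ← Finset.sum_add_distrib]
    congr 1
    refine Finset.sum_congr rfl fun i hi => ?_
    have hi' : i < N := Finset.mem_range.1 hi
    have e1 : N - i = N - (i + 1) + 1 := by omega
    have e2 : N - 1 - i = N - (i + 1) := by omega
    rw [ddelOp_pow_dOp_resIns_ddelOp, e1, e2, smul_add, smul_sub]
  have h3 : ∑ i ∈ Finset.range (N + 1), betaCoeff (m + 1) N i lam •
        (deldOp ^ (N - i)) (resIns 0 (dOp ((deldOp ^ i) w)))
      = (∑ i ∈ Finset.range (N + 1), β i • (lapOp ^ (N - i)) (resDir 1 ((lapOp ^ i) w)))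
        - β N • dOp (resIns 0 ((lapOp ^ N) w))
        - ∑ i ∈ Finset.range N, β i •
          (lapOp ^ (N - 1 - i)) (dOp (delOp (resDir 1 ((lapOp ^ i) w)))) := by
    rw [Finset.sum_range_succ, Finset.sum_range_succ, Nat.sub_self, pow_zero, Module.End.one_apply,
      pow_zero, Module.End.one_apply, resIns_dOp_deldOp_pow, smul_sub, add_sub_assoc,
      add_sub_right_comm, ← Finset.sum_sub_distrib]
    congr 1
    refine Finset.sum_congr rfl fun i hi => ?_
    have hi' : i < N := Finset.mem_range.1 hi
    have e1 : N - i = N - (i + 1) + 1 := by omega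
    have e2 : N - 1 - i = N - (i + 1) := by omega
    rw [e1, e2, deldOp_pow_resIns_dOp, smul_sub]
  rw [oddForms, h1, h2, h3, Finset.sum_range_succ
    (fun i => ((2 * i + 1) * betaCoeff (m + 1) N i lam
            - 2 * (i + 1) * betaCoeff (m + 1) N (i + 1) lam) •
          (lapOp ^ (N - i)) (dOp (resIns 0 ((lapOp ^ i) w)))), Nat.sub_self, pow_zero,
    Module.End.one_apply]
  -- The exact terms at i = N, left over from the second and third sums; the difference of the
  -- weights λ + p and λ + p - 2N - 1 is 2N + 1.
  have hN : (lam + p) • β N • dOp (resIns 0 ((lapOp ^ N) w))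
      - (lam + p - 2 * N - 1) • β N • dOp (resIns 0 ((lapOp ^ N) w))
      = ((2 * N + 1) * β N - 2 * (N + 1) * β (N + 1)) • dOp (resIns 0 ((lapOp ^ N) w)) := by
    rw [hβN]
    module
  -- For i < N the parameter λ + p drops out of the coefficients of the exact terms, leaving the
  -- combinations evaluated in `sum_betaCoeff_even` and `sum_betaCoeff_exact`.
  have hsum : (∑ i ∈ Finset.range N, ((lam + p - 2 * (i + 1)) * β (i + 1)
          - (lam + p - 2 * (i + 1) + 1) * β i) •
        ((lapOp ^ (N - i)) (dOp (resIns 0 ((lapOp ^ i) w)))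
          - (lapOp ^ (N - 1 - i)) (dOp (delOp (resDir 1 ((lapOp ^ i) w))))))
      + (lam + p) • (∑ i ∈ Finset.range N, (β i - β (i + 1)) •
          (lapOp ^ (N - i)) (dOp (resIns 0 ((lapOp ^ i) w))))
      + (lam + p) • (∑ i ∈ Finset.range N, β (i + 1) •
          (lapOp ^ (N - 1 - i)) (dOp (delOp (resDir 1 ((lapOp ^ i) w)))))
      - (lam + p - 2 * N - 1) • (∑ i ∈ Finset.range N, β i •
          (lapOp ^ (N - 1 - i)) (dOp (delOp (resDir 1 ((lapOp ^ i) w)))))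
      = (∑ i ∈ Finset.range N, ((2 * i + 1) * β i - 2 * (i + 1) * β (i + 1)) •
          (lapOp ^ (N - i)) (dOp (resIns 0 ((lapOp ^ i) w))))
        + ∑ i ∈ Finset.range N, (2 * (i + 1) * β (i + 1) + 2 * (N - i) * β i) •
          (lapOp ^ (N - 1 - i)) (dOp (delOp (resDir 1 ((lapOp ^ i) w)))) := by
    simp only [Finset.smul_sum, ← Finset.sum_add_distrib, ← Finset.sum_sub_distrib]
    exact Finset.sum_congr rfl fun i _ => by module
  linear_combination (norm := module) hsum + hN

/-- The operator of odd order as a combination of the conformally covariant blocks. -/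
lemma oddForms_eq_sum_gegenBlock (N p : ℕ) (lam : ℂ) :
    oddForms m N p lam w = ∑ j ∈ Finset.range (N + 1),
      gegenSigned m N j lam • gegenBlock (lam + p - 2 * N - 1) j (2 * (N - j) + 1) w := by
  have hU := sum_pow_apply_eq lapOp (fun i r => resDir (2 * r + 1) ((lapOp ^ i) w))
    (fun i r => by rw [← lapOp_lapPow_apply, resDir_lapOp]; rfl) N
    (fun i => betaCoeff (m + 1) N i lam)
  have hV := sum_pow_apply_eq lapOp (fun i r => dOp (resIns (2 * r) ((lapOp ^ i) w)))
    (fun i r => by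
      rw [← lapOp_lapPow_apply, resIns_lapOp, map_sub, ← lapOp_dOp_apply]
      rfl) N
    (fun i => (2 * i + 1) * betaCoeff (m + 1) N i lam
      - 2 * (i + 1) * betaCoeff (m + 1) N (i + 1) lam)
  -- The sum has one term fewer and one power of Δ fewer. It is extended to r = N, where the
  -- coefficient 2(N-r) is zero and the truncated exponent is harmless.
  have hX : ∑ i ∈ Finset.range N, (2 * (i + 1) * betaCoeff (m + 1) N (i + 1) lam
        + 2 * (N - i) * betaCoeff (m + 1) N i lam) •
        (lapOp ^ (N - 1 - i)) (dOp (delOp (resDir 1 ((lapOp ^ i) w))))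
      = ∑ r ∈ Finset.range (N + 1), ((-1) ^ r * (2 * (N - r)
        * gegenOdd (m + 1) N (N - r) lam)) • (lapOp ^ (N - 1 - r))
          (dOp (delOp (resDir (2 * r + 1) w))) := by
    rcases N with _ | M
    · simp
    have h := sum_pow_apply_eq lapOp
      (fun i r => dOp (delOp (resDir (2 * r + 1) ((lapOp ^ i) w))))
      (fun i r => by
        rw [← lapOp_lapPow_apply, resDir_lapOp, map_sub, map_sub,
          ← lapOp_delOp_apply, ← lapOp_dOp_apply]
        rfl) M
      (fun i => 2 * (i + 1) * betaCoeff (m + 1) (M + 1) (i + 1) lam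
        + 2 * ((M + 1 : ℕ) - i) * betaCoeff (m + 1) (M + 1) i lam)
    rw [Finset.sum_range_succ _ (M + 1), sub_self, mul_zero, zero_mul, mul_zero, zero_smul,
      add_zero, Nat.add_sub_cancel]
    refine h.trans (Finset.sum_congr rfl fun r hr => ?_)
    have hr' : r ≤ M + 1 := (Finset.mem_range.1 hr).le
    rw [← sum_betaCoeff_exact (m + 1) (M + 1) r lam hr', Finset.sum_range_succ _ (M + 1),
      betaCoeff_succ_self]
    simp
  simp only [pow_zero, Module.End.one_apply, mul_zero, zero_add] at hU hV
  -- The reflection r = N - j passes from counting pairs of normal derivatives to counting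
  -- Laplacians.
  rw [oddForms_eq_sum, hX, hU, hV, Finset.smul_sum, ← Finset.sum_add_distrib,
    ← Finset.sum_add_distrib, ← Finset.sum_range_reflect]
  refine Finset.sum_congr rfl fun j hj => ?_
  have hj' : j ≤ N := Nat.lt_succ_iff.1 (Finset.mem_range.1 hj)
  have e1 : N + 1 - 1 - j = N - j := by omega
  have e2 : N - (N - j) = j := by omega
  have e3 : N - 1 - (N - j) = j - 1 := by omega
  have e4 : (N : ℂ) - (N - j : ℕ) = j := by rw [Nat.cast_sub hj']; ring
  rw [e1, sum_betaCoeff_mul_choose _ _ _ (Nat.sub_le _ _),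
    sum_betaCoeff_even _ _ _ _ (Nat.sub_le _ _), e2, e3, e4, gegenBlock, gegenSigned,
    Nat.add_sub_cancel]
  push_cast
  module

end Expansion

end Gegenbauer

/-! ## Forms of a fixed degree -/

section Bridge

variable {d m : ℕ}

/-- A smooth form as a family concentrated in its degree. -/
def ofForm {p : ℕ} (w : Form d p) (hw : ContDiff ℝ ∞ w) : Forms d :=
  Pi.single (M := fun q => smoothForm d q) p ⟨w, hw⟩

lemma ofForm_val {p : ℕ} (w : Form d p) (hw : ContDiff ℝ ∞ w) : (ofForm w hw).val p = w := by
  have h : (ofForm w hw) p = (⟨w, hw⟩ : smoothForm d p) := Pi.single_eq_same _ _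
  rw [Forms.val, h]

lemma ofForm_val_of_ne {p q : ℕ} (w : Form d p) (hw : ContDiff ℝ ∞ w) (h : q ≠ p) :
    (ofForm w hw).val q = 0 := by
  have h : (ofForm w hw) q = (0 : smoothForm d q) := Pi.single_eq_of_ne h _
  rw [Forms.val, h]
  rfl

lemma degOp_ofForm {p : ℕ} (w : Form d p) (hw : ContDiff ℝ ∞ w) :
    degOp (ofForm w hw) = (p : ℂ) • ofForm w hw := by
  funext q
  change (q : ℂ) • (ofForm w hw) q = (p : ℂ) • (ofForm w hw) q
  rcases eq_or_ne q p with rfl | hne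
  · rfl
  · have h : (ofForm w hw) q = (0 : smoothForm d q) := Pi.single_eq_of_ne hne _
    rw [h]
    exact (smul_zero (A := smoothForm d q) _).trans (smul_zero (A := smoothForm d q) _).symm

lemma ddelOp_val (p : ℕ) (w : Forms d) : (ddelOp w).val p = extDCodiff p (w.val p) := by
  cases p with
  | zero => exact dOp_val_zero _
  | succ p => rw [ddelOp_apply, dOp_val_succ, delOp_val, extDCodiff]

lemma deldOp_val (p : ℕ) (w : Forms d) : (deldOp w).val p = codiffExtD p (w.val p) := by
  rw [deldOp_apply, delOp_val, dOp_val_succ, codiffExtD]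

lemma lapOp_val (p : ℕ) (w : Forms d) : (lapOp w).val p = laplace p (w.val p) := by
  rw [laplace, ← deldOp_val, ← ddelOp_val]
  rfl

lemma dir_last_val (p : ℕ) (w : Forms (m + 1)) :
    (dir (Fin.last m) w).val p = normalDeriv p (w.val p) := rfl

lemma pow_val (T : Module.End ℂ (Forms d)) {p : ℕ} {f : Form d p → Form d p}
    (h : ∀ w, (T w).val p = f (w.val p)) (k : ℕ) (w : Forms d) :
    ((T ^ k) w).val p = f^[k] (w.val p) := by
  induction k with
  | zero => rfl
  | succ k ih => rw [pow_succ', Module.End.mul_apply, h, ih, Function.iterate_succ_apply']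

lemma dOp_resIns_val (p : ℕ) (w : Forms (m + 1)) :
    (dOp (resIns 0 w)).val p = extDRestrictInsert p (w.val p) := by
  cases p with
  | zero => exact dOp_val_zero _
  | succ p => rw [dOp_val_succ]; rfl

lemma resIns_dOp_val (p : ℕ) (w : Forms (m + 1)) :
    (resIns 0 (dOp w)).val p = restrictInsertExtD p (w.val p) := by
  rw [restrictInsertExtD, ← dOp_val_succ]
  rfl

lemma oddForms_val (N p : ℕ) (lam : ℂ) (w : Forms (m + 1)) :
    (oddForms m N p lam w).val p = oddOp m N p lam (w.val p) := by
  simp only [oddForms, oddOp, Forms.val_add, Forms.val_smul, Forms.val_sum,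
    pow_val _ (ddelOp_val p), pow_val _ (deldOp_val p), dOp_resIns_val, resIns_dOp_val]

lemma oddOpGegenbauer_eq (N p : ℕ) (lam : ℂ) (w : Forms (m + 1)) :
    (∑ j ∈ Finset.range (N + 1),
      gegenSigned m N j lam • gegenBlock (lam + p - 2 * N - 1) j (2 * (N - j) + 1) w).val p
      = oddOpGegenbauer m N p lam (w.val p) := by
  have hres : ∀ k, (resIns k w) = resIns 0 ((dir (Fin.last m) ^ k) w) := fun k => rfl
  rw [oddOpGegenbauer, Forms.val_sum, ← Finset.sum_add_distrib]
  -- The third sum is shifted by one, so that its coefficient with index j belongs to block j + 1;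
  -- the block j = 0 has no such term because of the factor 2j.
  have hX : ∑ j ∈ Finset.range N,
      ((-1) ^ (N - j - 1) * (2 * N * gegenOdd (m + 1) (N - 1) j (lam - 1))) •
        (laplace p)^[j] (extDCodiff p (restrict ((normalDeriv p)^[2 * N - 1 - 2 * j] (w.val p))))
      = ∑ j ∈ Finset.range (N + 1), (gegenSigned m N j lam * (2 * j)) •
        ((lapOp ^ (j - 1)) (ddelOp (resDir (2 * (N - j) + 1) w))).val p := by
    have hz : ∀ f : Form m p, (0 : ℂ) • f = 0 := fun f => zero_smul ℂ f
    rw [Finset.sum_range_succ', Nat.cast_zero, mul_zero, mul_zero, hz, add_zero]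
    refine Finset.sum_congr rfl fun j hj => ?_
    have hj' : j < N := Finset.mem_range.1 hj
    have e : 2 * N - 1 - 2 * j = 2 * (N - (j + 1)) + 1 := by omega
    rw [pow_val _ (lapOp_val p), ddelOp_val, resDir_apply, resOp_val, pow_val _ (dir_last_val p),
      Nat.add_sub_cancel, e, gegenSigned, gegenOdd_sub_one _ _ _ hj', Nat.sub_sub]
    congr 1
    push_cast
    ring
  rw [hX, ← Finset.sum_add_distrib]
  refine Finset.sum_congr rfl fun j hj => ?_
  have hj' : j ≤ N := Nat.lt_succ_iff.1 (Finset.mem_range.1 hj)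
  have e1 : 2 * N + 1 - 2 * j = 2 * (N - j) + 1 := by omega
  have e2 : 2 * N - 2 * j = 2 * (N - j) := by omega
  rw [gegenBlock, hres, e1, e2, Forms.val_smul, Forms.val_add, Forms.val_add, Forms.val_smul,
    Forms.val_smul, Forms.val_smul, ← ddelOp_apply, pow_val _ (lapOp_val p),
    pow_val _ (lapOp_val p) j (dOp _), dOp_resIns_val, resDir_apply, resOp_val,
    pow_val _ (dir_last_val p), pow_val _ (dir_last_val p), Nat.add_sub_cancel,
    gegenEven_sub_one _ _ _ hj']
  simp only [gegenSigned]
  push_cast [Nat.cast_sub hj']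
  module

/-- The Gegenbauer form of the operator. -/
lemma oddOp_eq_oddOpGegenbauer (N p : ℕ) (lam : ℂ) {w : Form (m + 1) p} (hw : ContDiff ℝ ∞ w) :
    oddOp m N p lam w = oddOpGegenbauer m N p lam w := by
  have h := oddOpGegenbauer_eq N p lam (ofForm w hw)
  rw [← oddForms_eq_sum_gegenBlock, oddForms_val, ofForm_val] at h
  exact h

end Bridge

/-! ## Orders of differential operators -/

section Order

variable {d m : ℕ}

/-- The families of forms whose `k`-jet at `x` vanishes. -/
def vanJet (k : ℕ) (x : Euc d) : Submodule ℂ (Forms d) where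
  carrier := {w | ∀ p, ∀ j ≤ k, iteratedFDeriv ℝ j (w.val p) x = 0}
  add_mem' {w η} hw hη p j hj := by
    rw [Forms.val_add, iteratedFDeriv_add_apply ((contDiff_infty.1 (w.contDiff_val p) j).contDiffAt)
      ((contDiff_infty.1 (η.contDiff_val p) j).contDiffAt), hw p j hj, hη p j hj, add_zero]
  zero_mem' p j _ := by
    rw [Forms.val_zero]
    exact congrFun iteratedFDeriv_fun_zero x
  smul_mem' c w hw p j hj := by
    rw [Forms.val_smul, iteratedFDeriv_const_smul_apply
      ((contDiff_infty.1 (w.contDiff_val p) j).contDiffAt), hw p j hj, smul_zero]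

lemma vanJet_mono {k l : ℕ} (h : l ≤ k) {x : Euc d} {w : Forms d} (hw : w ∈ vanJet k x) :
    w ∈ vanJet l x := fun p j hj => hw p j (hj.trans h)

lemma iteratedFDeriv_clm_comp_eq_zero {E F G : Type*} [NormedAddCommGroup E] [NormedSpace ℝ E]
    [NormedAddCommGroup F] [NormedSpace ℝ F] [NormedAddCommGroup G] [NormedSpace ℝ G]
    (T : F →L[ℝ] G) {f : E → F} (hf : ContDiff ℝ ∞ f) {j : ℕ} {x : E}
    (h : iteratedFDeriv ℝ j f x = 0) : iteratedFDeriv ℝ j (fun y => T (f y)) x = 0 := by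
  have := T.iteratedFDeriv_comp_left (x := x) (contDiff_infty.1 hf j).contDiffAt (i := j) le_rfl
  rw [h] at this
  refine this.trans ?_
  ext
  simp

lemma ins_mem_vanJet {k : ℕ} {x : Euc d} {w : Forms d} (hw : w ∈ vanJet k x) (i : Fin d) :
    ins i w ∈ vanJet k x := fun p j hj =>
  iteratedFDeriv_clm_comp_eq_zero (insertCLM p (stdVec d i)) (w.contDiff_val (p + 1))
    (hw (p + 1) j hj)

lemma wdg_mem_vanJet {k : ℕ} {x : Euc d} {w : Forms d} (hw : w ∈ vanJet k x) (i : Fin d) :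
    wdg i w ∈ vanJet k x := fun p j hj => by
  cases p with
  | zero => exact (vanJet k x).zero_mem 0 j hj
  | succ p =>
    exact iteratedFDeriv_clm_comp_eq_zero (wedgeCLM p (coordCLM d i)) (w.contDiff_val p)
      (hw p j hj)

lemma dir_mem_vanJet {k : ℕ} {x : Euc d} {w : Forms d} (hw : w ∈ vanJet (k + 1) x) (i : Fin d) :
    dir i w ∈ vanJet k x := fun p j hj => by
  have h : iteratedFDeriv ℝ j (fderiv ℝ (w.val p)) x = 0 := by
    rw [← norm_eq_zero, norm_iteratedFDeriv_fderiv, hw p (j + 1) (by omega), norm_zero]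
  exact iteratedFDeriv_clm_comp_eq_zero (ContinuousLinearMap.apply ℝ _ (stdVec d i))
    ((w.contDiff_val p).fderiv_right (m := ∞) (by simp)) h

lemma dOp_mem_vanJet {k : ℕ} {x : Euc d} {w : Forms d} (hw : w ∈ vanJet (k + 1) x) :
    dOp w ∈ vanJet k x := by
  rw [dOp, LinearMap.sum_apply]
  exact Submodule.sum_mem _ fun i _ => wdg_mem_vanJet (dir_mem_vanJet hw i) i

lemma delOp_mem_vanJet {k : ℕ} {x : Euc d} {w : Forms d} (hw : w ∈ vanJet (k + 1) x) :
    delOp w ∈ vanJet k x := by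
  rw [delOp, LinearMap.neg_apply, LinearMap.sum_apply]
  exact Submodule.neg_mem _ (Submodule.sum_mem _ fun i _ => ins_mem_vanJet (dir_mem_vanJet hw i) i)

lemma lapPow_mem_vanJet {k : ℕ} (j : ℕ) {x : Euc d} {w : Forms d}
    (hw : w ∈ vanJet (k + 2 * j) x) : (lapOp ^ j) w ∈ vanJet k x := by
  induction j generalizing k with
  | zero => exact hw
  | succ j ih =>
    have h := ih (k := k + 2) (vanJet_mono (by omega) hw)
    rw [← lapOp_lapPow_apply]
    exact Submodule.add_mem _ (delOp_mem_vanJet (dOp_mem_vanJet h))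
      (dOp_mem_vanJet (delOp_mem_vanJet h))

lemma resOp_mem_vanJet {k : ℕ} {x : Euc m} {w : Forms (m + 1)} (hw : w ∈ vanJet k (incl m x)) :
    resOp w ∈ vanJet k x := fun p j hj => by
  refine iteratedFDeriv_clm_comp_eq_zero (restrictCLM m p)
    ((w.contDiff_val p).comp (incl m).contDiff) ?_
  have := (incl m).iteratedFDeriv_comp_right (contDiff_infty.1 (w.contDiff_val p) j) x (i := j) le_rfl
  rw [hw p j hj] at this
  refine this.trans ?_
  ext
  simp

lemma dirPow_mem_vanJet {k : ℕ} (j : ℕ) {x : Euc d} {w : Forms d} (i : Fin d)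
    (hw : w ∈ vanJet (k + j) x) : (dir i ^ j) w ∈ vanJet k x := by
  induction j generalizing k with
  | zero => exact hw
  | succ j ih =>
    rw [pow_succ', Module.End.mul_apply]
    exact dir_mem_vanJet (ih (k := k + 1) (vanJet_mono (by omega) hw)) i

lemma resDir_mem_vanJet {k : ℕ} (j : ℕ) {x : Euc m} {w : Forms (m + 1)}
    (hw : w ∈ vanJet (k + j) (incl m x)) : resDir j w ∈ vanJet k x :=
  resOp_mem_vanJet (dirPow_mem_vanJet j _ hw)

lemma resIns_mem_vanJet {k : ℕ} (j : ℕ) {x : Euc m} {w : Forms (m + 1)}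
    (hw : w ∈ vanJet (k + j) (incl m x)) : resIns j w ∈ vanJet k x :=
  resOp_mem_vanJet (ins_mem_vanJet (dirPow_mem_vanJet j _ hw) _)

lemma gegenBlock_mem_vanJet (κ : ℂ) (j k : ℕ) {x : Euc m} {w : Forms (m + 1)}
    (hw : w ∈ vanJet (2 * j + (k + 1)) (incl m x)) : gegenBlock κ j (k + 1) w ∈ vanJet 0 x := by
  refine Submodule.add_mem _ (Submodule.add_mem _ (Submodule.smul_mem _ _ ?_)
    (Submodule.smul_mem _ _ ?_)) ?_
  · refine lapPow_mem_vanJet j (resDir_mem_vanJet _ ?_)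
    exact vanJet_mono (by omega) hw
  · refine lapPow_mem_vanJet j (dOp_mem_vanJet (resIns_mem_vanJet _ ?_))
    exact vanJet_mono (by omega) hw
  · rcases j with _ | j
    · simp
    · refine Submodule.smul_mem _ _ (lapPow_mem_vanJet j
        (dOp_mem_vanJet (delOp_mem_vanJet (resDir_mem_vanJet _ ?_))))
      exact vanJet_mono (by omega) hw

lemma gegenBlock_add (κ : ℂ) (j k : ℕ) (w η : Forms (m + 1)) :
    gegenBlock κ j k (w + η) = gegenBlock κ j k w + gegenBlock κ j k η := by
  simp only [gegenBlock, map_add]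
  module

lemma gegenBlock_smul (κ : ℂ) (j k : ℕ) (a : ℂ) (w : Forms (m + 1)) :
    gegenBlock κ j k (a • w) = a • gegenBlock κ j k w := by
  simp only [gegenBlock, map_smul]
  module

/-- The operator of odd order is a linear differential operator. -/
lemma isDiffOpOfOrderLE_oddOp (N p : ℕ) (lam : ℂ) :
    IsDiffOpOfOrderLE (2 * N + 1) (oddOp m N p lam) := by
  have key : ∀ w : Forms (m + 1), oddOp m N p lam (w.val p) = (oddForms m N p lam w).val p :=
    fun w => (oddForms_val N p lam w).symm
  refine ⟨fun w hw => ?_, fun a b w η hw hη => ?_, fun w hw x hx => ?_⟩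
  · rw [← ofForm_val w hw, key]
    exact Forms.contDiff_val _ _
  -- Linearity is read off from the blocks, which are linear term by term.
  · have h : oddForms m N p lam (a • ofForm w hw + b • ofForm η hη)
        = a • oddForms m N p lam (ofForm w hw) + b • oddForms m N p lam (ofForm η hη) := by
      simp only [oddForms_eq_sum_gegenBlock, gegenBlock_add, gegenBlock_smul, smul_add,
        Finset.sum_add_distrib, Finset.smul_sum]
      congr 1 <;> exact Finset.sum_congr rfl fun j _ => smul_comm _ _ _
    have h2 := key (a • ofForm w hw + b • ofForm η hη)
    rw [h, Forms.val_add, Forms.val_add, Forms.val_smul, Forms.val_smul, Forms.val_smul,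
      Forms.val_smul, ← key, ← key, ofForm_val, ofForm_val] at h2
    exact h2
  · have hjet : ofForm w hw ∈ vanJet (2 * N + 1) (incl m x) := by
      intro q j hj
      rcases eq_or_ne q p with rfl | hne
      · rw [ofForm_val]
        exact hx j hj
      · rw [ofForm_val_of_ne w hw hne]
        exact congrFun iteratedFDeriv_fun_zero _
    -- Block j consumes 2j derivatives along the hyperplane and 2(N-j) + 1 further ones, at most 2N
    -- + 1 in every summand.
    have h : oddForms m N p lam (ofForm w hw) ∈ vanJet 0 x := by
      rw [oddForms_eq_sum_gegenBlock]
      refine Submodule.sum_mem _ fun j hj => Submodule.smul_mem _ _ (gegenBlock_mem_vanJet _ _ _ ?_)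
      have hj' : j ≤ N := Nat.lt_succ_iff.1 (Finset.mem_range.1 hj)
      exact vanJet_mono (by omega) hjet
    have h0 := h p 0 le_rfl
    rw [← norm_eq_zero, norm_iteratedFDeriv_zero, norm_eq_zero, ← key, ofForm_val] at h0
    exact h0

end Order

/-! ## The conformal action on the null cone -/

section NullCone

variable {d : ℕ}

/-- The point of the null cone over `x`. -/
def nullPt (x : Euc d) : Amb d := (1, x, -‖x‖ ^ 2 / 2)

/-- The tangent map of the section `nullPt` of the null cone. -/
def nullTan (x : Euc d) : Euc d →L[ℝ] Amb d :=
  (0 : Euc d →L[ℝ] ℝ).prod ((ContinuousLinearMap.id ℝ (Euc d)).prod (-(innerSL ℝ x)))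

lemma nullTan_apply (x v : Euc d) : nullTan x v = (0, v, -⟪x, v⟫_ℝ) := rfl

lemma hasFDerivAt_nullPt (x : Euc d) : HasFDerivAt nullPt (nullTan x) x := by
  have h : HasFDerivAt (fun y : Euc d => -‖y‖ ^ 2 / 2) (-(innerSL ℝ x)) x := by
    have h1 := ((hasStrictFDerivAt_norm_sq x).hasFDerivAt.const_mul (-(1 / 2) : ℝ))
    have e : (fun y : Euc d => -‖y‖ ^ 2 / 2) = fun y => -(1 / 2) * ‖y‖ ^ 2 := by
      ext y
      ring
    rw [e]
    refine h1.congr_fderiv ?_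
    ext1 v
    simp
  exact (hasFDerivAt_const (1 : ℝ) x).prodMk ((hasFDerivAt_id x).prodMk h)

/-- The component along `e_0`. -/
def headCLM (d : ℕ) : Amb d →L[ℝ] ℝ := ContinuousLinearMap.fst ℝ ℝ (Euc d × ℝ)

/-- The component in `ℝ^d`. -/
def midCLM (d : ℕ) : Amb d →L[ℝ] Euc d :=
  (ContinuousLinearMap.fst ℝ (Euc d) ℝ).comp (ContinuousLinearMap.snd ℝ ℝ (Euc d × ℝ))

lemma headCLM_apply (y : Amb d) : headCLM d y = y.1 := rfl

lemma midCLM_apply (y : Amb d) : midCLM d y = y.2.1 := rfl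

/-- The derivative of the conformal map `moebius A`. -/
def moebiusDeriv (A : Amb d →L[ℝ] Amb d) (x : Euc d) : Euc d →L[ℝ] Euc d :=
  (A (nullPt x)).1⁻¹ • (midCLM d ∘L A ∘L nullTan x)
    - ((A (nullPt x)).1 ^ 2)⁻¹ • (headCLM d ∘L A ∘L nullTan x).smulRight (A (nullPt x)).2.1

lemma moebiusDeriv_apply (A : Amb d →L[ℝ] Amb d) (x v : Euc d) :
    moebiusDeriv A x v = (A (nullPt x)).1⁻¹ • (A (nullTan x v)).2.1
      - (((A (nullPt x)).1 ^ 2)⁻¹ * (A (nullTan x v)).1) • (A (nullPt x)).2.1 := by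
  simp [moebiusDeriv, headCLM, midCLM, smul_smul]

lemma hasFDerivAt_moebius (A : Amb d →L[ℝ] Amb d) (x : Euc d) (h : (A (nullPt x)).1 ≠ 0) :
    HasFDerivAt (moebius A) (moebiusDeriv A x) x := by
  have hA : HasFDerivAt (fun y => A (nullPt y)) (A ∘L nullTan x) x :=
    A.hasFDerivAt.comp x (hasFDerivAt_nullPt x)
  have h1 : HasFDerivAt (fun y => (A (nullPt y)).1) (headCLM d ∘L A ∘L nullTan x) x :=
    (headCLM d).hasFDerivAt.comp x hA
  have h2 : HasFDerivAt (fun y => (A (nullPt y)).2.1) (midCLM d ∘L A ∘L nullTan x) x :=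
    (midCLM d).hasFDerivAt.comp x hA
  have h3 := (((hasDerivAt_inv h).comp_hasFDerivAt x h1)).smul h2
  refine h3.congr_fderiv ?_
  ext1 v
  rw [moebiusDeriv_apply]
  simp only [_root_.add_apply, _root_.smul_apply,
    ContinuousLinearMap.smulRight_apply, ContinuousLinearMap.comp_apply, headCLM_apply,
    midCLM_apply, Function.comp_apply, smul_eq_mul]
  module

/-- The image Q of a null point is null and orthogonal to the images of tangent vectors.
Renormalizing the first coordinate to 1 divides by that of Q and subtracts a multiple of Q, which
does not affect the form. Hence only the factor Q_0^(-2) remains. -/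
lemma inner_moebiusDeriv (A : Amb d →L[ℝ] Amb d) (hA : ∀ y z, ambForm (A y) (A z) = ambForm y z)
    (x : Euc d) (h : (A (nullPt x)).1 ≠ 0) (u v : Euc d) :
    ⟪moebiusDeriv A x u, moebiusDeriv A x v⟫_ℝ = ((A (nullPt x)).1 ^ 2)⁻¹ * ⟪u, v⟫_ℝ := by
  have h1 := hA (nullPt x) (nullPt x)
  have h2 := hA (nullPt x) (nullTan x u)
  have h3 := hA (nullPt x) (nullTan x v)
  have h4 := hA (nullTan x u) (nullTan x v)
  have e1 : ambForm (nullPt x) (nullPt x) = 0 := by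
    simp only [ambForm, nullPt, real_inner_self_eq_norm_sq]
    ring
  have e2 : ∀ v, ambForm (nullPt x) (nullTan x v) = 0 := by
    intro v
    simp [ambForm, nullPt, nullTan_apply]
  have e4 : ambForm (nullTan x u) (nullTan x v) = ⟪u, v⟫_ℝ := by
    simp [ambForm, nullTan_apply]
  rw [e1] at h1
  rw [e2] at h2 h3
  rw [e4] at h4
  rw [← h4]
  simp only [moebiusDeriv_apply]
  generalize A (nullPt x) = Q at *
  generalize A (nullTan x u) = U at *
  generalize A (nullTan x v) = V at *
  simp only [ambForm] at *
  simp only [inner_sub_left, inner_sub_right, real_inner_smul_left, real_inner_smul_right]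
  rw [real_inner_comm Q.2.1 U.2.1]
  field_simp
  linear_combination (U.1 * V.1) * h1 - (Q.1 * V.1) * h2 - (Q.1 * U.1) * h3

lemma logFactor_moebius (hd : 1 ≤ d) (A : Amb d →L[ℝ] Amb d)
    (hA : ∀ y z, ambForm (A y) (A z) = ambForm y z) (x : Euc d) (h : 0 < (A (nullPt x)).1) :
    logFactor (moebius A) x = - Real.log (A (nullPt x)).1 := by
  have hd1 := hasFDerivAt_moebius A x h.ne'
  have hin := inner_moebiusDeriv A hA x h.ne'
  have hc : ConformalAt (moebius A) x :=
    (conformalAt_iff hd1).2 ⟨_, by positivity, hin⟩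
  rw [logFactor, dif_pos hc]
  -- The conformal factor is determined by testing on a unit vector, which exists because d ≥ 1.
  set e := stdVec d ⟨0, hd⟩ with he
  have hee : ⟪e, e⟫_ℝ = 1 := by simp [he, stdVec]
  have h1 := conformalFactorAt_inner_eq_mul_inner hd1 hc e e
  rw [hin, hee, mul_one, mul_one] at h1
  rw [← h1, Real.log_inv, Real.log_pow]
  push_cast
  ring

end NullCone

/-! ### Differentiating the action of a one-parameter group -/

section OneParameter

variable {d : ℕ} (X : Amb d →L[ℝ] Amb d)

lemma hasDerivAt_exp_neg_smul (t : ℝ) :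
    HasDerivAt (fun t : ℝ => NormedSpace.exp (-(t • X))) (-X * NormedSpace.exp (-(t • X))) t := by
  have h := hasDerivAt_exp_smul_const' (𝕂 := ℝ) (-X) t
  simp only [smul_neg] at h
  exact h

lemma hasDerivAt_exp_neg_smul_apply (y : Amb d) (t : ℝ) :
    HasDerivAt (fun t : ℝ => NormedSpace.exp (-(t • X)) y)
      (-X (NormedSpace.exp (-(t • X)) y)) t :=
  (ContinuousLinearMap.apply ℝ (Amb d) y).hasFDerivAt.comp_hasDerivAt t
    (hasDerivAt_exp_neg_smul X t)

lemma exp_neg_zero_smul : NormedSpace.exp (-((0 : ℝ) • X)) = 1 := by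
  have h : (0 : ℝ) • X = 0 := zero_smul ℝ X
  rw [h, neg_zero, NormedSpace.exp_zero]

lemma hasDerivAt_ambForm {y z : ℝ → Amb d} {y' z' : Amb d} {t : ℝ} (hy : HasDerivAt y y' t)
    (hz : HasDerivAt z z' t) :
    HasDerivAt (fun t => ambForm (y t) (z t)) (ambForm y' (z t) + ambForm (y t) z') t := by
  have h1 := fun {y : ℝ → Amb d} {y' : Amb d} (hy : HasDerivAt y y' t) =>
    (headCLM d).hasFDerivAt.comp_hasDerivAt t hy
  have h2 := fun {y : ℝ → Amb d} {y' : Amb d} (hy : HasDerivAt y y' t) =>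
    (midCLM d).hasFDerivAt.comp_hasDerivAt t hy
  have h3 := fun {y : ℝ → Amb d} {y' : Amb d} (hy : HasDerivAt y y' t) =>
    ((ContinuousLinearMap.snd ℝ (Euc d) ℝ).comp
      (ContinuousLinearMap.snd ℝ ℝ (Euc d × ℝ))).hasFDerivAt.comp_hasDerivAt t hy
  have h := (((h1 hy).mul (h3 hz)).add ((h3 hy).mul (h1 hz))).add ((h2 hy).inner ℝ (h2 hz))
  refine h.congr_deriv ?_
  simp only [ambForm, headCLM, midCLM, ContinuousLinearMap.comp_apply,
    ContinuousLinearMap.coe_fst', ContinuousLinearMap.coe_snd', Function.comp_apply]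
  ring

/-- The derivative in t vanishes by skewness of X, and at t = 0 the exponential is the identity. -/
lemma ambForm_exp_neg_smul (hX : X ∈ soAlg d) (t : ℝ) (y z : Amb d) :
    ambForm (NormedSpace.exp (-(t • X)) y) (NormedSpace.exp (-(t • X)) z) = ambForm y z := by
  have h : ∀ t : ℝ, HasDerivAt (fun t : ℝ => ambForm (NormedSpace.exp (-(t • X)) y)
      (NormedSpace.exp (-(t • X)) z)) 0 t := by
    intro t
    refine (hasDerivAt_ambForm (hasDerivAt_exp_neg_smul_apply X y t)
      (hasDerivAt_exp_neg_smul_apply X z t)).congr_deriv ?_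
    have := hX (NormedSpace.exp (-(t • X)) y) (NormedSpace.exp (-(t • X)) z)
    simp only [ambForm, Prod.fst_neg, Prod.snd_neg, inner_neg_left, inner_neg_right] at this ⊢
    linear_combination -this
  have hc := is_const_of_deriv_eq_zero (fun t => (h t).differentiableAt) (fun t => (h t).deriv) t 0
  rw [hc, exp_neg_zero_smul]
  rfl

/-- The vector field generated by `X`. -/
def algField (x : Euc d) : Euc d := (X (nullPt x)).2.1 - (X (nullPt x)).1 • x

/-- The derivative of the vector field generated by `X`. -/
def algFieldDeriv (x : Euc d) : Euc d →L[ℝ] Euc d :=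
  midCLM d ∘L X ∘L nullTan x - ((X (nullPt x)).1 • ContinuousLinearMap.id ℝ (Euc d)
    + (headCLM d ∘L X ∘L nullTan x).smulRight x)

lemma hasFDerivAt_algField (x : Euc d) : HasFDerivAt (algField X) (algFieldDeriv X x) x := by
  have hA : HasFDerivAt (fun y => X (nullPt y)) (X ∘L nullTan x) x :=
    X.hasFDerivAt.comp x (hasFDerivAt_nullPt x)
  have h1 : HasFDerivAt (fun y => (X (nullPt y)).1) (headCLM d ∘L X ∘L nullTan x) x :=
    (headCLM d).hasFDerivAt.comp x hA
  have h2 : HasFDerivAt (fun y => (X (nullPt y)).2.1) (midCLM d ∘L X ∘L nullTan x) x :=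
    (midCLM d).hasFDerivAt.comp x hA
  exact h2.sub (h1.smul (hasFDerivAt_id x))

lemma hasDerivAt_head (x : Euc d) :
    HasDerivAt (fun t : ℝ => (NormedSpace.exp (-(t • X)) (nullPt x)).1) (-(X (nullPt x)).1) 0 := by
  have h := (headCLM d).hasFDerivAt.comp_hasDerivAt (0 : ℝ)
    (hasDerivAt_exp_neg_smul_apply X (nullPt x) 0)
  refine h.congr_deriv ?_
  simp [headCLM, exp_neg_zero_smul]

lemma hasDerivAt_mid (x : Euc d) :
    HasDerivAt (fun t : ℝ => (NormedSpace.exp (-(t • X)) (nullPt x)).2.1)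
      (-(X (nullPt x)).2.1) 0 := by
  have h := (midCLM d).hasFDerivAt.comp_hasDerivAt (0 : ℝ)
    (hasDerivAt_exp_neg_smul_apply X (nullPt x) 0)
  refine h.congr_deriv ?_
  simp [midCLM, exp_neg_zero_smul]

lemma hasDerivAt_moebius (x : Euc d) :
    HasDerivAt (fun t : ℝ => moebius (NormedSpace.exp (-(t • X))) x) (-algField X x) 0 := by
  have h0 : (NormedSpace.exp (-((0 : ℝ) • X)) (nullPt x)) = nullPt x := by
    rw [exp_neg_zero_smul]; rfl
  have h1 : (NormedSpace.exp (-((0 : ℝ) • X)) (nullPt x)).1 ≠ 0 := by rw [h0]; simp [nullPt]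
  have h := ((hasDerivAt_head X x).inv h1).smul (hasDerivAt_mid X x)
  refine h.congr_deriv ?_
  simp only [Pi.inv_apply, h0]
  simp [nullPt, algField]
  abel

lemma hasDerivAt_moebiusDeriv (x : Euc d) :
    HasDerivAt (fun t : ℝ => moebiusDeriv (NormedSpace.exp (-(t • X))) x)
      (-algFieldDeriv X x) 0 := by
  have h0 : (NormedSpace.exp (-((0 : ℝ) • X)) (nullPt x)) = nullPt x := by
    rw [exp_neg_zero_smul]; rfl
  have h1 : (NormedSpace.exp (-((0 : ℝ) • X)) (nullPt x)).1 ≠ 0 := by rw [h0]; simp [nullPt]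
  have h2 : (NormedSpace.exp (-((0 : ℝ) • X)) (nullPt x)).1 ^ 2 ≠ 0 := pow_ne_zero 2 h1
  have hE := hasDerivAt_exp_neg_smul X 0
  have hJ : HasDerivAt (fun t : ℝ => NormedSpace.exp (-(t • X)) ∘L nullTan x)
      (-(X ∘L nullTan x)) 0 := by
    have h := hE.clm_comp (hasDerivAt_const (0 : ℝ) (nullTan x))
    refine h.congr_deriv ?_
    rw [exp_neg_zero_smul, mul_one]
    ext1 v
    simp
  have hM := (hasDerivAt_const (0 : ℝ) (midCLM d)).clm_comp hJ
  have hH := (hasDerivAt_const (0 : ℝ) (headCLM d)).clm_comp hJ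
  have hS := (ContinuousLinearMap.smulRightL ℝ (Euc d) (Euc d)).hasDerivAt_of_bilinear
    (fun _ => hH) (fun _ => hasDerivAt_mid X x)
  have hP := (((hasDerivAt_head X x).pow 2).inv h2).smul hS
  have hQ := ((hasDerivAt_head X x).inv h1).smul hM
  refine (hQ.sub hP).congr_deriv ?_
  simp only [Pi.inv_apply, Pi.pow_apply, exp_neg_zero_smul]
  ext1 v
  simp [nullPt, nullTan_apply, headCLM, midCLM, algFieldDeriv]
  abel

lemma moebius_one (x : Euc d) : moebius (1 : Amb d →L[ℝ] Amb d) x = x := by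
  simp [moebius]

lemma moebiusDeriv_one (x : Euc d) :
    moebiusDeriv (1 : Amb d →L[ℝ] Amb d) x = ContinuousLinearMap.id ℝ (Euc d) := by
  ext1 v
  rw [moebiusDeriv_apply]
  simp [nullPt, nullTan_apply]

lemma eventually_head_pos (x : Euc d) :
    ∀ᶠ t : ℝ in nhds 0, 0 < (NormedSpace.exp (-(t • X)) (nullPt x)).1 := by
  refine (hasDerivAt_head X x).continuousAt.eventually (lt_mem_nhds ?_)
  simp [exp_neg_zero_smul, nullPt]

lemma hasDerivAt_weight (hd : 1 ≤ d) (hX : X ∈ soAlg d) (μ : ℂ) (x : Euc d) :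
    HasDerivAt (fun t : ℝ =>
      Complex.exp (μ * (logFactor (moebius (NormedSpace.exp (-(t • X)))) x : ℂ)))
      (μ * ((X (nullPt x)).1 : ℂ)) 0 := by
  have h1 : (NormedSpace.exp (-((0 : ℝ) • X)) (nullPt x)).1 ≠ 0 := by
    rw [exp_neg_zero_smul]; simp [nullPt]
  have h := (((hasDerivAt_head X x).log h1).neg.ofReal_comp.const_mul μ).cexp
  have he : ∀ᶠ t : ℝ in nhds 0,
      Complex.exp (μ * (logFactor (moebius (NormedSpace.exp (-(t • X)))) x : ℂ))
        = Complex.exp (μ * ((-Real.log (NormedSpace.exp (-(t • X)) (nullPt x)).1 : ℝ) : ℂ)) := by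
    filter_upwards [eventually_head_pos X x] with t ht
    rw [logFactor_moebius hd _ (ambForm_exp_neg_smul X hX t) x ht]
  refine HasDerivAt.congr_of_eventuallyEq (h.congr_deriv ?_) he
  simp [exp_neg_zero_smul, nullPt]

/-- The Lie derivative of a form along the vector field generated by `X`. -/
def lieAlg {p : ℕ} (w : Form d p) (x : Euc d) : (Euc d) [⋀^Fin p]→L[ℝ] ℂ :=
  fderiv ℝ w x (algField X x)
    + (w x).fderivCompContinuousLinearMap (ContinuousLinearMap.id ℝ (Euc d)) (algFieldDeriv X x)

/-- Product rule for the weight, the moving base point and the moving Jacobian. Since the map is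
that of exp(-tX), the last two contribute minus the Lie derivative. -/
lemma hasDerivAt_repCurve (hd : 1 ≤ d) (hX : X ∈ soAlg d) (μ : ℂ) {p : ℕ} {w : Form d p}
    (hw : Differentiable ℝ w) (x : Euc d) :
    HasDerivAt (repCurve μ X w x) (μ • ((X (nullPt x)).1 : ℂ) • w x - lieAlg X w x) 0 := by
  have hm := hasDerivAt_moebius X x
  have hw1 : HasDerivAt (fun t : ℝ => w (moebius (NormedSpace.exp (-(t • X))) x))
      (fderiv ℝ w x (-algField X x)) 0 := by
    have h0 : moebius (NormedSpace.exp (-((0 : ℝ) • X))) x = x := by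
      rw [exp_neg_zero_smul, moebius_one]
    have h := (hw x).hasFDerivAt
    rw [← h0] at h
    have h2 := h.comp_hasDerivAt (0 : ℝ) hm
    rw [h0] at h2
    exact h2
  have hD := hasDerivAt_moebiusDeriv X x
  have hc := (hw1.hasFDerivAt.continuousAlternatingMapCompContinuousLinearMap
    hD.hasFDerivAt).hasDerivAt
  have h := (hasDerivAt_weight X hd hX μ x).smul hc
  -- The explicit Jacobian is available only where the first coordinate is nonzero, which holds for
  -- small t; this suffices for the derivative at 0.
  have he : ∀ᶠ t : ℝ in nhds 0, repCurve μ X w x t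
      = Complex.exp (μ * (logFactor (moebius (NormedSpace.exp (-(t • X)))) x : ℂ)) •
        (w (moebius (NormedSpace.exp (-(t • X))) x)).compContinuousLinearMap
          (moebiusDeriv (NormedSpace.exp (-(t • X))) x) := by
    filter_upwards [eventually_head_pos X x] with t ht
    rw [repCurve, weightedPush, (hasFDerivAt_moebius _ x ht.ne').fderiv]
  refine HasDerivAt.congr_of_eventuallyEq (h.congr_deriv ?_) he
  have hL : logFactor (moebius (1 : Amb d →L[ℝ] Amb d)) x = 0 := by
    rw [logFactor_moebius hd 1 (fun y z => rfl) x (by simp [nullPt])]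
    simp [nullPt]
  have hid : ∀ f : (Euc d) [⋀^Fin p]→L[ℝ] ℂ,
      f.compContinuousLinearMap (ContinuousLinearMap.id ℝ (Euc d)) = f := fun f => rfl
  simp only [exp_neg_zero_smul, moebius_one, moebiusDeriv_one, hL, lieAlg]
  simp [hid, mul_smul]
  abel

end OneParameter

/-! ### Identification of the generated field with a quadratic conformal field -/

section Parameters

variable {d : ℕ} (X : Amb d →L[ℝ] Amb d)

/-- The translation part of an element of the conformal Lie algebra. -/
def algTrans (i : Fin d) : ℂ := ((X (1, 0, 0)).2.1 i : ℂ)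

/-- The rotation part of an element of the conformal Lie algebra. -/
def algRot (i j : Fin d) : ℂ := ((X (0, stdVec d j, 0)).2.1 i : ℂ)

/-- The dilation part of an element of the conformal Lie algebra. -/
def algDil : ℂ := -((X (1, 0, 0)).1 : ℂ)

/-- The part of an element of the conformal Lie algebra which generates special conformal
transformations. -/
def algSpec (i : Fin d) : ℂ := ((X (0, 0, 1)).2.1 i : ℂ)

variable {X}

lemma head_special (hX : X ∈ soAlg d) : (X (0, 0, 1)).1 = 0 := by
  have h := hX (0, 0, 1) (0, 0, 1)
  simp only [ambForm, inner_zero_left, inner_zero_right] at h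
  linarith

lemma head_rot (hX : X ∈ soAlg d) (v : Euc d) : (X (0, v, 0)).1 = -⟪v, (X (0, 0, 1)).2.1⟫_ℝ := by
  have h := hX (0, v, 0) (0, 0, 1)
  simp only [ambForm, inner_zero_right] at h
  linarith

lemma inner_stdVec_left (v : Euc d) (i : Fin d) : ⟪stdVec d i, v⟫_ℝ = v i := by
  simp [stdVec, EuclideanSpace.inner_single_left]

lemma inner_stdVec_right (v : Euc d) (i : Fin d) : ⟪v, stdVec d i⟫_ℝ = v i := by
  rw [real_inner_comm, inner_stdVec_left]

lemma algRot_skew (hX : X ∈ soAlg d) (i j : Fin d) : algRot X i j = - algRot X j i := by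
  have h := hX (0, stdVec d j, 0) (0, stdVec d i, 0)
  simp only [ambForm, inner_stdVec_left, inner_stdVec_right, mul_zero, zero_mul, zero_add] at h
  rw [algRot, algRot, ← Complex.ofReal_neg]
  congr 1
  linarith

lemma nullPt_eq (x : Euc d) :
    nullPt x = (1, 0, 0) + (∑ j, x j • (0, stdVec d j, 0)) + (-‖x‖ ^ 2 / 2) • ((0, 0, 1) : Amb d) := by
  have h : (∑ j, x j • ((0, stdVec d j, 0) : Amb d)) = (0, x, 0) := by
    have := congrArg (ContinuousLinearMap.inr ℝ ℝ (Euc d × ℝ) ∘L ContinuousLinearMap.inl ℝ (Euc d) ℝ)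
      (sum_coord_stdVec x)
    simpa [map_sum] using this
  rw [h]
  simp [nullPt]

/-- Skewness of X forces its e_0-component to vanish on the last basis vector and to be -⟨v, c⟩ on v
in ℝ^d. So the e_0-component along the null section is affine, namely -σ. -/
lemma head_nullPt (hX : X ∈ soAlg d) (x : Euc d) :
    ((X (nullPt x)).1 : ℂ) = -(confFactor (algDil X) (algSpec X) : Euc d → ℂ) x := by
  have h : (X (nullPt x)).1 = (X (1, 0, 0)).1 - ∑ j, x j * (X (0, 0, 1)).2.1 j := by
    rw [nullPt_eq, map_add, map_add, map_sum, map_smul]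
    simp only [map_smul, Prod.fst_add, Prod.fst_sum, Prod.smul_fst, head_special hX, head_rot hX,
      inner_stdVec_left, smul_eq_mul]
    simp
    ring
  rw [h]
  simp [confFactor, algDil, algSpec, coordFun]
  simp only [mul_comm]
  ring

lemma algField_apply (hX : X ∈ soAlg d) (x : Euc d) (i : Fin d) :
    (algField X x i : ℂ)
      = (confField (algTrans X) (algRot X) (algDil X) (algSpec X) i : Euc d → ℂ) x := by
  have h : (X (nullPt x)).2.1 i = (X (1, 0, 0)).2.1 i + (∑ j, x j * (X (0, stdVec d j, 0)).2.1 i)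
      + (-‖x‖ ^ 2 / 2) * (X (0, 0, 1)).2.1 i := by
    rw [nullPt_eq, map_add, map_add, map_sum, map_smul]
    simp only [map_smul, Prod.fst_add, Prod.snd_add, Prod.fst_sum, Prod.snd_sum, Prod.smul_fst,
      Prod.smul_snd, PiLp.add_apply, PiLp.smul_apply, smul_eq_mul]
    simp
  have h2 : (algField X x i : ℂ) = ((X (nullPt x)).2.1 i : ℂ) - ((X (nullPt x)).1 : ℂ) * x i := by
    simp [algField]
  rw [h2, head_nullPt hX, h, EuclideanSpace.norm_sq_eq]
  simp [confField, algTrans, algRot, algSpec, coordFun]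
  simp only [mul_comm]
  ring

lemma pderiv_confField_apply (hX : X ∈ soAlg d) (x : Euc d) (i j : Fin d) :
    (pderiv j (confField (algTrans X) (algRot X) (algDil X) (algSpec X) i) : Euc d → ℂ) x
      = (algFieldDeriv X x (stdVec d j) i : ℂ) := by
  have e : (confField (algTrans X) (algRot X) (algDil X) (algSpec X) i : Euc d → ℂ)
      = fun x => (algField X x i : ℂ) := funext fun x => (algField_apply hX x i).symm
  have h := (Complex.ofRealCLM ∘L coordCLM d i).hasFDerivAt.comp x (hasFDerivAt_algField X x)
  rw [pderiv_apply, e]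
  exact congrArg (fun T => T (stdVec d j)) h.fderiv

lemma real_smul_alt {p : ℕ} (r : ℝ) (f : (Euc d) [⋀^Fin p]→L[ℝ] ℂ) : (r : ℂ) • f = r • f := by
  ext v
  simp

/-- Matches the analytic Lie derivative with `lieOp_eq` by expanding the field and its Jacobian in
the standard basis. In degree zero there is no Jacobian term. -/
lemma lieAlg_eq (hX : X ∈ soAlg d) (w : Forms d) (p : ℕ) (x : Euc d) :
    lieAlg X (w.val p) x
      = (lieOp (confField (algTrans X) (algRot X) (algDil X) (algSpec X)) w).val p x := by
  rw [lieOp_eq]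
  simp only [LinearMap.add_apply, LinearMap.sum_apply, Module.End.mul_apply, Forms.val_add,
    Forms.val_sum, Pi.add_apply, Finset.sum_apply]
  have h1 : fderiv ℝ (w.val p) x (algField X x)
      = ∑ i, Forms.val (mulF (confField (algTrans X) (algRot X) (algDil X) (algSpec X) i)
          (dir i w)) p x := by
    conv_lhs => rw [← sum_coord_stdVec (algField X x), map_sum]
    refine Finset.sum_congr rfl fun i _ => ?_
    rw [map_smul, ← real_smul_alt, algField_apply hX]
    rfl
  rw [lieAlg, h1]
  congr 1
  cases p with
  | zero =>
    rw [ContinuousAlternatingMap.fderivCompContinuousLinearMap_of_isEmpty]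
    refine (Finset.sum_eq_zero fun i _ => Finset.sum_eq_zero fun j _ => ?_).symm
    exact smul_zero (M := ℂ) (A := (Euc d) [⋀^Fin 0]→L[ℝ] ℂ) _
  | succ p =>
    rw [ContinuousAlternatingMap.fderivCompContinuousLinearMap_eq_alternatizeUncurryFin]
    have h2 : ((ContinuousAlternatingMap.compContinuousLinearMapCLM (ContinuousLinearMap.id ℝ (Euc d))
          ∘L (w.val (p + 1) x).curryLeft).postcomp (Euc d)) (algFieldDeriv X x)
        = ∑ i, ∑ j, (algFieldDeriv X x (stdVec d j) i) •
          (coordCLM d j).smulRight ((w.val (p + 1) x).curryLeft (stdVec d i)) := by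
      ext1 v
      have hv : algFieldDeriv X x v
          = ∑ i, ∑ j, (algFieldDeriv X x (stdVec d j) i * v j) • stdVec d i := by
        conv_lhs => rw [← sum_coord_stdVec v, map_sum]
        rw [Finset.sum_comm]
        refine Finset.sum_congr rfl fun j _ => ?_
        rw [map_smul]
        conv_lhs => rw [← sum_coord_stdVec (algFieldDeriv X x (stdVec d j)), Finset.smul_sum]
        simp only [smul_smul, mul_comm]
      have hc : (((ContinuousAlternatingMap.compContinuousLinearMapCLM
          (ContinuousLinearMap.id ℝ (Euc d)) ∘L (w.val (p + 1) x).curryLeft).postcomp (Euc d))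
          (algFieldDeriv X x)) v = (w.val (p + 1) x).curryLeft (algFieldDeriv X x v) := rfl
      rw [hc, hv]
      simp only [map_sum, map_smul, _root_.sum_apply, _root_.smul_apply,
        ContinuousLinearMap.smulRight_apply, coordCLM_apply, smul_smul]
    rw [ContinuousLinearMap.comp_apply, h2]
    simp only [map_sum, map_smul]
    refine Finset.sum_congr rfl fun i _ => Finset.sum_congr rfl fun j _ => ?_
    rw [← real_smul_alt, ← pderiv_confField_apply hX]
    rfl

/-- The infinitesimal representation is given by a conformal Lie derivative. -/
lemma hasDerivAt_repCurve_val (hd : 1 ≤ d) (hX : X ∈ soAlg d) (μ : ℂ) (p : ℕ) (w : Forms d)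
    (x : Euc d) : HasDerivAt (repCurve μ X (w.val p) x)
      (-(confOp (algTrans X) (algRot X) (algDil X) (algSpec X) μ w).val p x) 0 := by
  refine (hasDerivAt_repCurve X hd hX μ (w.differentiable_val p) x).congr_deriv ?_
  rw [lieAlg_eq hX, head_nullPt hX, confOp, LinearMap.add_apply, LinearMap.smul_apply,
    Forms.val_add, Forms.val_smul, Pi.add_apply, Pi.smul_apply]
  change _ = -(_ + μ • ((confFactor (algDil X) (algSpec X) : Euc d → ℂ) x • w.val p x))
  module

lemma dRep_val (hd : 1 ≤ d) (hX : X ∈ soAlg d) (μ : ℂ) (p : ℕ) (w : Forms d) :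
    dRep μ X (w.val p)
      = (-(confOp (algTrans X) (algRot X) (algDil X) (algSpec X) μ w)).val p :=
  funext fun x => (hasDerivAt_repCurve_val hd hX μ p w x).deriv

end Parameters

/-! ### The subalgebra of fields tangent to the hyperplane -/

section Embedding

variable {m : ℕ} {X : Amb m →L[ℝ] Amb m}

lemma soEmbed_apply (X : Amb m →L[ℝ] Amb m) (a b : ℝ) (v : Euc (m + 1)) :
    soEmbed X (a, v, b) = ((X (a, proj m v, b)).1, incl m (X (a, proj m v, b)).2.1,
      (X (a, proj m v, b)).2.2) := rfl

lemma inner_incl_left (u : Euc m) (v : Euc (m + 1)) : ⟪incl m u, v⟫_ℝ = ⟪u, proj m v⟫_ℝ := by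
  rw [PiLp.inner_apply, PiLp.inner_apply, Fin.sum_univ_castSucc]
  simp [incl_castSucc, incl_last, proj_apply]

lemma inner_incl_right (u : Euc m) (v : Euc (m + 1)) : ⟪v, incl m u⟫_ℝ = ⟪proj m v, u⟫_ℝ := by
  rw [real_inner_comm, inner_incl_left, real_inner_comm]

/-- The inclusion and the orthogonal projection are adjoint, so skewness on the large space is
skewness on the small one applied to projected vectors. -/
lemma soEmbed_mem (hX : X ∈ soAlg m) : soEmbed X ∈ soAlg (m + 1) := by
  rintro ⟨a, u, b⟩ ⟨a', v, b'⟩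
  have h := hX (a, proj m u, b) (a', proj m v, b')
  simp only [soEmbed_apply, ambForm, inner_incl_left, inner_incl_right] at h ⊢
  exact h

lemma coe_incl_apply (u : Euc m) (i : Fin (m + 1)) :
    ((incl m u i : ℝ) : ℂ) = extVec (fun j => (u j : ℂ)) i := by
  refine Fin.lastCases ?_ (fun j => ?_) i
  · simp [incl_last]
  · simp [incl_castSucc]

lemma algTrans_soEmbed : algTrans (soEmbed X) = extVec (algTrans X) := by
  funext i
  rw [algTrans, soEmbed_apply, coe_incl_apply, map_zero]
  rfl

lemma algSpec_soEmbed : algSpec (soEmbed X) = extVec (algSpec X) := by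
  funext i
  rw [algSpec, soEmbed_apply, coe_incl_apply, map_zero]
  rfl

lemma algDil_soEmbed : algDil (soEmbed X) = algDil X := by
  rw [algDil, soEmbed_apply, map_zero]
  rfl

lemma algRot_soEmbed : algRot (soEmbed X) = extMat (algRot X) := by
  funext i j
  rw [algRot, soEmbed_apply, coe_incl_apply]
  refine Fin.lastCases ?_ (fun j => ?_) j
  · have h : proj m (stdVec (m + 1) (Fin.last m)) = 0 := by
      ext k
      simp [proj_apply, stdVec]
    have h0 : X (0, 0, 0) = 0 := map_zero X
    rw [h, h0, extMat_apply_last]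
    refine Fin.lastCases ?_ (fun k => ?_) i <;> simp
  · have h : proj m (stdVec (m + 1) j.castSucc) = stdVec m j := by
      ext k
      simp [proj_apply, stdVec]
    rw [h]
    refine Fin.lastCases ?_ (fun k => ?_) i
    · simp
    · simp [algRot]

end Embedding

/-! ### The intertwining relation -/

section Covariance

variable {m : ℕ}

lemma oddForms_neg (N p : ℕ) (lam : ℂ) (w : Forms (m + 1)) :
    oddForms m N p lam (-w) = -oddForms m N p lam w := by
  have h := fun j => gegenBlock_smul (lam + p - 2 * N - 1) j (2 * (N - j) + 1) (-1) w
  simp only [neg_one_smul] at h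
  simp only [oddForms_eq_sum_gegenBlock, h, smul_neg, Finset.sum_neg_distrib]

/-- Conformal covariance of the operator of odd order. -/
lemma oddForms_confOp (b : Fin m → ℂ) {A : Fin m → Fin m → ℂ} (hA : ∀ i j, A i j = - A j i)
    (s : ℂ) (c : Fin m → ℂ) (N p : ℕ) (lam : ℂ) {w : Forms (m + 1)}
    (hw : degOp w = (p : ℂ) • w) :
    oddForms m N p lam (confOp (extVec b) (extMat A) s (extVec c) (-lam - p) w)
      = confOp b A s c (-lam + 2 * N + 1 - p) (oddForms m N p lam w) := by
  have e : (-lam + 2 * N + 1 - p : ℂ) = -(lam + p - 2 * N - 1) := by ring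
  rw [oddForms_eq_sum_gegenBlock, oddForms_eq_sum_gegenBlock, e]
  refine sum_gegenBlock_confOp b A s c hA hw N (by ring) _ fun j hj => ?_
  rw [← gegenSigned_succ m N j hj lam]
  ring

lemma dRep_oddOp (hm : 1 ≤ m) {X : Amb m →L[ℝ] Amb m} (hX : X ∈ soAlg m) (N p : ℕ) (lam : ℂ)
    {w : Form (m + 1) p} (hw : ContDiff ℝ ∞ w) :
    (∀ x, DifferentiableAt ℝ (repCurve (-lam - p) (soEmbed X) w x) 0) ∧
      ContDiff ℝ ∞ (dRep (-lam - p) (soEmbed X) w) ∧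
      (∀ x, DifferentiableAt ℝ
        (repCurve (-lam + 2 * N + 1 - p) X (oddOp m N p lam w) x) 0) ∧
      dRep (-lam + 2 * N + 1 - p) X (oddOp m N p lam w) =
        oddOp m N p lam (dRep (-lam - p) (soEmbed X) w) := by
  obtain ⟨W, hW, rfl⟩ : ∃ W : Forms (m + 1), degOp W = (p : ℂ) • W ∧ W.val p = w :=
    ⟨ofForm w hw, degOp_ofForm w hw, ofForm_val w hw⟩
  have hX' := soEmbed_mem hX
  -- Both infinitesimal representations are -(L_ξ + μσ). The field for the embedded X has the
  -- parameters of the small field extended by zero, so `oddForms_confOp` applies after the signs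
  -- are pulled out.
  rw [← oddForms_val, dRep_val (Nat.le_add_left 1 m) hX', dRep_val hm hX, ← oddForms_val,
    oddForms_neg, algTrans_soEmbed, algRot_soEmbed, algDil_soEmbed, algSpec_soEmbed,
    oddForms_confOp _ (algRot_skew hX) _ _ _ _ _ hW]
  exact ⟨fun x => (hasDerivAt_repCurve_val (Nat.le_add_left 1 m) hX' _ p W x).differentiableAt,
    Forms.contDiff_val _ _, fun x => (hasDerivAt_repCurve_val hm hX _ p _ x).differentiableAt, rfl⟩

end Covariance

end SymBreak

end

open SymBreak in
theorem theorem1p2 (m N p : ℕ) (hm : 1 ≤ m) (hp : p ≤ m) (lam : ℂ) :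
    IsDiffOpOfOrderLE (2 * N + 1) (oddOp m N p lam) ∧
    (∀ i ∈ Finset.Icc 1 N, gammaCoeff (m + 1) N p i lam = gammaProd (m + 1) N p i lam) ∧
    (∀ w : Form (m + 1) p, ContDiff ℝ ∞ w →
      oddOp m N p lam w = oddOpGegenbauer m N p lam w) ∧
    (∀ X ∈ soAlg m, ∀ w : Form (m + 1) p, ContDiff ℝ ∞ w →
      (∀ x, DifferentiableAt ℝ (repCurve (-lam - p) (soEmbed X) w x) 0) ∧
      ContDiff ℝ ∞ (dRep (-lam - p) (soEmbed X) w) ∧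
      (∀ x, DifferentiableAt ℝ
        (repCurve (-lam + 2 * N + 1 - p) X (oddOp m N p lam w) x) 0) ∧
      dRep (-lam + 2 * N + 1 - p) X (oddOp m N p lam w) =
        oddOp m N p lam (dRep (-lam - p) (soEmbed X) w)) := by
  exact ⟨isDiffOpOfOrderLE_oddOp N p lam,
    fun i hi => gammaCoeff_eq_gammaProd (m + 1) N p i hi lam,
    fun w hw => oddOp_eq_oddOpGegenbauer N p lam hw,
    fun X hX w hw => dRep_oddOp hm hX N p lam hw⟩
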